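/- **Setting.** Let $\Lambda(x)=\sum_{l\ge 2}\Lambda_l x^l$ and $P(x)=\sum_{k\ge 2}P_kx^k$ be polynomials with non-negative real coefficients and $\Lambda(1)=P(1)=1$, and let $\gamma>0$. A Tanner graph has variable nodes $[n]=\{1,\dots,n\}$, $n\ge 1$, and finitely many check nodes; each check node $a$ is connected to a list $i^a_1,\dots,i^a_k$ of variable nodes, repetitions allowed. Consider the following random Tanner graphs. 1. *Standard ensemble* $(n,\Lambda,P)$, defined when $m=n\Lambda'(1)/P'(1)$ and all $n\Lambda_l$, $mP_k$ are integers: there are $m$ check nodes. Partition the variable nodes uniformly at random into classes of sizes $n\Lambda_l$ and the check nodes into classes of sizes $mP_k$, give $l$ (resp. $k$) sockets to each node of the corresponding class, and match the variable sockets with the check sockets by a uniformly random bijection. 2. *Poisson ensemble* $(n,\gamma,P)$: for each $2\le k\le \deg P$ there is an independent Poisson number, of mean $n\gamma P_k/P'(1)$, of check nodes of degree $k$; each of them is connected to $k$ independent uniformly random variable nodes. 3. *Multi-Poisson ensemble* $(n,\Lambda,P,\gamma)$, defined when all $n\Lambda_l$ are integers: partition the variable nodes uniformly at random into classes of sizes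 $n\Lambda_l$ and set $\mathsf d_i(0)=l$ for $i$ in the class of index $l$. In each of the rounds $t=0,\dots,t_{\max}-1$, where $t_{\max}=\lfloor\Lambda'(1)/\gamma\rfloor-1$ (no round if this is not positive), add for each $2\le k\le\deg P$ an independent Poisson number, of mean $n\gamma P_k/P'(1)$, of check nodes of degree $k$, each connected to $k$ independent variable nodes drawn from $w_i(t)=[\mathsf d_i(t)]_+/\sum_j[\mathsf d_j(t)]_+$; then set $\mathsf d_i(t+1)=\mathsf d_i(t)-\Delta_i(t)$, where $\Delta_i(t)$ is the number of times $i$ was chosen in round $t$. If $\sum_j[\mathsf d_j(t)]_+=0$ at the beginning of some round, the procedure fails and its output is drawn from an arbitrary fixed law $F$ on Tanner graphs with variable nodes $[n]$. Let $Q(y|x)$, $x\in\{0,1\}$, be the transition densities, with respect to some $\sigma$-finite measure on the output alphabet, of a binary-input memoryless channel. For a Tanner graph, let $H_n=H_n(\underline X|\underline Y,\underline{\hat Y})$ be the conditional entropy, in bits, of $\underline X$ given the channel output, where * for the LDGM code, $\underline X$ is uniform in $\{0,1\}^n$ and the transmitted symbols are $X_{i^a_1}\oplus\cdots\oplus X_{i^a_k}$,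 one for each check node $a$; * for the LDPC code, $\underline X$ is uniform among the $\underline x\in\{0,1\}^n$ such that $x_{i^a_1}\oplus\cdots\oplus x_{i^a_k}=0$ for every check node $a$, and the transmitted symbols are $X_1,\dots,X_n$. In this case the channel is assumed to be output-symmetric: a measurable involution of the output alphabet maps the output law given input $0$ to the output law given input $1$. **Theorem.** Fix the channel, $\Lambda$, $P$, $\gamma$, the type of code (LDGM or LDPC) and one of the three ensembles. Then $H_n$ has a finite expectation $n h_n=\mathbb E_C H_n$ over the ensemble, and there are constants $A,B>0$, independent of $n$ (and, for the multi-Poisson ensemble, of $F$), such that for every $n\ge 1$ for which the ensemble is defined and every $\varepsilon>0$ $$\mathbb P_C\{|H_n-n h_n|>n\varepsilon\}\le A\,e^{-nB\varepsilon^2},$$ where $\mathbb P_C$ is the probability with respect to the code realization. -/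

import Mathlib

open MeasureTheory ProbabilityTheory
open scoped ENNReal NNReal

noncomputable section

/-! ## Tanner graphs -/

/-- A Tanner graph on the variable nodes `Fin n`: the list of its check nodes, each check node being
given as the list `i₁, …, i_k` of the variable nodes it is connected to, one entry per edge. Multiple
edges are allowed. The position in the outer list is the label of the check node. -/
abbrev TannerGraph (n : ℕ) : Type := List (List (Fin n))

/-- The sum `x_{i₁} ⊕ ⋯ ⊕ x_{i_k}` computed by a check node. -/
def checkSum {n : ℕ} (c : List (Fin n)) (x : Fin n → ZMod 2) : ZMod 2 :=
  (c.map x).sum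

/-! ## Channels -/

/-- A binary-input channel with output alphabet `𝒜`: transition probability densities `Q(y|x)`
with respect to a σ-finite reference measure (counting measure for a countable alphabet, Lebesgue
measure for a real-valued output, and so on). -/
structure BinaryChannel (𝒜 : Type*) [MeasurableSpace 𝒜] where
  ref : Measure 𝒜
  sigmaFinite_ref : SigmaFinite ref
  density : ZMod 2 → 𝒜 → ℝ
  measurable_density : ∀ x, Measurable (density x)
  density_nonneg : ∀ x y, 0 ≤ density x y
  integral_density : ∀ x, ∫ y, density x y ∂ref = 1

attribute [instance] BinaryChannel.sigmaFinite_ref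

namespace BinaryChannel

variable {𝒜 : Type*} [MeasurableSpace 𝒜]

/-- The law of the channel output when the input is `x`. -/
def law (W : BinaryChannel 𝒜) (x : ZMod 2) : Measure 𝒜 :=
  W.ref.withDensity fun y => ENNReal.ofReal (W.density x y)

/-- Output symmetry: a measurable involution of the output alphabet exchanges the output laws of the
two inputs. -/
def OutputSymmetric (W : BinaryChannel 𝒜) : Prop :=
  ∃ τ : 𝒜 → 𝒜, Measurable τ ∧ Function.Involutive τ ∧ (W.law 0).map τ = W.law 1

end BinaryChannel

/-! ## Conditional entropy -/

/-- The conditional entropy `H(X|Y)`, in bits, of a random variable `X` with values in a finite set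
and probability mass function `p`, where given `X = x` the variable `Y` has density `Q x` with
respect to `ν`. It is the integral over `y`, against the density `∑ x, p x * Q x y` of `Y`, of the
entropy of the posterior distribution `p x * Q x y / ∑ x', p x' * Q x' y` of `X`. -/
def condEntropy {X Y : Type*} [Fintype X] [MeasurableSpace Y] (ν : Measure Y)
    (p : X → ℝ) (Q : X → Y → ℝ) : ℝ :=
  (∫ y, (∑ x, p x * Q x y) *
    ∑ x, Real.negMulLog (p x * Q x y / ∑ x', p x' * Q x' y) ∂ν) / Real.log 2

/-- The two ways of using a Tanner graph: its adjacency matrix modulo 2 is the generator matrix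
(`ldgm`) or the parity check matrix (`ldpc`) of the code. -/
inductive CodeKind
  | ldgm
  | ldpc

open Classical in
/-- The codewords of the LDPC code of `G`. -/
def ldpcCodewords {n : ℕ} (G : TannerGraph n) : Finset (Fin n → ZMod 2) :=
  Finset.univ.filter fun x => ∀ c ∈ G, checkSum c x = 0

/-- `H_n(X|Y)` for the LDGM code of `G` used over the memoryless channel `W`: `X` is a uniformly
random information message in `{0,1}^n`, and one symbol is received for each check node. -/
def ldgmEntropy {𝒜 : Type*} [MeasurableSpace 𝒜] (W : BinaryChannel 𝒜) {n : ℕ}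
    (G : TannerGraph n) : ℝ :=
  condEntropy (Measure.pi fun _ : Fin G.length => W.ref)
    (fun _ : Fin n → ZMod 2 => 1 / 2 ^ n)
    (fun x y => ∏ a, W.density (checkSum (G.get a) x) (y a))

open Classical in
/-- `H_n(X|Y)` for the LDPC code of `G` used over the memoryless channel `W`: `X` is a uniformly
random codeword, and one symbol is received for each variable node. -/
def ldpcEntropy {𝒜 : Type*} [MeasurableSpace 𝒜] (W : BinaryChannel 𝒜) {n : ℕ}
    (G : TannerGraph n) : ℝ :=
  condEntropy (Measure.pi fun _ : Fin n => W.ref)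
    (fun x : Fin n → ZMod 2 => if x ∈ ldpcCodewords G then 1 / ((ldpcCodewords G).card : ℝ) else 0)
    (fun x y => ∏ i, W.density (x i) (y i))

/-- The conditional entropy `H_n(X|Y)` for the LDGM or LDPC code of `G`. -/
def codeEntropy {𝒜 : Type*} [MeasurableSpace 𝒜] (κ : CodeKind) (W : BinaryChannel 𝒜) {n : ℕ}
    (G : TannerGraph n) : ℝ :=
  match κ with
  | .ldgm => ldgmEntropy W G
  | .ldpc => ldpcEntropy W G

/-! ## Degree sequences -/

/-- A design degree sequence: a polynomial `∑_{l ≥ 2} Λ_l x^l` with non-negative coefficients that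
sum to one. -/
structure IsDegreeSequence (Λ : Polynomial ℝ) : Prop where
  coeff_nonneg : ∀ l, 0 ≤ Λ.coeff l
  coeff_zero : Λ.coeff 0 = 0
  coeff_one : Λ.coeff 1 = 0
  eval_one : Λ.eval 1 = 1

/-- The average degree `Λ'(1)`. -/
def meanDegree (Λ : Polynomial ℝ) : ℝ := Λ.derivative.eval 1

/-- The assignments of a degree to each of `n` nodes such that exactly `n * Λ_l` nodes have degree
`l`, for every `l`; in other words the partitions of the nodes into classes of these sizes. -/
def DegreeAssignment (n : ℕ) (Λ : Polynomial ℝ) : Type :=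
  {d : Fin n → Fin (Λ.natDegree + 1) //
    ∀ l, ((Finset.univ.filter fun i => d i = l).card : ℝ) = n * Λ.coeff l}

instance (n : ℕ) (Λ : Polynomial ℝ) : Finite (DegreeAssignment n Λ) := by
  unfold DegreeAssignment; infer_instance

instance (n : ℕ) (Λ : Polynomial ℝ) : Fintype (DegreeAssignment n Λ) := Fintype.ofFinite _

/-- The degree of a node. -/
def DegreeAssignment.degree {n : ℕ} {Λ : Polynomial ℝ} (d : DegreeAssignment n Λ) (i : Fin n) : ℕ :=
  d.1 i

/-! ## Standard ensembles -/

/-- The number `m = n Λ'(1) / P'(1)` of check nodes. If this ratio is not an integer, then the type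
`StandardConfig n Λ P` below is empty. -/
def standardCheckCount (n : ℕ) (Λ P : Polynomial ℝ) : ℕ :=
  ⌊n * meanDegree Λ / meanDegree P⌋₊

/-- The choices made in the construction of a standard graph: the partition of the variable nodes,
the partition of the check nodes, and the matching of the sockets. -/
def StandardConfig (n : ℕ) (Λ P : Polynomial ℝ) : Type :=
  Σ (d : DegreeAssignment n Λ) (c : DegreeAssignment (standardCheckCount n Λ P) P),
    (Σ a, Fin (c.degree a)) ≃ (Σ i, Fin (d.degree i))

instance (n : ℕ) (Λ P : Polynomial ℝ) : Finite (StandardConfig n Λ P) := by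
  unfold StandardConfig; infer_instance

instance (n : ℕ) (Λ P : Polynomial ℝ) : Fintype (StandardConfig n Λ P) := Fintype.ofFinite _

/-- The Tanner graph obtained by connecting matched sockets. -/
def StandardConfig.graph {n : ℕ} {Λ P : Polynomial ℝ} (s : StandardConfig n Λ P) : TannerGraph n :=
  List.ofFn fun a => List.ofFn fun r : Fin (s.2.1.degree a) => (s.2.2 ⟨a, r⟩).1

/-- The standard ensemble `(n, Λ, P)`. -/
def standardEnsemble (n : ℕ) (Λ P : Polynomial ℝ) [Nonempty (StandardConfig n Λ P)] :
    PMF (TannerGraph n) :=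
  (PMF.uniformOfFintype (StandardConfig n Λ P)).map StandardConfig.graph

/-! ## Poisson ensembles -/

/-- The law of `k` independent draws from `p`. -/
def iidList {α : Type} (p : PMF α) : ℕ → PMF (List α)
  | 0 => PMF.pure []
  | k + 1 => p.bind fun a => (iidList p k).map fun as => a :: as

/-- For each `k` in the list `ks`, draw a Poisson number of check nodes of degree `k`, with mean
`μ k`, and connect each of them to `k` independent variable nodes of law `w`. -/
def poissonChecks {n : ℕ} (w : PMF (Fin n)) (μ : ℕ → ℝ≥0) : List ℕ → PMF (TannerGraph n)
  | [] => PMF.pure []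
  | k :: ks =>
      (poissonMeasure (μ k)).toPMF.bind fun m =>
        (iidList (iidList w k) m).bind fun C =>
          (poissonChecks w μ ks).map fun C' => C ++ C'

/-- The mean number `n γ P_k / P'(1)` of check nodes of degree `k`. -/
def checkRate (n : ℕ) (γ : ℝ) (P : Polynomial ℝ) (k : ℕ) : ℝ≥0 :=
  (n * γ * P.coeff k / meanDegree P).toNNReal

/-- The check nodes added in one Poisson round, of degrees `2 ≤ k ≤ k_max`. -/
def poissonRound {n : ℕ} (w : PMF (Fin n)) (γ : ℝ) (P : Polynomial ℝ) : PMF (TannerGraph n) :=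
  poissonChecks w (checkRate n γ P) (List.range' 2 (P.natDegree - 1))

/-- The Poisson ensemble `(n, γ, P)`. -/
def poissonEnsemble (n : ℕ) [NeZero n] (γ : ℝ) (P : Polynomial ℝ) : PMF (TannerGraph n) :=
  poissonRound (PMF.uniformOfFintype (Fin n)) γ P

/-! ## Multi-Poisson ensembles -/

/-- The law `w_i = [d_i]₊ / ∑ j, [d_j]₊` on the variable nodes. -/
def socketLaw {n : ℕ} (d : Fin n → ℤ) (h : ∃ i, 0 < d i) : PMF (Fin n) :=
  PMF.normalize (fun i => ((d i).toNat : ℝ≥0∞))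
    (by
      obtain ⟨i, hi⟩ := h
      intro h0
      have := ENNReal.tsum_eq_zero.1 h0 i
      simp only [Nat.cast_eq_zero] at this
      omega)
    (by
      rw [tsum_fintype]
      exact ENNReal.sum_ne_top.2 fun i _ => ENNReal.natCast_ne_top _)

open Classical in
/-- The last `t` rounds of the multi-Poisson construction, started from the numbers `d` of free
sockets and from the graph `G`. If no free socket is left at the beginning of a round, then the
procedure fails; its output is then drawn from the law `fail`. -/
def multiPoissonRounds {n : ℕ} (γ : ℝ) (P : Polynomial ℝ) (fail : PMF (TannerGraph n)) :
    ℕ → (Fin n → ℤ) → TannerGraph n → PMF (TannerGraph n)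
  | 0, _, G => PMF.pure G
  | t + 1, d, G =>
      if h : ∃ i, 0 < d i then
        (poissonRound (socketLaw d h) γ P).bind fun R =>
          multiPoissonRounds γ P fail t (fun i => d i - (R.flatten.count i : ℤ)) (G ++ R)
      else fail

/-- The multi-Poisson ensemble `(n, Λ, P, γ)`, with `⌊Λ'(1) / γ⌋ - 1` rounds. -/
def multiPoissonEnsemble (n : ℕ) (Λ P : Polynomial ℝ) (γ : ℝ) (fail : PMF (TannerGraph n))
    [Nonempty (DegreeAssignment n Λ)] : PMF (TannerGraph n) :=
  (PMF.uniformOfFintype (DegreeAssignment n Λ)).bind fun d =>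
    multiPoissonRounds γ P fail (⌊meanDegree Λ / γ⌋₊ - 1) (fun i => (d.degree i : ℤ)) []

/-! ## Concentration -/

/-- The ensemble average `h_n = (1/n) 𝔼 H` of a function `H` of a random graph of law `L`. -/
def meanPerBit {n : ℕ} (L : PMF (TannerGraph n)) (H : TannerGraph n → ℝ) : ℝ :=
  (1 / n) * ∑' G, (L G).toReal * H G

/-- `H` has an expectation under `L`, and for all `ε > 0` the probability that
`|H - n h_n| > n ε` is at most `A exp (-n B ε²)`. -/
def ConcentratesWith {n : ℕ} (A B : ℝ) (L : PMF (TannerGraph n)) (H : TannerGraph n → ℝ) : Prop :=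
  (Summable fun G => (L G).toReal * H G) ∧
    ∀ ε : ℝ, 0 < ε →
      (L.toOuterMeasure {G | |H G - n * meanPerBit L H| > n * ε}).toReal
        ≤ A * Real.exp (-(n * B * ε ^ 2))

end

noncomputable section

/-! The entropy is a Lipschitz function of the list of checks: inserting or deleting one check moves
it by at most one bit (`insertLipschitz_codeEntropy`). For LDGM codes a check is one more
observation of a bit that is a function of the message (`abs_generatorEntropy_sub_le`). For LDPC
codes it either leaves the code unchanged or keeps one of two cosets, and output symmetry gives both
cosets the same conditional entropy (`abs_ldpcEntropy_cons_sub_le`). Both arguments split an entropy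
along a binary partition, at a cost of at most one bit.

Concentration comes from exponential moments. `centeredMgf_bind_le` is a martingale step: when
randomness is revealed in stages, the moment generating functions of the conditional means multiply.
Each stage is bounded by symmetrization and `cosh x ≤ exp (x ^ 2 / 2)`, and a Chernoff bound
concludes.

In the standard ensemble, relabelling nodes shows that the mean given both degree partitions does
not depend on them. Only the matching fluctuates, and it is revealed transposition by transposition
(`centeredMgf_perm_le`). In the Poisson ensemble the checks form compound Poisson lists
(`centeredMgf_compoundPoisson_le`).

In the multi-Poisson ensemble the early rounds also influence the socket laws of the later ones. The
expected final entropy must therefore be Lipschitz in the vector of free sockets, which is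
problematic when few sockets are left. Padding the weights up to a total of at least `a = n γ`
removes the degeneracy: one socket then changes the law by `O(1/n)`, a round uses `n γ` edges on
average, and the Lipschitz constants are independent of `n` (`abs_expect_paddedRounds_sub_le`).
Since the number of rounds leaves a linear reserve of sockets, the true and padded ensembles differ
by an exponentially small amount, whatever the failure law
(`exists_abs_expect_multiPoissonEnsemble_sub_le`). This transfers the tail bound. -/

/-- A bounded real function. -/
def IsBdd {α : Type*} (f : α → ℝ) : Prop := ∃ C, ∀ x, |f x| ≤ C

/-! ### Closure properties of bounded functions. -/

namespace IsBdd

variable {α β : Type*} {f g : α → ℝ}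

theorem const (c : ℝ) : IsBdd fun _ : α => c := ⟨|c|, fun _ => le_rfl⟩

theorem add (hf : IsBdd f) (hg : IsBdd g) : IsBdd fun x => f x + g x := by
  obtain ⟨C, hC⟩ := hf
  obtain ⟨D, hD⟩ := hg
  exact ⟨C + D, fun x => (abs_add_le _ _).trans (add_le_add (hC x) (hD x))⟩

theorem sub (hf : IsBdd f) (hg : IsBdd g) : IsBdd fun x => f x - g x := by
  obtain ⟨C, hC⟩ := hf
  obtain ⟨D, hD⟩ := hg
  exact ⟨C + D, fun x => (abs_sub _ _).trans (add_le_add (hC x) (hD x))⟩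

theorem mul (hf : IsBdd f) (hg : IsBdd g) : IsBdd fun x => f x * g x := by
  obtain ⟨C, hC⟩ := hf
  obtain ⟨D, hD⟩ := hg
  refine ⟨C * D, fun x => ?_⟩
  rw [abs_mul]
  exact mul_le_mul (hC x) (hD x) (abs_nonneg _) ((abs_nonneg _).trans (hC x))

theorem comp (hf : IsBdd f) (u : β → α) : IsBdd fun y => f (u y) := by
  obtain ⟨C, hC⟩ := hf
  exact ⟨C, fun y => hC (u y)⟩

theorem exp (hf : IsBdd f) : IsBdd fun x => Real.exp (f x) := by
  obtain ⟨C, hC⟩ := hf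
  refine ⟨Real.exp C, fun x => ?_⟩
  rw [abs_of_pos (Real.exp_pos _)]
  exact Real.exp_le_exp.2 ((le_abs_self _).trans (hC x))

theorem cosh (hf : IsBdd f) : IsBdd fun x => Real.cosh (f x) := by
  obtain ⟨C, hC⟩ := hf
  refine ⟨Real.cosh C, fun x => ?_⟩
  rw [abs_of_pos (Real.cosh_pos _), Real.cosh_le_cosh]
  exact (hC x).trans (le_abs_self _)

theorem of_finite [Finite α] (f : α → ℝ) : IsBdd f := by
  cases nonempty_fintype α
  exact ⟨∑ x, |f x|, fun x =>
    Finset.single_le_sum (f := fun x => |f x|) (fun _ _ => abs_nonneg _) (Finset.mem_univ x)⟩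

end IsBdd

/-- The expectation of a real function of a discrete random variable. -/
def expect {α : Type*} (p : PMF α) (f : α → ℝ) : ℝ := ∑' x, (p x).toReal * f x

/-! ### Expectation under a discrete law: linearity, monotonicity, conditioning. -/

section Expect

variable {α β : Type*} {p : PMF α} {f g : α → ℝ}

theorem PMF.hasSum_toReal (p : PMF α) : HasSum (fun x => (p x).toReal) 1 := by
  have h := ENNReal.hasSum_toReal (f := p) p.tsum_coe_ne_top
  rwa [← ENNReal.tsum_toReal_eq (fun a => p.apply_ne_top a), p.tsum_coe, ENNReal.toReal_one] at h

theorem IsBdd.summable (hf : IsBdd f) (p : PMF α) : Summable fun x => (p x).toReal * f x := by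
  obtain ⟨C, hC⟩ := hf
  refine Summable.of_norm_bounded (g := fun x => (p x).toReal * C)
    (p.hasSum_toReal.summable.mul_right C) fun x => ?_
  rw [Real.norm_eq_abs, abs_mul, abs_of_nonneg ENNReal.toReal_nonneg]
  exact mul_le_mul_of_nonneg_left (hC x) ENNReal.toReal_nonneg

theorem expect_const (p : PMF α) (c : ℝ) : expect p (fun _ => c) = c := by
  rw [expect, tsum_mul_right, p.hasSum_toReal.tsum_eq, one_mul]

theorem expect_add (hf : IsBdd f) (hg : IsBdd g) :
    expect p (fun x => f x + g x) = expect p f + expect p g := by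
  simp only [expect, mul_add]
  exact (hf.summable p).tsum_add (hg.summable p)

theorem expect_sub (hf : IsBdd f) (hg : IsBdd g) :
    expect p (fun x => f x - g x) = expect p f - expect p g := by
  simp only [expect, mul_sub]
  exact (hf.summable p).tsum_sub (hg.summable p)

theorem expect_const_mul (p : PMF α) (c : ℝ) (f : α → ℝ) :
    expect p (fun x => c * f x) = c * expect p f := by
  simp only [expect, ← tsum_mul_left]
  exact tsum_congr fun x => by ring

theorem expect_mul_const (p : PMF α) (c : ℝ) (f : α → ℝ) :
    expect p (fun x => f x * c) = expect p f * c := by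
  simp only [expect, ← tsum_mul_right]
  exact tsum_congr fun x => by ring

theorem PMF.toReal_mul_le {x : α} {a b : ℝ} (h : x ∈ p.support → a ≤ b) :
    (p x).toReal * a ≤ (p x).toReal * b := by
  by_cases hx : x ∈ p.support
  · exact mul_le_mul_of_nonneg_left (h hx) ENNReal.toReal_nonneg
  · rw [(p.apply_eq_zero_iff x).2 hx]; simp

theorem expect_mono (hf : IsBdd f) (hg : IsBdd g) (h : ∀ x ∈ p.support, f x ≤ g x) :
    expect p f ≤ expect p g :=
  (hf.summable p).tsum_le_tsum (fun x => PMF.toReal_mul_le (h x)) (hg.summable p)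

theorem expect_congr (h : ∀ x ∈ p.support, f x = g x) : expect p f = expect p g :=
  tsum_congr fun x => by
    by_cases hx : x ∈ p.support
    · rw [h x hx]
    · rw [(p.apply_eq_zero_iff x).2 hx]; simp

/-- A bounded function lies in expectation below any function dominating it that has an
expectation. -/
theorem expect_le_of_hasSum {S : ℝ} (hf : IsBdd f) (hg : HasSum (fun x => (p x).toReal * g x) S)
    (h : ∀ x ∈ p.support, f x ≤ g x) : expect p f ≤ S := by
  rw [← hg.tsum_eq]
  exact (hf.summable p).tsum_le_tsum (fun x => PMF.toReal_mul_le (h x)) hg.summable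

theorem expect_le {C : ℝ} (hf : IsBdd f) (h : ∀ x ∈ p.support, f x ≤ C) : expect p f ≤ C :=
  (expect_mono hf (IsBdd.const C) h).trans_eq (expect_const p C)

theorem le_expect {C : ℝ} (hf : IsBdd f) (h : ∀ x ∈ p.support, C ≤ f x) : C ≤ expect p f :=
  (expect_const p C).symm.trans_le (expect_mono (IsBdd.const C) hf h)

theorem expect_nonneg (hf : IsBdd f) (h : ∀ x, 0 ≤ f x) : 0 ≤ expect p f :=
  le_expect hf fun x _ => h x

theorem abs_expect_le {C : ℝ} (hf : IsBdd f) (h : ∀ x ∈ p.support, |f x| ≤ C) :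
    |expect p f| ≤ C :=
  abs_le.2 ⟨le_expect hf fun x hx => (abs_le.1 (h x hx)).1,
    expect_le hf fun x hx => (abs_le.1 (h x hx)).2⟩

theorem abs_expect_sub_le {C : ℝ} (hf : IsBdd f) (hg : IsBdd g)
    (h : ∀ x ∈ p.support, |f x - g x| ≤ C) : |expect p f - expect p g| ≤ C := by
  rw [← expect_sub hf hg]
  exact abs_expect_le (hf.sub hg) h

theorem IsBdd.expect {q : α → PMF β} {F : α → β → ℝ}
    (hF : IsBdd fun x : α × β => F x.1 x.2) : IsBdd fun a => expect (q a) (F a) := by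
  obtain ⟨C, hC⟩ := hF
  exact ⟨C, fun a => abs_expect_le ⟨C, fun b => hC (a, b)⟩ fun b _ => hC (a, b)⟩

theorem expect_pure (a : α) (f : α → ℝ) : expect (PMF.pure a) f = f a := by
  rw [expect, tsum_eq_single a]
  · simp
  · intro b hb; simp [hb]

/-- Fubini for a double series, absolutely summable because `f` is bounded and the weights are those
of a joint law. -/
theorem expect_bind (p : PMF α) (q : α → PMF β) {f : β → ℝ} (hf : IsBdd f) :
    expect (p.bind q) f = expect p fun a => expect (q a) f := by
  obtain ⟨C, hC⟩ := hf
  have h1 : ∀ b, ((p.bind q) b).toReal * f b = ∑' a, (p a).toReal * ((q a b).toReal * f b) := by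
    intro b
    rw [PMF.bind_apply, ENNReal.tsum_toReal_eq fun a =>
      ENNReal.mul_ne_top (p.apply_ne_top a) ((q a).apply_ne_top b), ← tsum_mul_right]
    exact tsum_congr fun a => by rw [ENNReal.toReal_mul, mul_assoc]
  have hs : Summable fun x : α × β => (p x.1).toReal * ((q x.1 x.2).toReal * f x.2) := by
    have h2 : Summable fun x : α × β => (p x.1).toReal * ((q x.1 x.2).toReal * |C|) := by
      have h0 : (0 : α × β → ℝ) ≤ fun x => (p x.1).toReal * ((q x.1 x.2).toReal * |C|) :=
        fun x => mul_nonneg ENNReal.toReal_nonneg (mul_nonneg ENNReal.toReal_nonneg (abs_nonneg C))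
      rw [summable_prod_of_nonneg h0]
      have h3 : ∀ a, HasSum (fun b => (p a).toReal * ((q a b).toReal * |C|))
          ((p a).toReal * (1 * |C|)) := fun a => ((q a).hasSum_toReal.mul_right |C|).mul_left _
      refine ⟨fun a => (h3 a).summable, ?_⟩
      simp only [(h3 _).tsum_eq]
      exact p.hasSum_toReal.summable.mul_right _
    refine Summable.of_norm_bounded h2 fun x => ?_
    rw [Real.norm_eq_abs, abs_mul, abs_mul, abs_of_nonneg ENNReal.toReal_nonneg,
      abs_of_nonneg ENNReal.toReal_nonneg]
    exact mul_le_mul_of_nonneg_left (mul_le_mul_of_nonneg_left ((hC x.2).trans (le_abs_self C))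
      ENNReal.toReal_nonneg) ENNReal.toReal_nonneg
  simp only [expect, h1]
  rw [← Summable.tsum_comm (f := fun b a => (p a).toReal * ((q a b).toReal * f b)) hs.prod_symm]
  exact tsum_congr fun a => tsum_mul_left

theorem expect_map (p : PMF α) (u : α → β) {f : β → ℝ} (hf : IsBdd f) :
    expect (p.map u) f = expect p fun a => f (u a) := by
  rw [← PMF.bind_pure_comp, expect_bind _ _ hf]
  simp only [Function.comp, expect_pure]

theorem expect_uniformOfFintype [Fintype α] [Nonempty α] (f : α → ℝ) :
    expect (PMF.uniformOfFintype α) f = (∑ x, f x) / Fintype.card α := by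
  rw [expect, tsum_fintype, Finset.sum_div]
  refine Finset.sum_congr rfl fun x _ => ?_
  rw [PMF.uniformOfFintype_apply, ENNReal.toReal_inv, ENNReal.toReal_natCast]
  ring

end Expect

/-! ## Exponential moments -/

/-- The moment generating function of `f - 𝔼 f`. -/
def centeredMgf {α : Type*} (p : PMF α) (f : α → ℝ) (t : ℝ) : ℝ :=
  expect p fun x => Real.exp (t * (f x - expect p f))

section CenteredMgf

variable {α β : Type*} {p : PMF α} {f g : α → ℝ}

theorem IsBdd.exp_centered (hf : IsBdd f) (t c : ℝ) :
    IsBdd fun x => Real.exp (t * (f x - c)) :=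
  ((IsBdd.const t).mul (hf.sub (IsBdd.const c))).exp

theorem centeredMgf_map (p : PMF α) (u : α → β) {f : β → ℝ} (hf : IsBdd f) (t : ℝ) :
    centeredMgf (p.map u) f t = centeredMgf p (fun a => f (u a)) t := by
  rw [centeredMgf, centeredMgf, expect_map p u hf, expect_map p u (hf.exp_centered _ _)]

/-- Jensen's inequality for the exponential, obtained by integrating the tangent line at the mean.
-/
theorem exp_mul_sub_expect_le (hf : IsBdd f) (t c : ℝ) :
    Real.exp (t * (c - expect p f)) ≤ expect p fun y => Real.exp (t * (c - f y)) := by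
  set m := expect p f with hm
  have hlin : IsBdd fun y => Real.exp (t * (c - m)) * (t * (m - f y) + 1) :=
    (IsBdd.const _).mul (((IsBdd.const t).mul ((IsBdd.const m).sub hf)).add (IsBdd.const 1))
  have hle : ∀ y, Real.exp (t * (c - m)) * (t * (m - f y) + 1) ≤ Real.exp (t * (c - f y)) := by
    intro y
    have : t * (c - f y) = t * (c - m) + t * (m - f y) := by ring
    rw [this, Real.exp_add]
    exact mul_le_mul_of_nonneg_left (Real.add_one_le_exp _) (Real.exp_pos _).le
  have hval : expect p (fun y => Real.exp (t * (c - m)) * (t * (m - f y) + 1)) =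
      Real.exp (t * (c - m)) := by
    rw [expect_const_mul, expect_add ((IsBdd.const t).mul ((IsBdd.const m).sub hf))
      (IsBdd.const 1), expect_const_mul, expect_sub (IsBdd.const m) hf, expect_const, expect_const]
    rw [← hm]; ring
  rw [← hval]
  exact expect_mono hlin (((IsBdd.const t).mul ((IsBdd.const c).sub hf)).exp) fun y _ => hle y

/-- Symmetrization: the moment generating function is at most that of the difference of two
independent copies. -/
theorem centeredMgf_le_expect_cosh (hf : IsBdd f) (t : ℝ) :
    centeredMgf p f t ≤ expect p fun x => expect p fun y => Real.cosh (t * (f x - f y)) := by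
  have hb : ∀ s : ℝ, IsBdd fun z : α × α => Real.exp (s * (f z.1 - f z.2)) := fun s =>
    ((IsBdd.const s).mul ((hf.comp Prod.fst).sub (hf.comp Prod.snd))).exp
  have h1 : centeredMgf p f t ≤
      expect p fun x => expect p fun y => Real.exp (t * (f x - f y)) :=
    expect_mono (hf.exp_centered _ _) (hb t).expect fun x _ => exp_mul_sub_expect_le hf t (f x)
  -- Exchanging the two independent copies reverses the sign of `t`; averaging this with `h1`
  -- produces the hyperbolic cosine.
  have h2 : centeredMgf p f t ≤
      expect p fun x => expect p fun y => Real.exp (-t * (f x - f y)) := by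
    refine h1.trans_eq ?_
    have e1 := expect_bind (p.bind fun x => p.map (Prod.mk x)) (fun z => PMF.pure z) (hb t)
    have e2 : (p.bind fun x => p.map (Prod.mk x)) =
        p.bind fun y => p.map fun x => (x, y) := by
      simp only [← PMF.bind_pure_comp]
      exact PMF.bind_comm p p _
    have e3 : expect (p.bind fun x => p.map (Prod.mk x))
        (fun z : α × α => Real.exp (t * (f z.1 - f z.2))) =
        expect p fun x => expect p fun y => Real.exp (t * (f x - f y)) := by
      rw [expect_bind _ _ (hb t)]
      exact expect_congr fun x _ => expect_map _ _ (hb t)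
    rw [← e3, e2, expect_bind _ _ (hb t)]
    refine expect_congr fun x _ => ?_
    rw [expect_map _ _ (hb t)]
    exact expect_congr fun y _ => by congr 1; ring
  have h3 : (expect p fun x => expect p fun y => Real.cosh (t * (f x - f y))) =
      ((expect p fun x => expect p fun y => Real.exp (t * (f x - f y))) +
        expect p fun x => expect p fun y => Real.exp (-t * (f x - f y))) / 2 := by
    rw [← expect_add (hb t).expect (hb (-t)).expect, div_eq_mul_inv, ← expect_mul_const]
    refine expect_congr fun x _ => ?_
    rw [← expect_add ((hb t).comp (Prod.mk x)) ((hb (-t)).comp (Prod.mk x)), ← expect_mul_const]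
    refine expect_congr fun y _ => ?_
    rw [Real.cosh_eq]
    ring_nf
  rw [h3]
  linarith

/-- Hoeffding's lemma with the constant 1/2 in place of the optimal 1/8, which symmetrization gives
at once. -/
theorem centeredMgf_le_of_osc (hf : IsBdd f) {c : ℝ}
    (h : ∀ x ∈ p.support, ∀ y ∈ p.support, |f x - f y| ≤ c) (t : ℝ) :
    centeredMgf p f t ≤ Real.exp (t ^ 2 * c ^ 2 / 2) := by
  have hb : IsBdd fun z : α × α => Real.cosh (t * (f z.1 - f z.2)) :=
    ((IsBdd.const t).mul ((hf.comp Prod.fst).sub (hf.comp Prod.snd))).cosh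
  refine (centeredMgf_le_expect_cosh hf t).trans
    (expect_le hb.expect fun x hx => expect_le (hb.comp (Prod.mk x)) fun y hy => ?_)
  refine (Real.cosh_le_exp_half_sq _).trans (Real.exp_le_exp.2 ?_)
  rw [mul_pow, ← sq_abs (f x - f y)]
  have := pow_le_pow_left₀ (abs_nonneg _) (h x hx y hy) 2
  have := mul_le_mul_of_nonneg_left this (sq_nonneg t)
  linarith

theorem centeredMgf_bind_eq (p : PMF α) (q : α → PMF β) {f : β → ℝ} (hf : IsBdd f) (t : ℝ) :
    centeredMgf (p.bind q) f t = expect p fun a =>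
      Real.exp (t * (expect (q a) f - expect p fun a => expect (q a) f)) *
        centeredMgf (q a) f t := by
  rw [centeredMgf, expect_bind p q (hf.exp_centered _ _), expect_bind p q hf]
  refine expect_congr fun a _ => ?_
  rw [centeredMgf, ← expect_const_mul]
  refine expect_congr fun b _ => ?_
  rw [← Real.exp_add]
  ring_nf

theorem IsBdd.centeredMgf {q : α → PMF β} {f : β → ℝ} (hf : IsBdd f) (t : ℝ) :
    IsBdd fun a => centeredMgf (q a) f t := by
  have h1 : IsBdd fun a => _root_.expect (q a) f := (hf.comp Prod.snd).expect
  exact IsBdd.expect (F := fun a b => Real.exp (t * (f b - _root_.expect (q a) f)))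
    (((IsBdd.const t).mul ((hf.comp Prod.snd).sub (h1.comp Prod.fst))).exp)

theorem centeredMgf_nonneg (p : PMF α) (f : α → ℝ) (t : ℝ) : 0 ≤ centeredMgf p f t :=
  tsum_nonneg fun _ => mul_nonneg ENNReal.toReal_nonneg (Real.exp_pos _).le

/-- One step of the Azuma martingale method: the deviation of `f` is that of its conditional mean
plus that around the conditional mean, and the latter is controlled uniformly in the condition. -/
theorem centeredMgf_bind_le (p : PMF α) (q : α → PMF β) {f : β → ℝ} (hf : IsBdd f) {t B : ℝ}
    (hB : ∀ a ∈ p.support, centeredMgf (q a) f t ≤ B) :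
    centeredMgf (p.bind q) f t ≤ centeredMgf p (fun a => expect (q a) f) t * B := by
  have h1 : IsBdd fun a => expect (q a) f := (hf.comp Prod.snd).expect
  rw [centeredMgf_bind_eq p q hf, centeredMgf, ← expect_mul_const]
  exact expect_mono ((h1.exp_centered _ _).mul (hf.centeredMgf t))
    ((h1.exp_centered _ _).mul (IsBdd.const B))
    fun a ha => mul_le_mul_of_nonneg_left (hB a ha) (Real.exp_pos _).le

end CenteredMgf

/-! ## Lists of independent draws -/

section IidList

variable {α : Type} {p : PMF α}

theorem expect_iidList_succ (p : PMF α) (m : ℕ) {f : List α → ℝ} (hf : IsBdd f) :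
    expect (iidList p (m + 1)) f = expect p fun a => expect (iidList p m) fun l => f (a :: l) := by
  rw [iidList, expect_bind _ _ hf]
  exact expect_congr fun a _ => expect_map _ _ hf

theorem length_of_mem_support_iidList {m : ℕ} {l : List α} (hl : l ∈ (iidList p m).support) :
    l.length = m := by
  induction m generalizing l with
  | zero => simp_all [iidList]
  | succ m ih =>
    simp only [iidList, PMF.mem_support_bind_iff, PMF.mem_support_map_iff] at hl
    obtain ⟨a, -, l', hl', rfl⟩ := hl
    simp [ih hl']

theorem mem_support_of_mem_iidList {m : ℕ} {l : List α} (hl : l ∈ (iidList p m).support) :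
    ∀ a ∈ l, a ∈ p.support := by
  induction m generalizing l with
  | zero => simp_all [iidList]
  | succ m ih =>
    simp only [iidList, PMF.mem_support_bind_iff, PMF.mem_support_map_iff] at hl
    obtain ⟨a, ha, l', hl', rfl⟩ := hl
    intro b hb
    rcases List.mem_cons.1 hb with rfl | hb
    · exact ha
    · exact ih hl' b hb

/-- The bounded-differences inequality, revealing one entry at a time. The predicate `S` restricts
the comparison to entries that can occur, such as checks of a given degree. -/
theorem centeredMgf_iidList_le {S : α → Prop} (hS : ∀ a ∈ p.support, S a) {c : ℝ} (m : ℕ)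
    {f : List α → ℝ} (hf : IsBdd f)
    (h : ∀ l r a b, S a → S b → |f (l ++ a :: r) - f (l ++ b :: r)| ≤ c) (t : ℝ) :
    centeredMgf (iidList p m) f t ≤ Real.exp (m * (t ^ 2 * c ^ 2 / 2)) := by
  induction m generalizing f with
  | zero =>
    simp only [iidList, centeredMgf, expect_pure]
    simp
  | succ m ih =>
    have hcons : ∀ a, IsBdd fun l => f (a :: l) := fun a => hf.comp _
    refine (centeredMgf_bind_le p _ hf (B := Real.exp (m * (t ^ 2 * c ^ 2 / 2)))
      fun a _ => ?_).trans ?_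
    · rw [centeredMgf_map _ _ hf]
      exact ih (hcons a) fun l r => h (a :: l) r
    · have h1 : IsBdd fun a => expect ((iidList p m).map fun as => a :: as) f :=
        (hf.comp Prod.snd).expect
      refine (mul_le_mul_of_nonneg_right (centeredMgf_le_of_osc h1 (c := c) (fun a ha b hb => ?_) t)
        (Real.exp_pos _).le).trans_eq ?_
      · rw [expect_map _ _ hf, expect_map _ _ hf]
        exact abs_expect_sub_le (hcons a) (hcons b) fun l _ => h [] l a b (hS a ha) (hS b hb)
      · rw [← Real.exp_add]
        push_cast
        ring_nf

end IidList

/-! ## Poisson variables -/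

section Poisson

theorem poisson_toPMF_toReal (μ : ℝ≥0) (m : ℕ) :
    ((poissonMeasure μ).toPMF m).toReal = Real.exp (-μ) * μ ^ m / m.factorial := by
  rw [Measure.toPMF_apply, ← measureReal_def, poissonMeasure_real_singleton]

theorem hasSum_poisson_exp (μ : ℝ≥0) (s : ℝ) :
    HasSum (fun m : ℕ => ((poissonMeasure μ).toPMF m).toReal * Real.exp (s * m))
      (Real.exp (μ * (Real.exp s - 1))) := by
  have h := (NormedSpace.expSeries_div_hasSum_exp (μ * Real.exp s : ℝ)).mul_left (Real.exp (-μ))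
  rw [← Real.exp_eq_exp_ℝ, ← Real.exp_add] at h
  convert! h using 1
  · funext m
    rw [poisson_toPMF_toReal, mul_pow, ← Real.exp_nat_mul, mul_comm s]
    ring
  · ring_nf

/-- The term at zero vanishes, and each later term is `μ` times the preceding Poisson weight. -/
theorem hasSum_poisson_mean (μ : ℝ≥0) :
    HasSum (fun m : ℕ => ((poissonMeasure μ).toPMF m).toReal * (m : ℝ)) μ := by
  have h0 := (poissonMeasure μ).toPMF.hasSum_toReal.mul_left (μ : ℝ)
  rw [mul_one] at h0
  rw [← hasSum_nat_add_iff' 1]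
  simp only [Finset.range_one, Finset.sum_singleton, Nat.cast_zero, mul_zero, sub_zero]
  convert! h0 using 1
  funext m
  rw [poisson_toPMF_toReal, poisson_toPMF_toReal, Nat.factorial_succ]
  have : (m.factorial : ℝ) ≠ 0 := by positivity
  push_cast
  field_simp
  ring

theorem exp_sub_one_le_two_mul {x : ℝ} (h0 : 0 ≤ x) (h1 : x ≤ 1) : Real.exp x - 1 ≤ 2 * x := by
  have := Real.abs_exp_sub_one_le (x := x) (by rwa [abs_of_nonneg h0])
  rw [abs_of_nonneg h0] at this
  exact (le_abs_self _).trans this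

theorem abs_sub_le_of_step {g : ℕ → ℝ} {A : ℝ} (hA : ∀ m, |g (m + 1) - g m| ≤ A) (m k : ℕ) :
    |g m - g k| ≤ A * |(m : ℝ) - k| := by
  have h : ∀ k j : ℕ, |g (k + j) - g k| ≤ A * j := by
    intro k j
    induction j with
    | zero => simp
    | succ j ih =>
      have := abs_sub_le (g (k + (j + 1))) (g (k + j)) (g k)
      have := hA (k + j)
      push_cast
      rw [add_assoc] at this
      linarith
  rcases le_total k m with hk | hk
  · obtain ⟨j, rfl⟩ := Nat.exists_eq_add_of_le hk
    simpa using h k j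
  · obtain ⟨j, rfl⟩ := Nat.exists_eq_add_of_le hk
    rw [abs_sub_comm, abs_sub_comm (m : ℝ)]
    simpa using h m j

/-- The oscillation of `g` is not controlled by `A`, only its increments are. After symmetrization
`g` may be replaced by `A` times the identity, and the difference of two Poisson variables has the
explicit exponential moment `exp (2 μ (cosh s - 1))` with `s = t A`. Smallness of `s` makes this
quadratic in the exponent. -/
theorem centeredMgf_poisson_le (μ : ℝ≥0) {g : ℕ → ℝ} (hg : IsBdd g) {A : ℝ}
    (hA : ∀ m, |g (m + 1) - g m| ≤ A) {t : ℝ} (ht : |t| * A ≤ 1) :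
    centeredMgf (poissonMeasure μ).toPMF g t ≤ Real.exp (2 * μ * (t * A) ^ 2) := by
  have hA0 : 0 ≤ A := (abs_nonneg _).trans (hA 0)
  set s := t * A with hs
  have hb : IsBdd fun z : ℕ × ℕ => Real.cosh (t * (g z.1 - g z.2)) :=
    ((IsBdd.const t).mul ((hg.comp Prod.fst).sub (hg.comp Prod.snd))).cosh
  have hcosh : ∀ m k : ℕ, Real.cosh (t * (g m - g k)) ≤
      Real.exp (s * m) / 2 * Real.exp (-s * k) + Real.exp (-s * m) / 2 * Real.exp (s * k) := by
    intro m k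
    have h1 : Real.cosh (t * (g m - g k)) ≤ Real.cosh (s * (m - k)) := by
      rw [Real.cosh_le_cosh, abs_mul, abs_mul, hs, abs_mul, abs_of_nonneg hA0, mul_assoc]
      exact mul_le_mul_of_nonneg_left (abs_sub_le_of_step hA m k) (abs_nonneg _)
    refine h1.trans_eq ?_
    rw [Real.cosh_eq, div_mul_eq_mul_div, div_mul_eq_mul_div, ← Real.exp_add, ← Real.exp_add,
      ← add_div]
    ring_nf
  have hin : ∀ m : ℕ, (expect (poissonMeasure μ).toPMF fun k => Real.cosh (t * (g m - g k))) ≤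
      Real.exp (s * m) * (Real.exp (μ * (Real.exp (-s) - 1)) / 2) +
        Real.exp (-s * m) * (Real.exp (μ * (Real.exp s - 1)) / 2) := by
    intro m
    refine expect_le_of_hasSum (hb.comp (Prod.mk m)) ?_ fun k _ => hcosh m k
    convert! ((hasSum_poisson_exp μ (-s)).mul_left (Real.exp (s * m) / 2)).add
      ((hasSum_poisson_exp μ s).mul_left (Real.exp (-s * m) / 2)) using 1
    · funext k; ring
    · ring
  refine (centeredMgf_le_expect_cosh hg t).trans ?_
  refine (expect_le_of_hasSum hb.expect (g := fun m : ℕ =>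
      Real.exp (s * m) * (Real.exp (μ * (Real.exp (-s) - 1)) / 2) +
        Real.exp (-s * m) * (Real.exp (μ * (Real.exp s - 1)) / 2))
      (S := Real.exp (μ * (Real.exp s - 1)) * Real.exp (μ * (Real.exp (-s) - 1))) ?_
      fun m _ => hin m).trans ?_
  · convert! ((hasSum_poisson_exp μ s).mul_right (Real.exp (μ * (Real.exp (-s) - 1)) / 2)).add
      ((hasSum_poisson_exp μ (-s)).mul_right (Real.exp (μ * (Real.exp s - 1)) / 2)) using 1
    · funext m; ring
    · ring
  · rw [← Real.exp_add, Real.exp_le_exp]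
    have h1 : Real.cosh s - 1 ≤ s ^ 2 := by
      have hs1 : s ^ 2 ≤ 1 := by
        rw [← sq_abs, hs, abs_mul, abs_of_nonneg hA0]
        exact pow_le_one₀ (by positivity) ht
      have := exp_sub_one_le_two_mul (x := s ^ 2 / 2) (by positivity) (by linarith)
      have := Real.cosh_le_exp_half_sq s
      linarith
    rw [Real.cosh_eq] at h1
    have := mul_le_mul_of_nonneg_left h1 (NNReal.coe_nonneg μ)
    nlinarith

/-- Two sources fluctuate: the number `m` of entries and the entries themselves. The conditional
bound grows with `m`, so `centeredMgf_bind_le` is not applicable; the product of the two factors is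
split by `x y ≤ (x² + y²) / 2` instead. Squaring doubles `t`, hence the factor 2 in the condition on
`t`. -/
theorem centeredMgf_compoundPoisson_le {α : Type} {p : PMF α} {S : α → Prop}
    (hS : ∀ a ∈ p.support, S a) (μ : ℝ≥0) {f : List α → ℝ} (hf : IsBdd f) {A : ℝ}
    (h : ∀ l r a, S a → |f (l ++ a :: r) - f (l ++ r)| ≤ A) {t : ℝ} (ht : 2 * |t| * A ≤ 1) :
    centeredMgf ((poissonMeasure μ).toPMF.bind (iidList p)) f t ≤
      Real.exp (8 * μ * (t * A) ^ 2) := by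
  obtain ⟨a0, ha0⟩ := p.support_nonempty
  have hA0 : 0 ≤ A := (abs_nonneg _).trans (h [] [] a0 (hS a0 ha0))
  have hg : IsBdd fun m => expect (iidList p m) f := (hf.comp Prod.snd).expect
  set g : ℕ → ℝ := fun m => expect (iidList p m) f with hgdef
  have hstep : ∀ m, |g (m + 1) - g m| ≤ A := by
    intro m
    have h1 : g m = expect p fun _ => g m := (expect_const _ _).symm
    rw [h1, hgdef]
    simp only
    rw [expect_iidList_succ p m hf]
    refine abs_expect_sub_le ((hf.comp fun z : α × List α => z.1 :: z.2).expect) (IsBdd.const _)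
      fun a ha => ?_
    exact abs_expect_sub_le (hf.comp _) hf fun l _ => h [] l a (hS a ha)
  set s := t * A with hs
  have hs1 : 4 * s ^ 2 ≤ 1 := by
    have h0 : 0 ≤ 2 * |t| * A := by positivity
    have := pow_le_one₀ (n := 2) h0 ht
    rw [mul_pow, mul_pow, sq_abs] at this
    rw [hs, mul_pow]
    linarith
  have hin : ∀ m : ℕ, centeredMgf (iidList p m) f t ≤ Real.exp (2 * s ^ 2 * m) := by
    intro m
    -- Replacing an entry is a deletion followed by an insertion.
    refine (centeredMgf_iidList_le hS (c := 2 * A) m hf (fun l r a b ha hb => ?_) t).trans_eq ?_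
    · have h1 := abs_sub_le (f (l ++ a :: r)) (f (l ++ r)) (f (l ++ b :: r))
      have h2 := h l r a ha
      have h3 := h l r b hb
      rw [abs_sub_comm] at h3
      linarith
    · rw [hs]; ring_nf
  rw [centeredMgf_bind_eq _ _ hf]
  set M := expect (poissonMeasure μ).toPMF fun m => expect (iidList p m) f with hM
  have hE : IsBdd fun m => Real.exp (t * (g m - M)) := hg.exp_centered _ _
  have hC : IsBdd fun m => centeredMgf (iidList p m) f t := hf.centeredMgf t
  have hhalf : IsBdd fun m => centeredMgf (iidList p m) f t ^ 2 := by
    simpa only [sq] using hC.mul hC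
  have hE2 : IsBdd fun m => Real.exp (2 * t * (g m - M)) := hg.exp_centered _ _
  have key : (expect (poissonMeasure μ).toPMF fun m =>
      Real.exp (t * (g m - M)) * centeredMgf (iidList p m) f t) ≤
      (expect (poissonMeasure μ).toPMF fun m => Real.exp (2 * t * (g m - M))) * (1 / 2) +
        (expect (poissonMeasure μ).toPMF fun m => centeredMgf (iidList p m) f t ^ 2) * (1 / 2) := by
    rw [← expect_mul_const, ← expect_mul_const, ← expect_add (hE2.mul (IsBdd.const _))
      (hhalf.mul (IsBdd.const _))]
    refine expect_mono (hE.mul hC) ((hE2.mul (IsBdd.const _)).add (hhalf.mul (IsBdd.const _)))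
      fun m _ => ?_
    have : Real.exp (2 * t * (g m - M)) = Real.exp (t * (g m - M)) ^ 2 := by
      rw [← Real.exp_nat_mul]; push_cast; ring_nf
    rw [this]
    nlinarith [sq_nonneg (Real.exp (t * (g m - M)) - centeredMgf (iidList p m) f t)]
  have k1 : (expect (poissonMeasure μ).toPMF fun m => Real.exp (2 * t * (g m - M))) ≤
      Real.exp (8 * μ * s ^ 2) := by
    refine (centeredMgf_poisson_le μ hg hstep (t := 2 * t) ?_).trans_eq ?_
    · rwa [abs_mul, abs_two]
    · rw [hs]; ring_nf
  have k2 : (expect (poissonMeasure μ).toPMF fun m => centeredMgf (iidList p m) f t ^ 2) ≤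
      Real.exp (8 * μ * s ^ 2) := by
    refine (expect_le_of_hasSum hhalf (hasSum_poisson_exp μ (4 * s ^ 2)) fun m _ => ?_).trans ?_
    · refine (pow_le_pow_left₀ (centeredMgf_nonneg _ _ _) (hin m) 2).trans_eq ?_
      rw [← Real.exp_nat_mul]; push_cast; ring_nf
    · rw [Real.exp_le_exp]
      have := mul_le_mul_of_nonneg_left
        (exp_sub_one_le_two_mul (x := 4 * s ^ 2) (by positivity) hs1) (NNReal.coe_nonneg μ)
      linarith
  linarith

end Poisson

/-! ## Poisson rounds -/

/-- Inserting an entry of length at most `K` changes `f` by at most `A`. -/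
def InsertLipschitz {α : Type*} (K : ℕ) (A : ℝ) (f : List (List α) → ℝ) : Prop :=
  ∀ l r c, c.length ≤ K → |f (l ++ c :: r) - f (l ++ r)| ≤ A

section PoissonChecks

variable {n : ℕ} {K : ℕ} {A : ℝ}

theorem InsertLipschitz.append_left {f : TannerGraph n → ℝ} (h : InsertLipschitz K A f)
    (C : TannerGraph n) : InsertLipschitz K A fun R => f (C ++ R) := fun l r c hc => by
  simpa using h (C ++ l) r c hc

theorem poissonChecks_cons (w : PMF (Fin n)) (μ : ℕ → ℝ≥0) (k : ℕ) (ks : List ℕ) :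
    poissonChecks w μ (k :: ks) = ((poissonMeasure (μ k)).toPMF.bind
      (iidList (iidList w k))).bind fun C => (poissonChecks w μ ks).map fun C' => C ++ C' := by
  rw [PMF.bind_bind]; rfl

theorem centeredMgf_poissonChecks_le (w : PMF (Fin n)) (μ : ℕ → ℝ≥0) (ks : List ℕ)
    (hks : ∀ k ∈ ks, k ≤ K) {f : TannerGraph n → ℝ} (hf : IsBdd f) (h : InsertLipschitz K A f)
    {t : ℝ} (ht : 2 * |t| * A ≤ 1) :
    centeredMgf (poissonChecks w μ ks) f t ≤
      Real.exp (8 * (ks.map fun k => (μ k : ℝ)).sum * (t * A) ^ 2) := by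
  induction ks generalizing f with
  | nil => simp [poissonChecks, centeredMgf, expect_pure]
  | cons k ks ih =>
    rw [poissonChecks_cons]
    refine (centeredMgf_bind_le _ _ hf
      (B := Real.exp (8 * (ks.map fun k => (μ k : ℝ)).sum * (t * A) ^ 2)) fun C _ => ?_).trans ?_
    · rw [centeredMgf_map _ _ hf]
      exact ih (fun k hk => hks k (List.mem_cons_of_mem _ hk)) (hf.comp _) (h.append_left C)
    · have h1 : IsBdd fun C => expect ((poissonChecks w μ ks).map fun C' => C ++ C') f :=
        (hf.comp Prod.snd).expect
      refine (mul_le_mul_of_nonneg_right (centeredMgf_compoundPoisson_le (A := A)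
        (S := fun c => c.length = k) (fun a ha => length_of_mem_support_iidList ha) (μ k) h1
        (fun l r a ha => ?_) ht) (Real.exp_pos _).le).trans_eq ?_
      · rw [expect_map _ _ hf, expect_map _ _ hf]
        refine abs_expect_sub_le (hf.comp _) (hf.comp _) fun R _ => ?_
        simpa using h l (r ++ R) a (ha.trans_le (hks k List.mem_cons_self))
      · rw [← Real.exp_add, List.map_cons, List.sum_cons]
        ring_nf

end PoissonChecks

/-! ## Comparison of laws -/

/-- The `ℓ¹` distance of two laws on a finite set. -/
def lawDist {α : Type*} [Fintype α] (w w' : PMF α) : ℝ := ∑ i, |(w i).toReal - (w' i).toReal|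

section ChangeOfLaw

/-- Both laws have mass one, so a constant can be subtracted from `f`, after which `f` is bounded by
its oscillation. -/
theorem abs_expect_sub_le_lawDist {α : Type*} [Fintype α] (w w' : PMF α) {f : α → ℝ} {c : ℝ}
    (h : ∀ a b, |f a - f b| ≤ c) : |expect w f - expect w' f| ≤ c * lawDist w w' := by
  obtain ⟨a0, -⟩ := w.support_nonempty
  have h1 : ∀ v : PMF α, expect v f = (∑ i, (v i).toReal * (f i - f a0)) + f a0 := by
    intro v
    have h2 := expect_sub (p := v) (IsBdd.of_finite f) (IsBdd.const (f a0))
    rw [expect_const] at h2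
    rw [← sub_eq_iff_eq_add, ← h2, expect, tsum_fintype]
  rw [h1, h1, add_sub_add_right_eq_sub, ← Finset.sum_sub_distrib, lawDist, Finset.mul_sum]
  refine (Finset.abs_sum_le_sum_abs _ _).trans (Finset.sum_le_sum fun i _ => ?_)
  rw [← sub_mul, abs_mul, mul_comm]
  exact mul_le_mul_of_nonneg_right (h i a0) (abs_nonneg _)

/-- A hybrid argument: `p` is exchanged for `p'` entry by entry. The cost `D` of one exchange is a
hypothesis, so that the lemma can be nested, once for the checks in a list and once for the nodes in
a check. The length condition keeps the inner comparison among checks of equal degree. -/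
theorem abs_expect_iidList_sub_le {α : Type} {p p' : PMF α} {S : α → Prop} {c D : ℝ}
    (hD : ∀ g : α → ℝ, IsBdd g → (∀ a b, S a → S b → |g a - g b| ≤ c) →
      |expect p g - expect p' g| ≤ D) (m : ℕ) {f : List α → ℝ} (hf : IsBdd f)
    (h : ∀ l r a b, l.length + r.length + 1 = m → S a → S b →
      |f (l ++ a :: r) - f (l ++ b :: r)| ≤ c) :
    |expect (iidList p m) f - expect (iidList p' m) f| ≤ m * D := by
  induction m generalizing f with
  | zero => simp [iidList]
  | succ m ih =>
    rw [expect_iidList_succ _ _ hf, expect_iidList_succ _ _ hf]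
    have hb : IsBdd fun z : α × List α => f (z.1 :: z.2) := hf.comp _
    have h1 : |(expect p fun a => expect (iidList p m) fun l => f (a :: l)) -
        expect p fun a => expect (iidList p' m) fun l => f (a :: l)| ≤ m * D := by
      refine abs_expect_sub_le hb.expect hb.expect fun a ha => ih (hf.comp _) ?_
      intro l r b b' hl
      exact h (a :: l) r b b' (by simp only [List.length_cons]; omega)
    have h2 : |(expect p fun a => expect (iidList p' m) fun l => f (a :: l)) -
        expect p' fun a => expect (iidList p' m) fun l => f (a :: l)| ≤ D := by
      refine hD _ hb.expect fun a b ha hb => ?_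
      refine abs_expect_sub_le (hf.comp _) (hf.comp _) fun l hl => h [] l a b ?_ ha hb
      rw [length_of_mem_support_iidList hl]; simp
    have h3 := abs_sub_le (expect p fun a => expect (iidList p m) fun l => f (a :: l))
      (expect p fun a => expect (iidList p' m) fun l => f (a :: l))
      (expect p' fun a => expect (iidList p' m) fun l => f (a :: l))
    push_cast
    linarith

/-- Each edge endpoint drawn from the wrong law costs at most the oscillation `2 * A`, a deletion
and an insertion, times the distance of the laws. The prefactor is the mean number of edges. -/
theorem abs_expect_poissonChecks_sub_le {n K : ℕ} {A : ℝ} (w w' : PMF (Fin n)) (μ : ℕ → ℝ≥0)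
    (ks : List ℕ) (hks : ∀ k ∈ ks, k ≤ K) {f : TannerGraph n → ℝ} (hf : IsBdd f)
    (h : InsertLipschitz K A f) :
    |expect (poissonChecks w μ ks) f - expect (poissonChecks w' μ ks) f| ≤
      (ks.map fun k => (μ k : ℝ) * k).sum * (2 * A * lawDist w w') := by
  induction ks generalizing f with
  | nil => simp [poissonChecks]
  | cons k ks ih =>
    have hk : k ≤ K := hks k List.mem_cons_self
    have hb : IsBdd fun z : TannerGraph n × TannerGraph n => f (z.1 ++ z.2) := hf.comp _
    have e : ∀ v : PMF (Fin n), expect (poissonChecks v μ (k :: ks)) f =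
        expect (poissonMeasure (μ k)).toPMF fun m => expect (iidList (iidList v k) m) fun C =>
          expect (poissonChecks v μ ks) fun C' => f (C ++ C') := by
      intro v
      rw [poissonChecks, expect_bind _ _ hf]
      refine expect_congr fun m _ => ?_
      rw [expect_bind _ _ hf]
      exact expect_congr fun C _ => expect_map _ _ hf
    rw [e, e]
    -- Hybrid laws: `v` draws the checks of degree `k`, and `u` those of the remaining degrees.
    set X := fun (v u : PMF (Fin n)) (m : ℕ) => expect (iidList (iidList v k) m) fun C =>
          expect (poissonChecks u μ ks) fun C' => f (C ++ C') with hX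
    have hbe : ∀ u, IsBdd fun C => expect (poissonChecks u μ ks) fun C' => f (C ++ C') :=
      fun u => hb.expect
    have hXb : ∀ v u, IsBdd (X v u) := fun v u => IsBdd.expect
      (F := fun _ C => expect (poissonChecks u μ ks) fun C' => f (C ++ C')) ((hbe u).comp Prod.snd)
    have hlip : ∀ u, InsertLipschitz K A fun C => expect (poissonChecks u μ ks)
        fun C' => f (C ++ C') := by
      intro u l r c hc
      refine abs_expect_sub_le (hf.comp _) (hf.comp _) fun R _ => ?_
      simpa using h l (r ++ R) c hc
    have h1 : |expect (poissonMeasure (μ k)).toPMF (X w w) -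
        expect (poissonMeasure (μ k)).toPMF (X w w')| ≤
        (ks.map fun k => (μ k : ℝ) * k).sum * (2 * A * lawDist w w') := by
      refine abs_expect_sub_le (hXb w w) (hXb w w') fun m _ => ?_
      refine abs_expect_sub_le hb.expect hb.expect fun C _ => ?_
      exact ih (fun j hj => hks j (List.mem_cons_of_mem _ hj)) (hf.comp _) (h.append_left C)
    have h2 : ∀ m, |X w w' m - X w' w' m| ≤ m * (k * (2 * A * lawDist w w')) := by
      intro m
      refine abs_expect_iidList_sub_le (S := fun c => c.length = k) (c := 2 * A)
        (fun g hg hosc => ?_) m hb.expect ?_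
      · refine abs_expect_iidList_sub_le (S := fun _ => True) (c := 2 * A) (fun g' _ h' => abs_expect_sub_le_lawDist w w' fun a b =>
            h' a b trivial trivial) k hg fun l r a b hl _ _ => hosc _ _ ?_ ?_
        · simpa [add_assoc] using hl
        · simpa [add_assoc] using hl
      · intro l r a b _ ha hb
        have h3 := hlip w' l r a (ha.trans_le hk)
        have h4 := hlip w' l r b (hb.trans_le hk)
        rw [abs_sub_comm] at h4
        exact (abs_sub_le _ _ _).trans ((add_le_add h3 h4).trans_eq (two_mul A).symm)
    have h3 : |expect (poissonMeasure (μ k)).toPMF (X w w') -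
        expect (poissonMeasure (μ k)).toPMF (X w' w')| ≤
        μ k * (k * (2 * A * lawDist w w')) := by
      have hs := (hasSum_poisson_mean (μ k)).mul_right (k * (2 * A * lawDist w w'))
      simp only [mul_assoc] at hs
      rw [← expect_sub (hXb w w') (hXb w' w'), abs_le']
      constructor
      · simpa only [mul_assoc] using expect_le_of_hasSum ((hXb w w').sub (hXb w' w')) hs
          fun m _ => (le_abs_self _).trans (by simpa only [mul_assoc] using h2 m)
      · rw [expect_sub (hXb w w') (hXb w' w'), neg_sub, ← expect_sub (hXb w' w') (hXb w w')]
        refine (expect_le_of_hasSum ((hXb w' w').sub (hXb w w')) hs fun m _ => ?_).trans_eq ?_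
        · refine (le_abs_self _).trans ?_
          rw [abs_sub_comm]
          simpa only [mul_assoc] using h2 m
        · simp only [mul_assoc]
    have h4 := abs_sub_le (expect (poissonMeasure (μ k)).toPMF (X w w))
      (expect (poissonMeasure (μ k)).toPMF (X w w'))
      (expect (poissonMeasure (μ k)).toPMF (X w' w'))
    rw [List.map_cons, List.sum_cons]
    refine h4.trans ((add_le_add h1 h3).trans_eq ?_)
    ring

theorem length_flatten_of_mem_iidList {n k m : ℕ} {w : PMF (Fin n)} {C : TannerGraph n}
    (hC : C ∈ (iidList (iidList w k) m).support) : C.flatten.length = k * m := by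
  have h1 : C.map List.length = List.replicate m k := by
    rw [List.eq_replicate_iff]
    refine ⟨by rw [List.length_map, length_of_mem_support_iidList hC], fun j hj => ?_⟩
    obtain ⟨c, hc, rfl⟩ := List.mem_map.1 hj
    exact length_of_mem_support_iidList (mem_support_of_mem_iidList hC c hc)
  rw [List.length_flatten, h1, List.sum_replicate, smul_eq_mul, mul_comm]

/-- Exponential moments of the number of edges. -/
theorem expect_poissonChecks_le_of_le_exp {n : ℕ} (w : PMF (Fin n)) (μ : ℕ → ℝ≥0) (ks : List ℕ)
    {F : TannerGraph n → ℝ} (hF : IsBdd F) {c θ : ℝ}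
    (h : ∀ R, F R ≤ c * Real.exp (θ * R.flatten.length)) :
    expect (poissonChecks w μ ks) F ≤
      c * Real.exp ((ks.map fun k => (μ k : ℝ) * (Real.exp (θ * k) - 1)).sum) := by
  induction ks generalizing F c with
  | nil => simpa [poissonChecks, expect_pure] using h []
  | cons k ks ih =>
    rw [poissonChecks_cons, PMF.bind_bind, expect_bind _ _ hF]
    set M := Real.exp ((ks.map fun k => (μ k : ℝ) * (Real.exp (θ * k) - 1)).sum) with hM
    have hb : IsBdd fun m => expect ((iidList (iidList w k) m).bind fun C =>
        (poissonChecks w μ ks).map fun C' => C ++ C') F := (hF.comp Prod.snd).expect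
    have hle : ∀ m : ℕ, expect ((iidList (iidList w k) m).bind fun C =>
        (poissonChecks w μ ks).map fun C' => C ++ C') F ≤ Real.exp (θ * k * m) * (c * M) := by
      intro m
      rw [expect_bind _ _ hF]
      have hb' : IsBdd fun C => expect ((poissonChecks w μ ks).map fun C' => C ++ C') F :=
        (hF.comp Prod.snd).expect
      refine expect_le hb' fun C hC => ?_
      rw [expect_map _ _ hF]
      refine (ih (hF.comp _) (c := c * Real.exp (θ * C.flatten.length)) fun R => ?_).trans_eq ?_
      · refine (h (C ++ R)).trans_eq ?_
        rw [mul_assoc, ← Real.exp_add, List.flatten_append, List.length_append]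
        push_cast
        ring_nf
      · rw [length_flatten_of_mem_iidList hC]
        push_cast
        ring_nf
    have hsum : HasSum (fun m : ℕ => ((poissonMeasure (μ k)).toPMF m).toReal *
        (Real.exp (θ * k * m) * (c * M))) (Real.exp (μ k * (Real.exp (θ * k) - 1)) * (c * M)) := by
      simpa only [mul_assoc] using (hasSum_poisson_exp (μ k) (θ * k)).mul_right (c * M)
    refine (expect_le_of_hasSum hb hsum fun m _ => hle m).trans_eq ?_
    rw [hM, List.map_cons, List.sum_cons, Real.exp_add]
    ring

end ChangeOfLaw

/-! ## Random permutations -/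

section RandomPermutations

open Equiv

theorem expect_uniformOfFintype_equiv {α β : Type*} [Fintype α] [Nonempty α] [Fintype β]
    [Nonempty β] (e : α ≃ β) (f : β → ℝ) :
    expect (PMF.uniformOfFintype β) f = expect (PMF.uniformOfFintype α) fun a => f (e a) := by
  rw [expect_uniformOfFintype, expect_uniformOfFintype, Fintype.card_congr e, e.sum_comp]

/-- This exhibits a uniform permutation as a two-stage experiment, the image of 0 and then a
permutation of the rest, so that the martingale step applies. -/
theorem expect_uniform_perm_succ {n : ℕ} (f : Perm (Fin (n + 1)) → ℝ) :
    expect (PMF.uniformOfFintype (Perm (Fin (n + 1)))) f =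
      expect ((PMF.uniformOfFintype (Fin (n + 1))).bind fun p =>
        (PMF.uniformOfFintype (Perm (Fin n))).map fun e => Perm.decomposeFin.symm (p, e)) f := by
  rw [expect_bind _ _ (IsBdd.of_finite f), expect_uniformOfFintype_equiv Perm.decomposeFin.symm,
    expect_uniformOfFintype, expect_uniformOfFintype]
  simp only [expect_map _ _ (IsBdd.of_finite f), expect_uniformOfFintype]
  rw [← Finset.sum_div, Fintype.sum_prod_type, Fintype.card_prod, div_div]
  push_cast
  rw [mul_comm (Fintype.card (Perm (Fin n)) : ℝ)]

theorem decomposeFin_symm_eq {n : ℕ} (p : Fin (n + 1)) (e : Perm (Fin n)) :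
    Perm.decomposeFin.symm (p, e) = swap 0 p * Perm.decomposeFin.symm (0, e) := by
  ext i
  refine Fin.cases ?_ (fun i => ?_) i <;> simp

theorem decomposeFin_symm_swap_mul {n : ℕ} (a b : Fin n) (e : Perm (Fin n)) :
    Perm.decomposeFin.symm (0, swap a b * e) =
      swap a.succ b.succ * Perm.decomposeFin.symm (0, e) := by
  ext i
  refine Fin.cases ?_ (fun i => ?_) i
  · rw [Perm.decomposeFin_symm_apply_zero, Perm.mul_apply, Perm.decomposeFin_symm_apply_zero,
      swap_apply_of_ne_of_ne (Fin.succ_ne_zero a).symm (Fin.succ_ne_zero b).symm]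
  · simp [(Fin.succ_injective n).swap_apply]

/-- Once the image of 0 is revealed, a transposition of the remaining permutation is conjugate to a
transposition of the whole, so the hypothesis is inherited. Two images `p` and `p'` are compared
through the permutation fixing 0: it is one transposition away from either, whence `2 * c`. -/
theorem centeredMgf_perm_le (n : ℕ) {f : Perm (Fin n) → ℝ} {c : ℝ}
    (h : ∀ a b σ, |f (swap a b * σ) - f σ| ≤ c) (t : ℝ) :
    centeredMgf (PMF.uniformOfFintype (Perm (Fin n))) f t ≤
      Real.exp (n * (t ^ 2 * (2 * c) ^ 2 / 2)) := by
  induction n with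
  | zero =>
    refine (centeredMgf_le_of_osc (IsBdd.of_finite f) (c := 0) (fun x _ y _ => ?_) t).trans_eq ?_
    · rw [Subsingleton.elim x y]; simp
    · simp
  | succ n ih =>
    have hf := IsBdd.of_finite f
    rw [centeredMgf, expect_uniform_perm_succ, expect_uniform_perm_succ]
    refine (centeredMgf_bind_le _ _ hf (B := Real.exp (n * (t ^ 2 * (2 * c) ^ 2 / 2)))
      fun p _ => ?_).trans ?_
    · rw [centeredMgf_map _ _ hf]
      refine ih fun a b σ => ?_
      rw [decomposeFin_symm_eq, decomposeFin_symm_swap_mul, ← mul_assoc, mul_swap_eq_swap_mul,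
        mul_assoc, ← decomposeFin_symm_eq]
      exact h _ _ _
    · refine (mul_le_mul_of_nonneg_right (centeredMgf_le_of_osc (IsBdd.of_finite _) (c := 2 * c)
        (fun p _ p' _ => ?_) t) (Real.exp_pos _).le).trans_eq ?_
      · rw [expect_map _ _ hf, expect_map _ _ hf]
        refine abs_expect_sub_le (IsBdd.of_finite _) (IsBdd.of_finite _) fun e _ => ?_
        rw [decomposeFin_symm_eq p, decomposeFin_symm_eq p']
        have h1 := h 0 p (Perm.decomposeFin.symm (0, e))
        have h2 := h 0 p' (Perm.decomposeFin.symm (0, e))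
        rw [abs_sub_comm] at h2
        exact (abs_sub_le _ _ _).trans ((add_le_add h1 h2).trans_eq (two_mul c).symm)
      · rw [← Real.exp_add]
        push_cast
        ring_nf

theorem centeredMgf_equiv_le {α β : Type*} [Fintype (α ≃ β)] [Nonempty (α ≃ β)] [Fintype β]
    [DecidableEq β] {f : (α ≃ β) → ℝ} {c : ℝ}
    (h : ∀ a b e, |f (e.trans (swap a b)) - f e| ≤ c) (t : ℝ) :
    centeredMgf (PMF.uniformOfFintype (α ≃ β)) f t ≤
      Real.exp (Fintype.card β * (t ^ 2 * (2 * c) ^ 2 / 2)) := by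
  obtain ⟨e0⟩ := ‹Nonempty (α ≃ β)›
  have eβ := Fintype.equivFin β
  let Φ : Perm (Fin (Fintype.card β)) ≃ (α ≃ β) := equivCongr (e0.trans eβ).symm eβ.symm
  rw [centeredMgf, expect_uniformOfFintype_equiv Φ, expect_uniformOfFintype_equiv Φ]
  refine centeredMgf_perm_le _ (f := fun σ => f (Φ σ)) (fun a b σ => ?_) t
  have : Φ (swap a b * σ) = (Φ σ).trans (swap (eβ.symm a) (eβ.symm b)) := by
    ext x
    simp [Φ, equivCongr, eβ.symm.injective.swap_apply]
  rw [this]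
  exact h _ _ _

end RandomPermutations

/-! ## Tail bounds -/

section Tail

open Classical in
/-- The probability that `f` is at distance more than `r` from `c`. -/
def tailProb {α : Type*} (p : PMF α) (f : α → ℝ) (c r : ℝ) : ℝ :=
  expect p fun x => if r < |f x - c| then 1 else 0

open Classical in
theorem IsBdd.ite {α : Type*} (q : α → Prop) : IsBdd fun x => if q x then (1 : ℝ) else 0 :=
  ⟨1, fun x => by dsimp only; split_ifs <;> simp⟩

theorem tailProb_le_of_centeredMgf {α : Type*} {p : PMF α} {f : α → ℝ} (hf : IsBdd f) {t V : ℝ}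
    (h1 : centeredMgf p f t ≤ V) (h2 : centeredMgf p f (-t) ≤ V) (ht : 0 ≤ t) (r : ℝ) :
    tailProb p f (expect p f) r ≤ 2 * (V * Real.exp (-(t * r))) := by
  set M := expect p f
  have hb : ∀ s, IsBdd fun x => Real.exp (s * (f x - M)) := fun s => hf.exp_centered s M
  have h3 : tailProb p f M r ≤ expect p fun x =>
      (Real.exp (t * (f x - M)) + Real.exp (-t * (f x - M))) * Real.exp (-(t * r)) := by
    refine expect_mono (IsBdd.ite _) (((hb t).add (hb (-t))).mul (IsBdd.const _)) fun x _ => ?_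
    split_ifs with hx
    · rw [add_mul, ← Real.exp_add, ← Real.exp_add]
      rcases lt_abs.1 hx with h | h
      · have := Real.one_le_exp (x := t * (f x - M) + -(t * r)) (by nlinarith)
        have := Real.exp_pos (-t * (f x - M) + -(t * r))
        linarith
      · have := Real.one_le_exp (x := -t * (f x - M) + -(t * r)) (by nlinarith)
        have := Real.exp_pos (t * (f x - M) + -(t * r))
        linarith
    · positivity
  rw [expect_mul_const, expect_add (hb t) (hb (-t))] at h3
  have := mul_le_mul_of_nonneg_right (add_le_add h1 h2) (Real.exp_pos (-(t * r))).le
  refine h3.trans (this.trans_eq (by ring))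

variable {n : ℕ} {L : PMF (TannerGraph n)} {H : TannerGraph n → ℝ}

theorem abs_sub_expect_le_of_mem_Icc {α : Type*} {p : PMF α} {f : α → ℝ} {b : ℝ}
    (hf : ∀ x, f x ∈ Set.Icc 0 b) (x : α) : |f x - expect p f| ≤ b := by
  have hb : IsBdd f := ⟨b, fun x => by rw [abs_of_nonneg (hf x).1]; exact (hf x).2⟩
  have h1 : 0 ≤ expect p f := expect_nonneg hb fun x => (hf x).1
  have h2 : expect p f ≤ b := expect_le hb fun x _ => (hf x).2
  have := hf x
  exact abs_le.2 ⟨by linarith [this.1], by linarith [this.2]⟩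

theorem tailProb_eq_zero {α : Type*} {p : PMF α} {f : α → ℝ} {c r : ℝ}
    (h : ∀ x, |f x - c| ≤ r) : tailProb p f c r = 0 := by
  rw [tailProb]
  exact (expect_congr fun x _ => if_neg (h x).not_gt).trans (expect_const p 0)

/-- The Chernoff parameter is `s * ε` with `s = min t₀ (1 / (2 * v))`: it is admissible for `ε ≤ 1`,
and the quadratic term consumes at most half of the gain `n s ε²`. For `ε > 1` the event is empty,
because `H` takes values in `[0, n]`. -/
theorem tailProb_mgf_le (hH : ∀ G, H G ∈ Set.Icc 0 (n : ℝ)) {t₀ v : ℝ} (ht₀ : 0 < t₀)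
    (hv : 0 < v) (hm : ∀ t, |t| ≤ t₀ → centeredMgf L H t ≤ Real.exp (n * v * t ^ 2)) {ε : ℝ}
    (hε : 0 < ε) :
    tailProb L H (expect L H) (n * ε) ≤
      2 * Real.exp (-(n * (min t₀ (1 / (2 * v)) / 2) * ε ^ 2)) := by
  have hb : IsBdd H := ⟨n, fun x => by rw [abs_of_nonneg (hH x).1]; exact (hH x).2⟩
  set s := min t₀ (1 / (2 * v)) with hs
  have hs0 : 0 < s := lt_min ht₀ (by positivity)
  have hsv : s * v ≤ 1 / 2 := by
    refine (mul_le_mul_of_nonneg_right (min_le_right t₀ (1 / (2 * v))) hv.le).trans_eq ?_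
    field_simp
  rcases le_or_gt ε 1 with h1 | h1
  · have ht : |s * ε| ≤ t₀ := by
      rw [abs_of_pos (by positivity)]
      exact (mul_le_of_le_one_right hs0.le h1).trans (min_le_left _ _)
    have hneg := hm (-(s * ε)) (by rwa [abs_neg])
    rw [neg_sq] at hneg
    refine (tailProb_le_of_centeredMgf hb (hm _ ht) hneg (by positivity) _).trans ?_
    rw [← Real.exp_add]
    refine mul_le_mul_of_nonneg_left (Real.exp_le_exp.2 ?_) zero_le_two
    have hn : (0 : ℝ) ≤ n := Nat.cast_nonneg n
    have : (n : ℝ) * s * ε ^ 2 * (s * v) ≤ n * s * ε ^ 2 * (1 / 2) :=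
      mul_le_mul_of_nonneg_left hsv (by positivity)
    nlinarith
  · rw [tailProb_eq_zero]
    · positivity
    · intro x
      refine (abs_sub_expect_le_of_mem_Icc hH x).trans ?_
      exact le_mul_of_one_le_right (Nat.cast_nonneg n) h1.le

theorem concentratesWith_of_tailProb [NeZero n] (hH : ∀ G, H G ∈ Set.Icc 0 (n : ℝ)) {A B : ℝ}
    (h : ∀ ε : ℝ, 0 < ε → ε ≤ 1 →
      tailProb L H (expect L H) (n * ε) ≤ A * Real.exp (-(n * B * ε ^ 2))) (hA : 0 ≤ A) :
    ConcentratesWith A B L H := by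
  have hb : IsBdd H := ⟨n, fun x => by rw [abs_of_nonneg (hH x).1]; exact (hH x).2⟩
  refine ⟨hb.summable L, fun ε hε => ?_⟩
  have hn : (n : ℝ) ≠ 0 := Nat.cast_ne_zero.2 (NeZero.ne n)
  have hmean : n * meanPerBit L H = expect L H := by
    rw [meanPerBit, ← mul_assoc, mul_one_div_cancel hn, one_mul]; rfl
  have h1 : (L.toOuterMeasure {G | |H G - n * meanPerBit L H| > n * ε}).toReal =
      tailProb L H (expect L H) (n * ε) := by
    rw [hmean, PMF.toOuterMeasure_apply, ENNReal.tsum_toReal_eq]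
    · refine tsum_congr fun G => ?_
      dsimp only
      by_cases hG : n * ε < |H G - expect L H|
      · rw [Set.indicator_of_mem (by exact hG), if_pos hG, mul_one]
      · rw [Set.indicator_of_notMem (by exact hG), if_neg hG, mul_zero, ENNReal.toReal_zero]
    · intro G
      exact ne_top_of_le_ne_top (L.apply_ne_top G) (Set.indicator_le_self _ _ G)
  rw [h1]
  rcases le_or_gt ε 1 with h2 | h2
  · exact h ε hε h2
  · rw [tailProb_eq_zero]
    · positivity
    · intro x
      refine (abs_sub_expect_le_of_mem_Icc hH x).trans ?_
      exact le_mul_of_one_le_right (Nat.cast_nonneg n) h2.le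

end Tail

/-! ## Entropy of a finite non-negative weight -/

/-- The entropy of the weight `a` restricted to `s`, in natural units: the total mass times the
entropy of the normalized weight. -/
def entropyOn {X : Type*} (s : Finset X) (a : X → ℝ) : ℝ :=
  ∑ x ∈ s, Real.negMulLog (a x) - Real.negMulLog (∑ x ∈ s, a x)

section EntropyOn

variable {X : Type*} {s : Finset X} {a b : X → ℝ}

theorem entropyOn_congr (h : ∀ x ∈ s, a x = b x) : entropyOn s a = entropyOn s b := by
  rw [entropyOn, entropyOn, Finset.sum_congr rfl h,
    Finset.sum_congr rfl fun x hx => congrArg Real.negMulLog (h x hx)]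

/-- The correction by the total mass cancels the `c log c` terms. Homogeneity allows density factors
that do not depend on `x` to be pulled out without normalizing any posterior. -/
theorem entropyOn_const_mul (s : Finset X) (c : ℝ) (a : X → ℝ) :
    entropyOn s (fun x => c * a x) = c * entropyOn s a := by
  simp only [entropyOn, ← Finset.mul_sum, Real.negMulLog_mul, Finset.sum_add_distrib,
    ← Finset.sum_mul]
  ring

theorem entropyOn_map {Y : Type*} (s : Finset Y) (u : Y ↪ X) (a : X → ℝ) :
    entropyOn (s.map u) a = entropyOn s fun y => a (u y) := by
  simp only [entropyOn, Finset.sum_map]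

theorem entropyOn_of_subset {t : Finset X} (hst : s ⊆ t) (h : ∀ x ∈ t, x ∉ s → a x = 0) :
    entropyOn t a = entropyOn s a := by
  rw [entropyOn, entropyOn, ← Finset.sum_subset hst h,
    ← Finset.sum_subset hst fun x hx hxs => by rw [h x hx hxs, Real.negMulLog_zero]]

theorem entropyOn_nonneg (h : ∀ x ∈ s, 0 ≤ a x) : 0 ≤ entropyOn s a := by
  rw [entropyOn, sub_nonneg, Real.negMulLog, neg_mul, Finset.sum_mul, ← Finset.sum_neg_distrib]
  refine Finset.sum_le_sum fun x hx => ?_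
  rw [Real.negMulLog, neg_mul, neg_le_neg_iff]
  rcases (h x hx).eq_or_lt with h0 | h0
  · simp [← h0]
  · exact mul_le_mul_of_nonneg_left (Real.log_le_log h0 (Finset.single_le_sum h hx)) h0.le

/-- Jensen's inequality for the concave function `Real.negMulLog` with uniform weights. -/
theorem entropyOn_le (h : ∀ x ∈ s, 0 ≤ a x) : entropyOn s a ≤ (∑ x ∈ s, a x) * Real.log s.card := by
  rcases s.eq_empty_or_nonempty with rfl | hs
  · simp [entropyOn]
  have hN : (0 : ℝ) < s.card := Nat.cast_pos.2 hs.card_pos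
  have hJ := Real.concaveOn_negMulLog.le_map_sum (t := s) (w := fun _ => (s.card : ℝ)⁻¹) (p := a)
    (fun _ _ => by positivity) (by rw [Finset.sum_const, nsmul_eq_mul, mul_inv_cancel₀ hN.ne'])
    (fun x hx => h x hx)
  simp only [smul_eq_mul, ← Finset.mul_sum, Real.negMulLog_mul] at hJ
  have h1 : Real.negMulLog ((s.card : ℝ)⁻¹) = (s.card : ℝ)⁻¹ * Real.log s.card := by
    rw [Real.negMulLog, Real.log_inv]; ring
  rw [h1] at hJ
  have h2 := mul_le_mul_of_nonneg_left hJ hN.le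
  have h3 : (s.card : ℝ) * ((s.card : ℝ)⁻¹ * ∑ x ∈ s, Real.negMulLog (a x)) =
      ∑ x ∈ s, Real.negMulLog (a x) := by rw [← mul_assoc, mul_inv_cancel₀ hN.ne', one_mul]
  have h4 : (s.card : ℝ) * ((∑ x ∈ s, a x) * ((s.card : ℝ)⁻¹ * Real.log s.card) +
      (s.card : ℝ)⁻¹ * Real.negMulLog (∑ x ∈ s, a x)) =
      (∑ x ∈ s, a x) * Real.log s.card + Real.negMulLog (∑ x ∈ s, a x) := by
    field_simp
  rw [h3, h4] at h2
  rw [entropyOn]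
  linarith

/-- This brings the integrand of `condEntropy` into homogeneous form. At outputs of zero density all
the weights vanish, so the convention for division by zero is harmless. -/
theorem sum_mul_sum_negMulLog_div (h : ∀ x ∈ s, 0 ≤ a x) :
    (∑ x ∈ s, a x) * ∑ x ∈ s, Real.negMulLog (a x / ∑ x ∈ s, a x) = entropyOn s a := by
  rcases (Finset.sum_nonneg h).eq_or_lt with h1 | h1
  · have hz := (Finset.sum_eq_zero_iff_of_nonneg h).1 h1.symm
    rw [entropyOn, ← h1, Finset.sum_eq_zero fun x hx => by rw [hz x hx, zero_div,
      Real.negMulLog_zero], Finset.sum_eq_zero fun x hx => by rw [hz x hx, Real.negMulLog_zero]]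
    simp
  · simp only [div_eq_mul_inv, Real.negMulLog_mul, Finset.sum_add_distrib, ← Finset.mul_sum,
      ← Finset.sum_mul]
    rw [entropyOn, mul_add, ← mul_assoc, mul_inv_cancel₀ h1.ne', one_mul]
    simp only [Real.negMulLog, Real.log_inv]
    field_simp
    ring

/-- The chain rule: the entropy splits into the entropies on a set and on its complement and that
of the indicator of the set. -/
theorem entropyOn_split (s : Finset X) (q : X → Prop) [DecidablePred q] (a : X → ℝ) :
    entropyOn s a = entropyOn (s.filter q) a + entropyOn (s.filter fun x => ¬q x) a +
      entropyOn Finset.univ fun β : Bool =>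
        bif β then ∑ x ∈ s.filter q, a x else ∑ x ∈ s.filter fun x => ¬q x, a x := by
  simp only [entropyOn, Fintype.sum_bool, cond_true, cond_false]
  rw [← Finset.sum_filter_add_sum_filter_not s q fun x => Real.negMulLog (a x),
    ← Finset.sum_filter_add_sum_filter_not s q a]
  ring

variable {Y : Type*} [MeasurableSpace Y] {ν : Measure Y} {A : X → Y → ℝ}

theorem integrable_entropyOn (h0 : ∀ x y, 0 ≤ A x y) (hi : ∀ x, Integrable (A x) ν) :
    Integrable (fun y => entropyOn s fun x => A x y) ν := by
  refine Integrable.mono' ((integrable_finsetSum s fun x _ => hi x).mul_const (Real.log s.card))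
    ?_ (Filter.Eventually.of_forall fun y => ?_)
  · refine AEStronglyMeasurable.sub (Finset.aestronglyMeasurable_fun_sum _ fun x _ =>
      Real.continuous_negMulLog.comp_aestronglyMeasurable (hi x).1)
      (Real.continuous_negMulLog.comp_aestronglyMeasurable
        (Finset.aestronglyMeasurable_fun_sum _ fun x _ => (hi x).1))
  · rw [Real.norm_of_nonneg (entropyOn_nonneg fun x _ => h0 x y)]
    exact entropyOn_le fun x _ => h0 x y

theorem integral_entropyOn_nonneg (h0 : ∀ x y, 0 ≤ A x y) :
    0 ≤ ∫ y, entropyOn s (fun x => A x y) ∂ν :=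
  integral_nonneg fun y => entropyOn_nonneg fun x _ => h0 x y

theorem integral_entropyOn_le (h0 : ∀ x y, 0 ≤ A x y) (hi : ∀ x, Integrable (A x) ν) :
    ∫ y, entropyOn s (fun x => A x y) ∂ν ≤ (∑ x ∈ s, ∫ y, A x y ∂ν) * Real.log s.card := by
  rw [← integral_finsetSum _ fun x _ => hi x, ← integral_mul_const]
  exact integral_mono (integrable_entropyOn h0 hi)
    ((integrable_finsetSum s fun x _ => hi x).mul_const _) fun y => entropyOn_le fun x _ => h0 x y

/-- The remainder `r` is the integrated entropy of the indicator of `q`, a weight on two points.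
This is the source of the one-bit bounds for a single check. -/
theorem integral_entropyOn_split (h0 : ∀ x y, 0 ≤ A x y) (hi : ∀ x, Integrable (A x) ν)
    (s : Finset X) (q : X → Prop) [DecidablePred q] :
    ∃ r, 0 ≤ r ∧ r ≤ (∑ x ∈ s, ∫ y, A x y ∂ν) * Real.log 2 ∧
      ∫ y, entropyOn s (fun x => A x y) ∂ν =
        ∫ y, entropyOn (s.filter q) (fun x => A x y) ∂ν +
          ∫ y, entropyOn (s.filter fun x => ¬q x) (fun x => A x y) ∂ν + r := by
  set D : Bool → Y → ℝ := fun β y =>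
    bif β then ∑ x ∈ s.filter q, A x y else ∑ x ∈ s.filter fun x => ¬q x, A x y with hD
  have i0 : ∀ β y, 0 ≤ D β y := by
    rintro (_ | _) y <;> exact Finset.sum_nonneg fun x _ => h0 x y
  have i1 : ∀ β, Integrable (D β) ν := by
    rintro (_ | _) <;> exact integrable_finsetSum _ fun x _ => hi x
  have j : ∀ t : Finset X, Integrable (fun y => entropyOn t fun x => A x y) ν :=
    fun t => integrable_entropyOn h0 hi
  refine ⟨∫ y, entropyOn Finset.univ (fun β => D β y) ∂ν, integral_entropyOn_nonneg i0,
    (integral_entropyOn_le i0 i1).trans_eq ?_, ?_⟩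
  · simp only [Fintype.sum_bool, hD, cond_true, cond_false]
    rw [integral_finsetSum _ fun x _ => hi x, integral_finsetSum _ fun x _ => hi x,
      Finset.sum_filter_add_sum_filter_not]
    simp
  · have k : Integrable (fun y => entropyOn (s.filter q) (fun x => A x y) +
        entropyOn (s.filter fun x => ¬q x) fun x => A x y) ν := (j _).add (j _)
    rw [← integral_add (j _) (j _), ← integral_add k (integrable_entropyOn i0 i1)]
    exact integral_congr_ae (Filter.Eventually.of_forall fun y => entropyOn_split s q _)

end EntropyOn

/-! ## Conditional entropy -/

section CondEntropy

variable {X Y : Type*} [Fintype X] [MeasurableSpace Y] {ν : Measure Y} {p : X → ℝ} {Q : X → Y → ℝ}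

theorem condEntropy_eq (hp : ∀ x, 0 ≤ p x) (hQ : ∀ x y, 0 ≤ Q x y) :
    condEntropy ν p Q =
      (∫ y, entropyOn Finset.univ (fun x => p x * Q x y) ∂ν) / Real.log 2 := by
  rw [condEntropy]
  congr 2
  funext y
  exact sum_mul_sum_negMulLog_div fun x _ => mul_nonneg (hp x) (hQ x y)

theorem condEntropy_mem_Icc (hp : ∀ x, 0 ≤ p x) (hp1 : ∑ x, p x = 1) (hQ : ∀ x y, 0 ≤ Q x y)
    (hQi : ∀ x, Integrable (Q x) ν) (hQ1 : ∀ x, ∫ y, Q x y ∂ν = 1) :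
    condEntropy ν p Q ∈ Set.Icc 0 (Real.log (Fintype.card X) / Real.log 2) := by
  have hl : 0 < Real.log 2 := Real.log_pos one_lt_two
  have h0 : ∀ x y, 0 ≤ p x * Q x y := fun x y => mul_nonneg (hp x) (hQ x y)
  rw [condEntropy_eq hp hQ]
  refine ⟨div_nonneg (integral_entropyOn_nonneg h0) hl.le, div_le_div_of_nonneg_right ?_ hl.le⟩
  refine (integral_entropyOn_le h0 fun x => (hQi x).const_mul _).trans_eq ?_
  simp only [integral_const_mul, hQ1, mul_one, hp1, one_mul, Finset.card_univ]

theorem condEntropy_congr {X' Y' : Type*} [Fintype X'] [MeasurableSpace Y'] {ν' : Measure Y'}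
    {p' : X' → ℝ} {Q' : X' → Y' → ℝ} (e : X ≃ X') (φ : Y ≃ᵐ Y') (hφ : MeasurePreserving φ ν ν')
    (hp : ∀ x, p' (e x) = p x) (hQ : ∀ x y, Q' (e x) (φ y) = Q x y) :
    condEntropy ν p Q = condEntropy ν' p' Q' := by
  rw [condEntropy, condEntropy, ← hφ.integral_comp']
  congr 2
  funext y
  simp only [← e.sum_comp, hp, hQ]

end CondEntropy

/-! ## Products of channel densities -/

section Channel

variable {𝒜 : Type*} [MeasurableSpace 𝒜] (W : BinaryChannel 𝒜)

theorem BinaryChannel.integrable_density (x : ZMod 2) : Integrable (W.density x) W.ref :=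
  integrable_of_integral_eq_one (W.integral_density x)

/-- The density of the outputs given the inputs. -/
def channelDensity {ι : Type*} [Fintype ι] (x : ι → ZMod 2) (y : ι → 𝒜) : ℝ :=
  ∏ i, W.density (x i) (y i)

variable {ι : Type*} [Fintype ι]

theorem channelDensity_nonneg (x : ι → ZMod 2) (y : ι → 𝒜) : 0 ≤ channelDensity W x y :=
  Finset.prod_nonneg fun _ _ => W.density_nonneg _ _

theorem integrable_channelDensity (x : ι → ZMod 2) :
    Integrable (channelDensity W x) (Measure.pi fun _ => W.ref) :=
  Integrable.fintype_prod fun i => W.integrable_density (x i)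

theorem integral_channelDensity (x : ι → ZMod 2) :
    ∫ y, channelDensity W x y ∂(Measure.pi fun _ => W.ref) = 1 := by
  simp only [channelDensity]
  rw [integral_fintype_prod_eq_prod (fun i => W.density (x i))]
  exact Finset.prod_eq_one fun i _ => W.integral_density _

theorem channelDensity_piCongrLeft {ι' : Type*} [Fintype ι'] (e : ι ≃ ι') (x' : ι' → ZMod 2)
    (y : ι → 𝒜) : channelDensity W x' (MeasurableEquiv.piCongrLeft (fun _ => 𝒜) e y) =
      channelDensity W (fun i => x' (e i)) y := by
  simp only [channelDensity, ← e.prod_comp, MeasurableEquiv.piCongrLeft_apply_apply]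

end Channel

/-! ## Codes with a generator matrix given by a family of checks -/

theorem checkSum_add {n : ℕ} (c : List (Fin n)) (x v : Fin n → ZMod 2) :
    checkSum c (x + v) = checkSum c x + checkSum c v := by
  simp [checkSum, ← List.sum_map_add, Pi.add_def]

theorem checkSum_map {n : ℕ} (c : List (Fin n)) (σ : Fin n → Fin n) (x : Fin n → ZMod 2) :
    checkSum (c.map σ) x = checkSum c fun i => x (σ i) := by
  simp [checkSum, Function.comp_def]

theorem card_binary_words (n : ℕ) : Fintype.card (Fin n → ZMod 2) = 2 ^ n := by
  rw [Fintype.card_fun, ZMod.card, Fintype.card_fin]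

theorem log_card_binary_words (n : ℕ) :
    Real.log (Fintype.card (Fin n → ZMod 2)) / Real.log 2 = n := by
  rw [card_binary_words, Nat.cast_pow, Real.log_pow, Nat.cast_ofNat,
    mul_div_cancel_right₀ _ (Real.log_pos one_lt_two).ne']

section Generator

variable {𝒜 : Type*} [MeasurableSpace 𝒜] (W : BinaryChannel 𝒜) {n : ℕ}

/-- The conditional entropy of the message given the received values of a family of checks. -/
def generatorEntropy {ι : Type*} [Fintype ι] (c : ι → List (Fin n)) : ℝ :=
  condEntropy (Measure.pi fun _ : ι => W.ref) (fun _ : Fin n → ZMod 2 => 1 / 2 ^ n)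
    fun x y => channelDensity W (fun a => checkSum (c a) x) y

theorem ldgmEntropy_eq (G : TannerGraph n) : ldgmEntropy W G = generatorEntropy W G.get := rfl

theorem generatorEntropy_comp {ι ι' : Type*} [Fintype ι] [Fintype ι'] (e : ι ≃ ι')
    (c : ι' → List (Fin n)) : generatorEntropy W (fun i => c (e i)) = generatorEntropy W c :=
  condEntropy_congr (Equiv.refl _) (MeasurableEquiv.piCongrLeft (fun _ => 𝒜) e)
    (measurePreserving_piCongrLeft (fun _ => W.ref) e) (fun _ => rfl)
    fun x y => channelDensity_piCongrLeft W e (fun a => checkSum (c a) x) y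

theorem generatorEntropy_map {ι : Type*} [Fintype ι] (c : ι → List (Fin n))
    (σ : Equiv.Perm (Fin n)) :
    generatorEntropy W (fun i => (c i).map σ) = generatorEntropy W c := by
  refine (condEntropy_congr (Equiv.arrowCongr σ (Equiv.refl (ZMod 2))) (MeasurableEquiv.refl _)
    (MeasurePreserving.id _) (fun _ => rfl) fun x y => ?_).symm
  simp [checkSum_map]

theorem generatorEntropy_mem_Icc {ι : Type*} [Fintype ι] (c : ι → List (Fin n)) :
    generatorEntropy W c ∈ Set.Icc 0 (n : ℝ) := by
  rw [← log_card_binary_words n]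
  refine condEntropy_mem_Icc (fun _ => by positivity) ?_ (fun x y => channelDensity_nonneg W _ y)
    (fun x => integrable_channelDensity W _) fun x => integral_channelDensity W _
  rw [Finset.sum_const, Finset.card_univ, card_binary_words, nsmul_eq_mul]
  push_cast
  field_simp

/-- Split the messages by the value of the extra check. On either class the extra received symbol
has a density independent of the message, so it integrates out and the class contributes the same
with and without the observation. The two entropies differ only in the remainders of the splitting,
which both lie in `[0, log 2]`. -/
theorem abs_generatorEntropy_sub_le {m : ℕ} (c : Fin (m + 1) → List (Fin n)) :
    |generatorEntropy W c - generatorEntropy W fun i : Fin m => c i.succ| ≤ 1 := by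
  have hl : 0 < Real.log 2 := Real.log_pos one_lt_two
  set ν := Measure.pi fun _ : Fin m => W.ref with hν
  set a : (Fin n → ZMod 2) → (Fin m → 𝒜) → ℝ := fun x y =>
    1 / 2 ^ n * channelDensity W (fun i => checkSum (c i.succ) x) y with ha
  set b : (Fin n → ZMod 2) → ZMod 2 := checkSum (c 0) with hb
  set a' : (Fin n → ZMod 2) → 𝒜 × (Fin m → 𝒜) → ℝ := fun x z => W.density (b x) z.1 * a x z.2
    with ha'
  have ha0 : ∀ x y, 0 ≤ a x y := fun x y => mul_nonneg (by positivity) (channelDensity_nonneg W _ _)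
  have hai : ∀ x, Integrable (a x) ν := fun x => (integrable_channelDensity W _).const_mul _
  have ha1 : ∀ x, ∫ y, a x y ∂ν = 1 / 2 ^ n := fun x => by
    simp only [ha]; rw [integral_const_mul, integral_channelDensity, mul_one]
  have ha0' : ∀ x z, 0 ≤ a' x z := fun x z => mul_nonneg (W.density_nonneg _ _) (ha0 _ _)
  have hai' : ∀ x, Integrable (a' x) (W.ref.prod ν) := fun x =>
    (W.integrable_density (b x)).mul_prod (hai x)
  have ha1' : ∀ x, ∫ z, a' x z ∂(W.ref.prod ν) = 1 / 2 ^ n := fun x => by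
    simp only [ha']; rw [integral_prod_mul, W.integral_density, one_mul, ha1]
  have hsum : ∑ _x : Fin n → ZMod 2, (1 / 2 ^ n : ℝ) = 1 := by
    rw [Finset.sum_const, Finset.card_univ, card_binary_words, nsmul_eq_mul]
    push_cast
    field_simp
  have e1 : generatorEntropy W (fun i : Fin m => c i.succ) =
      (∫ y, entropyOn Finset.univ (fun x => a x y) ∂ν) / Real.log 2 :=
    condEntropy_eq (fun _ => by positivity) fun x y => channelDensity_nonneg W _ _
  have e2 : generatorEntropy W c =
      (∫ z, entropyOn Finset.univ (fun x => a' x z) ∂(W.ref.prod ν)) / Real.log 2 := by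
    refine (condEntropy_eq (fun _ => by positivity) fun x y =>
      channelDensity_nonneg W _ _).trans ?_
    congr 1
    rw [← (measurePreserving_piFinSuccAbove (fun _ : Fin (m + 1) => W.ref) 0).integral_comp']
    refine integral_congr_ae (Filter.Eventually.of_forall fun y => entropyOn_congr fun x _ => ?_)
    simp only [ha', ha, hb, channelDensity, Fin.prod_univ_succ, MeasurableEquiv.piFinSuccAbove_apply,
      Fin.insertNthEquiv_symm_apply, Fin.removeNth, Fin.zero_succAbove]
    ring
  set s0 := Finset.univ.filter fun x => b x = 0 with hs0
  set s1 := Finset.univ.filter fun x => ¬b x = 0 with hs1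
  obtain ⟨r, r0, r1, E⟩ := integral_entropyOn_split ha0 hai Finset.univ fun x => b x = 0
  obtain ⟨r', r0', r1', E'⟩ := integral_entropyOn_split ha0' hai' Finset.univ fun x => b x = 0
  simp only [ha1, hsum, one_mul] at r1
  simp only [ha1', hsum, one_mul] at r1'
  have t0 : ∀ z, entropyOn s0 (fun x => a' x z) =
      W.density 0 z.1 * entropyOn s0 fun x => a x z.2 := fun z => by
    rw [← entropyOn_const_mul]
    exact entropyOn_congr fun x hx => by
      rw [ha']; simp only; rw [(Finset.mem_filter.1 hx).2]
  have t1 : ∀ z, entropyOn s1 (fun x => a' x z) =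
      W.density 1 z.1 * entropyOn s1 fun x => a x z.2 := fun z => by
    rw [← entropyOn_const_mul]
    refine entropyOn_congr fun x hx => ?_
    have h1 : ∀ u : ZMod 2, ¬u = 0 → u = 1 := by decide
    rw [ha']; simp only; rw [h1 _ (Finset.mem_filter.1 hx).2]
  have v0 := integral_prod_mul (μ := W.ref) (ν := ν) (W.density 0)
    fun y => entropyOn s0 fun x => a x y
  have v1 := integral_prod_mul (μ := W.ref) (ν := ν) (W.density 1)
    fun y => entropyOn s1 fun x => a x y
  rw [W.integral_density, one_mul] at v0 v1
  simp only [← t0] at v0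
  simp only [← t1] at v1
  rw [v0, v1] at E'
  rw [e1, e2, ← sub_div, abs_div, abs_of_pos hl, div_le_one hl, E, E', add_sub_add_left_eq_sub]
  exact abs_le.2 ⟨by linarith, by linarith⟩

theorem ldgmEntropy_mem_Icc (G : TannerGraph n) : ldgmEntropy W G ∈ Set.Icc 0 (n : ℝ) :=
  generatorEntropy_mem_Icc W _

theorem abs_ldgmEntropy_cons_sub_le (c : List (Fin n)) (G : TannerGraph n) :
    |ldgmEntropy W (c :: G) - ldgmEntropy W G| ≤ 1 :=
  abs_generatorEntropy_sub_le W (m := G.length) (c :: G).get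

end Generator

/-! ## Output-symmetric channels -/

theorem pi_withDensity_ofReal {ι α : Type*} [Fintype ι] [MeasurableSpace α] {ν : Measure α}
    [SigmaFinite ν] {w : α → ℝ} (hw : ∀ y, 0 ≤ w y) (hi : Integrable w ν)
    [SigmaFinite (ν.withDensity fun y => ENNReal.ofReal (w y))] :
    (Measure.pi fun _ : ι => ν).withDensity (fun y => ENNReal.ofReal (∏ i, w (y i))) =
      Measure.pi fun _ : ι => ν.withDensity fun y => ENNReal.ofReal (w y) := by
  refine (Measure.pi_eq fun s hs => ?_).symm
  rw [withDensity_apply _ (MeasurableSet.univ_pi hs), Measure.restrict_pi_pi,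
    ← ofReal_integral_eq_lintegral_ofReal (Integrable.fintype_prod fun i => hi.restrict)
      (Filter.Eventually.of_forall fun y => Finset.prod_nonneg fun i _ => hw (y i)),
    integral_fintype_prod_eq_prod fun _ => w,
    ENNReal.ofReal_prod_of_nonneg fun i _ => integral_nonneg fun y => hw y]
  refine Finset.prod_congr rfl fun i _ => ?_
  rw [withDensity_apply _ (hs i), ofReal_integral_eq_lintegral_ofReal hi.restrict
    (Filter.Eventually.of_forall hw)]

namespace BinaryChannel

variable {𝒜 : Type*} [MeasurableSpace 𝒜] (W : BinaryChannel 𝒜)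

/-- The density of the sum of the two output laws. -/
def totalDensity (y : 𝒜) : ℝ := W.density 0 y + W.density 1 y

/-- The sum of the two output laws. -/
def totalLaw : Measure 𝒜 := W.ref.withDensity fun y => ENNReal.ofReal (W.totalDensity y)

/-- The posterior law of a uniform input. -/
def posterior (x : ZMod 2) (y : 𝒜) : ℝ := W.density x y / W.totalDensity y

theorem totalDensity_nonneg (y : 𝒜) : 0 ≤ W.totalDensity y :=
  add_nonneg (W.density_nonneg 0 y) (W.density_nonneg 1 y)

theorem measurable_totalDensity : Measurable W.totalDensity :=
  (W.measurable_density 0).add (W.measurable_density 1)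

theorem measurable_posterior (x : ZMod 2) : Measurable (W.posterior x) :=
  (W.measurable_density x).div W.measurable_totalDensity

theorem posterior_nonneg (x : ZMod 2) (y : 𝒜) : 0 ≤ W.posterior x y :=
  div_nonneg (W.density_nonneg x y) (W.totalDensity_nonneg y)

theorem eq_zero_or_one : ∀ x : ZMod 2, x = 0 ∨ x = 1 := by decide

theorem totalDensity_mul_posterior (x : ZMod 2) (y : 𝒜) :
    W.totalDensity y * W.posterior x y = W.density x y := by
  refine mul_div_cancel_of_imp' fun h => ?_
  have h0 := W.density_nonneg 0 y
  have h1 := W.density_nonneg 1 y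
  rw [totalDensity] at h
  rcases eq_zero_or_one x with rfl | rfl <;> linarith

theorem integrable_totalDensity : Integrable W.totalDensity W.ref :=
  (W.integrable_density 0).add (W.integrable_density 1)

instance isFiniteMeasure_totalLaw : IsFiniteMeasure W.totalLaw :=
  isFiniteMeasure_withDensity_ofReal W.integrable_totalDensity.2

theorem totalLaw_eq : W.totalLaw = W.law 0 + W.law 1 := by
  rw [law, law, ← withDensity_add_left (W.measurable_density 0).ennreal_ofReal, totalLaw]
  congr 1
  funext y
  exact ENNReal.ofReal_add (W.density_nonneg 0 y) (W.density_nonneg 1 y)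

theorem totalLaw_withDensity_posterior (x : ZMod 2) :
    W.totalLaw.withDensity (fun y => ENNReal.ofReal (W.posterior x y)) = W.law x := by
  rw [totalLaw, law, ← withDensity_mul _ W.measurable_totalDensity.ennreal_ofReal
    (W.measurable_posterior x).ennreal_ofReal]
  congr 1
  funext y
  rw [Pi.mul_apply, ← ENNReal.ofReal_mul (W.totalDensity_nonneg y), totalDensity_mul_posterior]

theorem integral_pi_totalLaw {ι : Type*} [Fintype ι] (f : (ι → 𝒜) → ℝ) :
    ∫ y, f y ∂(Measure.pi fun _ : ι => W.totalLaw) =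
      ∫ y, (∏ i, W.totalDensity (y i)) * f y ∂(Measure.pi fun _ : ι => W.ref) := by
  have : SigmaFinite (W.ref.withDensity fun y => ENNReal.ofReal (W.totalDensity y)) :=
    inferInstanceAs (SigmaFinite W.totalLaw)
  have h0 : ∀ y : ι → 𝒜, 0 ≤ ∏ i, W.totalDensity (y i) := fun y =>
    Finset.prod_nonneg fun i _ => W.totalDensity_nonneg _
  have hm : Measurable fun y : ι → 𝒜 => ∏ i, W.totalDensity (y i) :=
    Finset.measurable_fun_prod _ fun i _ => W.measurable_totalDensity.comp (measurable_pi_apply i)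
  rw [totalLaw, ← pi_withDensity_ofReal W.totalDensity_nonneg W.integrable_totalDensity,
    integral_withDensity_eq_integral_toReal_smul hm.ennreal_ofReal
      (Filter.Eventually.of_forall fun y => ENNReal.ofReal_lt_top)]
  simp only [ENNReal.toReal_ofReal (h0 _), smul_eq_mul]

variable {W} {τ : 𝒜 → 𝒜}

theorem map_law (hτ : Measurable τ) (hinv : Function.Involutive τ)
    (h : (W.law 0).map τ = W.law 1) (x : ZMod 2) : (W.law x).map τ = W.law (x + 1) := by
  rcases eq_zero_or_one x with rfl | rfl
  · rw [h, zero_add]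
  · rw [← h, Measure.map_map hτ hτ, hinv.comp_self, Measure.map_id]
    rfl

theorem measurePreserving_totalLaw (hτ : Measurable τ) (hinv : Function.Involutive τ)
    (h : (W.law 0).map τ = W.law 1) : MeasurePreserving τ W.totalLaw W.totalLaw := by
  refine ⟨hτ, ?_⟩
  rw [totalLaw_eq, Measure.map_add _ _ hτ, map_law hτ hinv h, map_law hτ hinv h, add_comm]
  rfl

/-- The involution need not preserve the reference measure, and the densities themselves need not be
exchanged by it. It does preserve the sum of the two output laws, with respect to which the
posteriors are densities; uniqueness of densities then exchanges the posteriors almost everywhere.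
-/
theorem posterior_comp_ae (hτ : Measurable τ) (hinv : Function.Involutive τ)
    (h : (W.law 0).map τ = W.law 1) (x : ZMod 2) :
    ∀ᵐ y ∂W.totalLaw, W.posterior x (τ y) = W.posterior (x + 1) y := by
  have hm := measurePreserving_totalLaw hτ hinv h
  have h1 : (fun y => ENNReal.ofReal (W.posterior x (τ y))) =ᵐ[W.totalLaw]
      fun y => ENNReal.ofReal (W.posterior (x + 1) y) := by
    rw [← withDensity_eq_iff_of_sigmaFinite (μ := W.totalLaw)
      (f := fun y => ENNReal.ofReal (W.posterior x (τ y)))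
      ((W.measurable_posterior x).comp hτ).ennreal_ofReal.aemeasurable
      (W.measurable_posterior (x + 1)).ennreal_ofReal.aemeasurable,
      totalLaw_withDensity_posterior, ← map_law hτ hinv h x]
    ext E hE
    have hE' : τ ⁻¹' (τ ⁻¹' E) = E := by
      rw [← Set.preimage_comp, hinv.comp_self, Set.preimage_id]
    rw [Measure.map_apply hτ hE, ← totalLaw_withDensity_posterior, withDensity_apply _ hE,
      withDensity_apply _ (hτ hE), ← hm.setLIntegral_comp_preimage (hτ hE)
        (W.measurable_posterior x).ennreal_ofReal, hE']
  filter_upwards [h1] with y hy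
  exact (ENNReal.ofReal_eq_ofReal_iff (W.posterior_nonneg _ _) (W.posterior_nonneg _ _)).1 hy

end BinaryChannel

/-! ### Invariance of the integrated entropy under translation. -/

section Translate

variable {𝒜 : Type*} [MeasurableSpace 𝒜] {W : BinaryChannel 𝒜}

/-- A change of reference measure: by homogeneity the total densities, which do not depend on the
input, move from the weights into the measure. -/
theorem integral_entropyOn_eq_posterior {X ι : Type*} [Fintype ι] (s : Finset X)
    (u : X → ι → ZMod 2) :
    ∫ y, entropyOn s (fun x => channelDensity W (u x) y) ∂(Measure.pi fun _ => W.ref) =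
      ∫ y, entropyOn s (fun x => ∏ i, W.posterior (u x i) (y i))
        ∂(Measure.pi fun _ => W.totalLaw) := by
  rw [W.integral_pi_totalLaw]
  congr 1
  funext y
  rw [← entropyOn_const_mul]
  refine entropyOn_congr fun x _ => ?_
  rw [← Finset.prod_mul_distrib]
  exact Finset.prod_congr rfl fun i _ => (W.totalDensity_mul_posterior _ _).symm

/-- Apply the involution to the output coordinates where `v` is 1. This preserves the product of the
total laws and almost everywhere turns the posterior weight of `x` into that of `x + v`. -/
theorem integral_entropyOn_translate (hW : W.OutputSymmetric) {ι : Type*} [Fintype ι]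
    (s : Finset (ι → ZMod 2)) (v : ι → ZMod 2) :
    ∫ y, entropyOn s (fun x => channelDensity W (x + v) y) ∂(Measure.pi fun _ => W.ref) =
      ∫ y, entropyOn s (fun x => channelDensity W x y) ∂(Measure.pi fun _ => W.ref) := by
  classical
  obtain ⟨τ, hτ, hinv, h⟩ := hW
  rw [integral_entropyOn_eq_posterior s fun x => x + v, integral_entropyOn_eq_posterior s fun x => x]
  set T : ι → 𝒜 → 𝒜 := fun i => if v i = 0 then id else τ with hT
  have hTm : MeasurePreserving (fun (y : ι → 𝒜) i => T i (y i))
      (Measure.pi fun _ => W.totalLaw) (Measure.pi fun _ => W.totalLaw) := by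
    refine measurePreserving_pi _ _ fun i => ?_
    rw [hT]
    dsimp only
    split_ifs
    · exact MeasurePreserving.id _
    · exact BinaryChannel.measurePreserving_totalLaw hτ hinv h
  have hae : ∀ᵐ y ∂(Measure.pi fun _ : ι => W.totalLaw), ∀ (i : ι) (x : ZMod 2),
      W.posterior x (T i (y i)) = W.posterior (x + v i) (y i) := by
    refine Filter.eventually_all.2 fun i => Filter.eventually_all.2 fun x => ?_
    rw [hT]
    dsimp only
    split_ifs with hv
    · exact Filter.Eventually.of_forall fun y => by rw [hv, add_zero, id]
    · rw [(BinaryChannel.eq_zero_or_one (v i)).resolve_left hv]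
      exact (Measure.tendsto_eval_ae_ae (μ := fun _ : ι => W.totalLaw) (i := i)).eventually
        (BinaryChannel.posterior_comp_ae hτ hinv h x)
  have hmeas : Measurable fun y : ι → 𝒜 => entropyOn s fun x => ∏ i, W.posterior (x i) (y i) := by
    have h1 : ∀ x : ι → ZMod 2, Measurable fun y : ι → 𝒜 => ∏ i, W.posterior (x i) (y i) :=
      fun x => Finset.measurable_fun_prod _ fun i _ =>
        (W.measurable_posterior (x i)).comp (measurable_pi_apply i)
    exact (Finset.measurable_fun_sum _ fun x _ =>
      Real.continuous_negMulLog.measurable.comp (h1 x)).sub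
      (Real.continuous_negMulLog.measurable.comp (Finset.measurable_fun_sum _ fun x _ => h1 x))
  conv_rhs => rw [← hTm.map_eq]
  rw [integral_map hTm.measurable.aemeasurable hmeas.aestronglyMeasurable]
  refine integral_congr_ae ?_
  filter_upwards [hae] with y hy
  simp only [hy, Pi.add_apply]

end Translate

/-! ## Codes with a parity check matrix -/

section ParityCheck

variable {𝒜 : Type*} [MeasurableSpace 𝒜] (W : BinaryChannel 𝒜) {n : ℕ}

theorem mem_ldpcCodewords {G : TannerGraph n} {x : Fin n → ZMod 2} :
    x ∈ ldpcCodewords G ↔ ∀ c ∈ G, checkSum c x = 0 := by simp [ldpcCodewords]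

theorem zero_mem_ldpcCodewords (G : TannerGraph n) : 0 ∈ ldpcCodewords G :=
  mem_ldpcCodewords.2 fun c _ => by
    simpa using checkSum_add c 0 0

theorem card_ldpcCodewords_pos (G : TannerGraph n) : (0 : ℝ) < (ldpcCodewords G).card :=
  Nat.cast_pos.2 (Finset.card_pos.2 ⟨0, zero_mem_ldpcCodewords G⟩)

open Classical in
theorem ldpcCodewords_cons (c : List (Fin n)) (G : TannerGraph n) :
    ldpcCodewords (c :: G) = (ldpcCodewords G).filter fun x => checkSum c x = 0 := by
  ext x
  simp [mem_ldpcCodewords, and_comm]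

theorem ldpcEntropy_eq (G : TannerGraph n) :
    ldpcEntropy W G = (1 / (ldpcCodewords G).card * ∫ y, entropyOn (ldpcCodewords G)
      (fun x => channelDensity W x y) ∂(Measure.pi fun _ => W.ref)) / Real.log 2 := by
  have h := (card_ldpcCodewords_pos G).le
  rw [ldpcEntropy, condEntropy_eq (fun x => by split_ifs <;> positivity)
    (fun x y => by exact channelDensity_nonneg W x y), ← integral_const_mul]
  congr 2
  funext y
  rw [entropyOn_of_subset (Finset.subset_univ (ldpcCodewords G)) fun x _ hx => by
    rw [if_neg hx, zero_mul], ← entropyOn_const_mul]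
  exact entropyOn_congr fun x hx => by rw [if_pos hx]; rfl

theorem ldpcEntropy_mem_Icc (G : TannerGraph n) : ldpcEntropy W G ∈ Set.Icc 0 (n : ℝ) := by
  rw [← log_card_binary_words n]
  have h := card_ldpcCodewords_pos G
  refine condEntropy_mem_Icc (fun x => by split_ifs <;> positivity) ?_
    (fun x y => channelDensity_nonneg W x y) (fun x => integrable_channelDensity W x)
    fun x => integral_channelDensity W x
  rw [Finset.sum_ite_mem, Finset.univ_inter, Finset.sum_const, nsmul_eq_mul,
    mul_one_div_cancel h.ne']

/-- If every codeword satisfies the new check, nothing changes. Otherwise the violating codewords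
form a coset of the new code, of the same size, and output symmetry gives both halves the same
integrated entropy. -/
theorem abs_ldpcEntropy_cons_sub_le (hW : W.OutputSymmetric) (c : List (Fin n))
    (G : TannerGraph n) : |ldpcEntropy W (c :: G) - ldpcEntropy W G| ≤ 1 := by
  classical
  have hl : 0 < Real.log 2 := Real.log_pos one_lt_two
  set C := ldpcCodewords G with hC
  set C' := C.filter fun x => checkSum c x = 0 with hC'
  have hcons : ldpcCodewords (c :: G) = C' := ldpcCodewords_cons c G
  by_cases hv : ∃ v ∈ C, checkSum c v = 1
  · obtain ⟨v, hvC, hv⟩ := hv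
    have hcoset : (C.filter fun x => ¬checkSum c x = 0) = C'.map (addRightEmbedding v) := by
      ext x
      have hz : ∀ x : Fin n → ZMod 2, x - v = x + v := fun x => by
        funext i
        rw [Pi.sub_apply, Pi.add_apply, CharTwo.sub_eq_add]
      simp only [hC', Finset.mem_filter, Finset.mem_map, addRightEmbedding_apply]
      constructor
      · rintro ⟨hx, hx1⟩
        refine ⟨x - v, ⟨mem_ldpcCodewords.2 fun d hd => ?_, ?_⟩, sub_add_cancel x v⟩
        · rw [hz, checkSum_add, mem_ldpcCodewords.1 hx d hd, mem_ldpcCodewords.1 hvC d hd, add_zero]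
        · rw [hz, checkSum_add, hv, (BinaryChannel.eq_zero_or_one _).resolve_left hx1]
          decide
      · rintro ⟨x, ⟨hx, hx1⟩, rfl⟩
        refine ⟨mem_ldpcCodewords.2 fun d hd => ?_, ?_⟩
        · rw [checkSum_add, mem_ldpcCodewords.1 hx d hd, mem_ldpcCodewords.1 hvC d hd, add_zero]
        · rw [checkSum_add, hx1, hv]
          decide
    have hcard : (C.card : ℝ) = 2 * C'.card := by
      have := Finset.card_filter_add_card_filter_not (s := C) fun x => checkSum c x = 0
      rw [hcoset, Finset.card_map] at this
      rw [← this]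
      push_cast
      ring
    have hpos : (0 : ℝ) < C'.card := hcons ▸ card_ldpcCodewords_pos (c :: G)
    obtain ⟨r, r0, r1, E⟩ := integral_entropyOn_split (fun x y => channelDensity_nonneg W x y)
      (fun x => integrable_channelDensity W x) C fun x => checkSum c x = 0
    simp only [integral_channelDensity, Finset.sum_const, nsmul_eq_mul, mul_one] at r1
    rw [hcoset] at E
    simp only [entropyOn_map, addRightEmbedding_apply] at E
    rw [integral_entropyOn_translate hW] at E
    rw [ldpcEntropy_eq, ldpcEntropy_eq, hcons, ← hC, E, ← hC', ← sub_div, abs_div, abs_of_pos hl,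
      div_le_one hl, hcard]
    have h2 : r / (2 * C'.card) ≤ Real.log 2 := by
      rw [div_le_iff₀ (by positivity), ← hcard]
      linarith
    -- The common integral `I` of the two cosets cancels, because the old code is exactly twice as
    -- large; only the normalized remainder survives.
    have h3 : ∀ I : ℝ, 1 / (C'.card : ℝ) * I - 1 / (2 * C'.card) * (I + I + r) =
        -(r / (2 * C'.card)) := fun I => by field_simp; ring
    rw [h3, abs_neg, abs_of_nonneg (by positivity)]
    exact h2
  · have hCC : C' = C := Finset.filter_true_of_mem fun x hx =>
      (BinaryChannel.eq_zero_or_one _).resolve_right fun h => hv ⟨x, hx, h⟩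
    rw [ldpcEntropy_eq, ldpcEntropy_eq, hcons, hCC, ← hC, sub_self, abs_zero]
    exact zero_le_one

theorem ldpcEntropy_congr {G G' : TannerGraph n} (h : ∀ c, c ∈ G ↔ c ∈ G') :
    ldpcEntropy W G = ldpcEntropy W G' := by
  have : ldpcCodewords G = ldpcCodewords G' := by
    ext x
    simp only [mem_ldpcCodewords, h]
  rw [ldpcEntropy_eq, ldpcEntropy_eq, this]

theorem ldpcEntropy_map (G : TannerGraph n) (σ : Equiv.Perm (Fin n)) :
    ldpcEntropy W (G.map (List.map σ)) = ldpcEntropy W G := by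
  have hmem : ∀ x, (Equiv.arrowCongr σ (Equiv.refl (ZMod 2)) x) ∈
      ldpcCodewords (G.map (List.map σ)) ↔ x ∈ ldpcCodewords G := fun x => by
    simp [mem_ldpcCodewords, checkSum_map]
  have hcard : (ldpcCodewords (G.map (List.map σ))).card = (ldpcCodewords G).card := by
    refine (Finset.card_equiv (Equiv.arrowCongr σ (Equiv.refl (ZMod 2))) fun x => ?_).symm
    exact (hmem x).symm
  refine (condEntropy_congr (Equiv.arrowCongr σ (Equiv.refl (ZMod 2)))
    (MeasurableEquiv.piCongrLeft (fun _ => 𝒜) σ)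
    (measurePreserving_piCongrLeft (fun _ => W.ref) σ) (fun x => ?_) fun x y => ?_).symm
  · simp only [hmem, hcard]
  · refine (channelDensity_piCongrLeft W σ _ y).trans ?_
    simp [channelDensity]

end ParityCheck

/-! ## The conditional entropy as a function of the graph -/

section CodeEntropy

variable {𝒜 : Type*} [MeasurableSpace 𝒜] (κ : CodeKind) (W : BinaryChannel 𝒜) {n : ℕ}

theorem exists_equiv_of_card_fiber_eq {α β γ : Type*} [Fintype α] [Fintype β] [DecidableEq γ]
    (f : α → γ) (g : β → γ) (h : ∀ c, (Finset.univ.filter fun a => f a = c).card =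
      (Finset.univ.filter fun b => g b = c).card) : ∃ e : α ≃ β, ∀ a, g (e a) = f a := by
  have h' : ∀ c, Nonempty ({a // f a = c} ≃ {b // g b = c}) := fun c => by
    rw [← Fintype.card_eq, Fintype.card_subtype, Fintype.card_subtype, h]
  refine ⟨(Equiv.sigmaFiberEquiv f).symm.trans ((Equiv.sigmaCongrRight fun c => (h' c).some).trans
    (Equiv.sigmaFiberEquiv g)), fun a => ?_⟩
  exact ((h' (f a)).some ⟨a, rfl⟩).2

theorem List.Perm.exists_equiv_get {α : Type*} {l l' : List α} (h : l.Perm l') :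
    ∃ e : Fin l.length ≃ Fin l'.length, ∀ i, l'.get (e i) = l.get i := by
  classical
  refine exists_equiv_of_card_fiber_eq _ _ fun c => ?_
  have hc : ∀ l : List α, (Finset.univ.filter fun i => l.get i = c).card = l.count c := by
    intro l
    have := Fin.card_filter_univ_eq_vector_get_eq_count c ⟨l, rfl⟩
    simpa [List.Vector.get, eq_comm] using this
  rw [hc, hc, h.count_eq]

theorem codeEntropy_mem_Icc (G : TannerGraph n) : codeEntropy κ W G ∈ Set.Icc 0 (n : ℝ) :=
  match κ with
  | .ldgm => ldgmEntropy_mem_Icc W G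
  | .ldpc => ldpcEntropy_mem_Icc W G

theorem isBdd_codeEntropy : IsBdd fun G : TannerGraph n => codeEntropy κ W G :=
  ⟨n, fun G => by rw [abs_of_nonneg (codeEntropy_mem_Icc κ W G).1]
                  exact (codeEntropy_mem_Icc κ W G).2⟩

theorem codeEntropy_perm {G G' : TannerGraph n} (h : G.Perm G') :
    codeEntropy κ W G = codeEntropy κ W G' := by
  cases κ with
  | ldgm =>
    obtain ⟨e, he⟩ := h.exists_equiv_get
    refine (?_ : ldgmEntropy W G = ldgmEntropy W G')
    rw [ldgmEntropy_eq, ldgmEntropy_eq, ← generatorEntropy_comp W e]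
    simp only [he]
  | ldpc => exact ldpcEntropy_congr W fun c => h.mem_iff

theorem codeEntropy_map (G : TannerGraph n) (σ : Equiv.Perm (Fin n)) :
    codeEntropy κ W (G.map (List.map σ)) = codeEntropy κ W G := by
  cases κ with
  | ldgm =>
    refine (?_ : ldgmEntropy W _ = ldgmEntropy W G)
    rw [ldgmEntropy_eq, ldgmEntropy_eq, ← generatorEntropy_map W G.get σ,
      ← generatorEntropy_comp W (finCongr (List.length_map (List.map σ))) fun i =>
        (G.get i).map σ]
    congr 1
    funext i
    simp
  | ldpc => exact ldpcEntropy_map W G σ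

variable {κ W}

/-- The order of the checks is irrelevant, so the inserted one may be moved to the front. One bit
suffices whatever the degree, hence for every `K`. -/
theorem insertLipschitz_codeEntropy (hW : κ = CodeKind.ldpc → W.OutputSymmetric) (K : ℕ) :
    InsertLipschitz K 1 fun G : TannerGraph n => codeEntropy κ W G := by
  intro l r c _
  dsimp only
  rw [codeEntropy_perm κ W (List.perm_middle)]
  cases κ with
  | ldgm => exact abs_ldgmEntropy_cons_sub_le W c (l ++ r)
  | ldpc => exact abs_ldpcEntropy_cons_sub_le W (hW rfl) c (l ++ r)

end CodeEntropy

/-! ## Check rates -/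

section CheckRates

variable {P : Polynomial ℝ}

theorem IsDegreeSequence.sum_range' (hP : IsDegreeSequence P) (u : ℕ → ℝ) :
    ((List.range' 2 (P.natDegree - 1)).map fun k => P.coeff k * u k).sum =
      ∑ k ∈ Finset.range (P.natDegree + 1), P.coeff k * u k := by
  have h1 : ((List.range' 2 (P.natDegree - 1)).map fun k => P.coeff k * u k).sum =
      ∑ j ∈ Finset.range (P.natDegree - 1), P.coeff (j + 2) * u (j + 2) := by
    rw [List.range'_eq_map_range, List.map_map]
    simp only [Function.comp_def, add_comm 2]
    rfl
  rw [h1]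
  -- A constant polynomial with zero constant term cannot take the value 1, so the subtraction in
  -- `P.natDegree - 1` does not truncate.
  have hd : P.natDegree ≠ 0 := by
    intro h
    have := hP.eval_one
    rw [Polynomial.eval_eq_sum_range, h] at this
    simp [hP.coeff_zero] at this
  obtain ⟨d, hd⟩ := Nat.exists_eq_succ_of_ne_zero hd
  rw [hd, Nat.succ_eq_add_one, Nat.add_sub_cancel, Finset.sum_range_succ', Finset.sum_range_succ',
    hP.coeff_zero, zero_add, hP.coeff_one]
  simp

theorem IsDegreeSequence.sum_coeff (hP : IsDegreeSequence P) :
    ∑ k ∈ Finset.range (P.natDegree + 1), P.coeff k = 1 := by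
  rw [← hP.eval_one, Polynomial.eval_eq_sum_range]
  simp

theorem meanDegree_eq (P : Polynomial ℝ) :
    meanDegree P = ∑ k ∈ Finset.range (P.natDegree + 1), P.coeff k * k := by
  rw [meanDegree, Polynomial.derivative_eval, Polynomial.sum_over_range _ (by simp)]
  simp

theorem IsDegreeSequence.meanDegree_pos (hP : IsDegreeSequence P) : 0 < meanDegree P := by
  have h : ∑ k ∈ Finset.range (P.natDegree + 1), P.coeff k ≤ meanDegree P := by
    rw [meanDegree_eq]
    refine Finset.sum_le_sum fun k _ => ?_
    rcases Nat.eq_zero_or_pos k with rfl | hk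
    · simp [hP.coeff_zero]
    · exact le_mul_of_one_le_right (hP.coeff_nonneg k) (by exact_mod_cast hk)
  rw [hP.sum_coeff] at h
  linarith

theorem coe_checkRate (hP : IsDegreeSequence P) {γ : ℝ} (hγ : 0 < γ) (n k : ℕ) :
    (checkRate n γ P k : ℝ) = n * γ / meanDegree P * P.coeff k := by
  have := hP.meanDegree_pos
  have := hP.coeff_nonneg k
  rw [checkRate, Real.coe_toNNReal _ (by positivity)]
  ring

theorem sum_checkRate_mul (hP : IsDegreeSequence P) {γ : ℝ} (hγ : 0 < γ) (n : ℕ) (u : ℕ → ℝ) :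
    ((List.range' 2 (P.natDegree - 1)).map fun k => (checkRate n γ P k : ℝ) * u k).sum =
      n * γ / meanDegree P * ∑ k ∈ Finset.range (P.natDegree + 1), P.coeff k * u k := by
  simp only [coe_checkRate hP hγ, mul_assoc]
  rw [List.sum_map_mul_left, hP.sum_range']

theorem sum_checkRate (hP : IsDegreeSequence P) {γ : ℝ} (hγ : 0 < γ) (n : ℕ) :
    ((List.range' 2 (P.natDegree - 1)).map fun k => (checkRate n γ P k : ℝ)).sum =
      n * γ / meanDegree P := by
  simpa [hP.sum_coeff] using sum_checkRate_mul hP hγ n fun _ => 1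

theorem sum_checkRate_mul_degree (hP : IsDegreeSequence P) {γ : ℝ} (hγ : 0 < γ) (n : ℕ) :
    ((List.range' 2 (P.natDegree - 1)).map fun k => (checkRate n γ P k : ℝ) * k).sum = n * γ := by
  have h := hP.meanDegree_pos.ne'
  rw [sum_checkRate_mul hP hγ n fun k => (k : ℝ), ← meanDegree_eq]
  field_simp

theorem le_natDegree_of_mem_range' {k : ℕ} (hk : k ∈ List.range' 2 (P.natDegree - 1)) :
    k ≤ P.natDegree := by
  have := List.mem_range'_1.1 hk
  omega

/-- Exponential moments for one Poisson round. -/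
theorem centeredMgf_poissonRound_le (hP : IsDegreeSequence P) {γ : ℝ} (hγ : 0 < γ) {n : ℕ}
    (w : PMF (Fin n)) {A : ℝ} {f : TannerGraph n → ℝ} (hf : IsBdd f)
    (h : InsertLipschitz P.natDegree A f) {t : ℝ} (ht : 2 * |t| * A ≤ 1) :
    centeredMgf (poissonRound w γ P) f t ≤
      Real.exp (n * (8 * (γ / meanDegree P) * A ^ 2) * t ^ 2) := by
  refine (centeredMgf_poissonChecks_le w (checkRate n γ P) _
    (fun k hk => le_natDegree_of_mem_range' hk) hf h ht).trans_eq ?_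
  rw [sum_checkRate hP hγ]
  ring_nf

end CheckRates

/-! ### Concentration for the Poisson ensemble. -/

section PoissonEnsemble

variable {𝒜 : Type*} [MeasurableSpace 𝒜] {W : BinaryChannel 𝒜} {κ : CodeKind}
  {P : Polynomial ℝ} {γ : ℝ}

theorem concentratesWith_of_centeredMgf {n : ℕ} [NeZero n] {L : PMF (TannerGraph n)}
    {t₀ v : ℝ} (ht₀ : 0 < t₀) (hv : 0 < v)
    (hm : ∀ t, |t| ≤ t₀ → centeredMgf L (codeEntropy κ W) t ≤ Real.exp (n * v * t ^ 2)) :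
    ConcentratesWith 2 (min t₀ (1 / (2 * v)) / 2) L (codeEntropy κ W) :=
  concentratesWith_of_tailProb (fun G => codeEntropy_mem_Icc κ W G)
    (fun _ hε _ => tailProb_mgf_le (fun G => codeEntropy_mem_Icc κ W G) ht₀ hv hm hε) zero_le_two

theorem poissonEnsemble_concentrates (hW : κ = CodeKind.ldpc → W.OutputSymmetric)
    (hP : IsDegreeSequence P) (hγ : 0 < γ) :
    ∃ A B : ℝ, 0 < A ∧ 0 < B ∧ ∀ (n : ℕ) [NeZero n],
      ConcentratesWith A B (poissonEnsemble n γ P) (codeEntropy κ W) := by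
  have hmd := hP.meanDegree_pos
  have hv : 0 < 8 * (γ / meanDegree P) * 1 ^ 2 := by positivity
  refine ⟨2, min (1 / 2) (1 / (2 * (8 * (γ / meanDegree P) * 1 ^ 2))) / 2, two_pos, by positivity,
    fun n _ => concentratesWith_of_centeredMgf one_half_pos hv fun t ht => ?_⟩
  exact centeredMgf_poissonRound_le hP hγ _ (isBdd_codeEntropy κ W)
    (insertLipschitz_codeEntropy hW _) (by linarith)

end PoissonEnsemble

/-! ## Socket matchings -/

section Sockets

open Equiv

/-- The graph obtained from a matching of check sockets and variable sockets. -/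
def socketGraph {m n : ℕ} {k : Fin m → ℕ} {l : Fin n → ℕ}
    (e : (Σ a, Fin (k a)) ≃ (Σ i, Fin (l i))) : TannerGraph n :=
  List.ofFn fun a => List.ofFn fun r : Fin (k a) => (e ⟨a, r⟩).1

theorem socketGraph_congr_perm {m n : ℕ} {k : Fin m → ℕ} {l : Fin n → ℕ} (ρ : Perm (Fin m))
    (σ : Perm (Fin n)) (e : (Σ a, Fin (k (ρ a))) ≃ (Σ i, Fin (l (σ i)))) :
    (socketGraph (equivCongr (sigmaCongrLeft (β := fun a => Fin (k a)) ρ)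
      (sigmaCongrLeft (β := fun i => Fin (l i)) σ) e)).Perm
      ((socketGraph e).map (List.map σ)) := by
  set e' := equivCongr (sigmaCongrLeft (β := fun a => Fin (k a)) ρ)
      (sigmaCongrLeft (β := fun i => Fin (l i)) σ) e with he'
  have h1 : ∀ a (r : Fin (k (ρ a))), (e' ⟨ρ a, r⟩).1 = σ (e ⟨a, r⟩).1 := by
    intro a r
    have : (sigmaCongrLeft (β := fun a => Fin (k a)) ρ).symm ⟨ρ a, r⟩ = ⟨a, r⟩ := by
      rw [symm_apply_eq]; rfl
    rw [he']
    simp only [equivCongr_apply_apply, this]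
    rfl
  refine (Perm.ofFn_comp_perm ρ _).symm.trans (List.Perm.of_eq ?_)
  rw [socketGraph, List.map_ofFn]
  congr 1
  funext a
  simp only [Function.comp_apply, List.map_ofFn]
  congr 1
  funext r
  exact h1 a r

variable {α : Type*}

theorem List.ofFn_update {m : ℕ} (F : Fin m → α) (a : Fin m) (x : α) :
    List.ofFn (Function.update F a x) = (List.ofFn F).set a x := by
  refine List.ext_getElem (by simp) fun i h1 h2 => ?_
  simp only [List.getElem_ofFn, List.getElem_set, Function.update_apply, Fin.ext_iff]
  simp only [eq_comm]

theorem abs_ofFn_update_sub_le {f : List (List α) → ℝ} {A : ℝ} (h : ∀ K, InsertLipschitz K A f)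
    {m : ℕ} (F : Fin m → List α) (a : Fin m) (x : List α) :
    |f (List.ofFn (Function.update F a x)) - f (List.ofFn F)| ≤ 2 * A := by
  have ha : (a : ℕ) < (List.ofFn F).length := by simp
  rw [List.ofFn_update, List.set_eq_take_append_cons_drop, if_pos ha]
  have e1 : List.ofFn F = (List.ofFn F).take a ++ (List.ofFn F)[(a : ℕ)] ::
      (List.ofFn F).drop (a + 1) := by
    rw [← List.drop_eq_getElem_cons ha, List.take_append_drop]
  have h1 := h _ ((List.ofFn F).take a) ((List.ofFn F).drop (a + 1)) x le_rfl
  have h2 := h _ ((List.ofFn F).take a) ((List.ofFn F).drop (a + 1)) (List.ofFn F)[(a : ℕ)] le_rfl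
  rw [← e1, abs_sub_comm] at h2
  exact (abs_sub_le _ _ _).trans ((add_le_add h1 h2).trans_eq (two_mul A).symm)

/-- Exchanging two variable sockets alters only the checks matched to them, at most two. Each
altered check is a replacement, of cost `2 * A`. -/
theorem abs_socketGraph_swap_sub_le {m n : ℕ} {k : Fin m → ℕ} {l : Fin n → ℕ}
    {f : TannerGraph n → ℝ} {A : ℝ} (h : ∀ K, InsertLipschitz K A f) (u v : Σ i, Fin (l i))
    (e : (Σ a, Fin (k a)) ≃ (Σ i, Fin (l i))) :
    |f (socketGraph (e.trans (swap u v))) - f (socketGraph e)| ≤ 4 * A := by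
  set F : Fin m → List (Fin n) := fun a => List.ofFn fun r : Fin (k a) => (e ⟨a, r⟩).1 with hF
  set F' : Fin m → List (Fin n) := fun a =>
    List.ofFn fun r : Fin (k a) => ((e.trans (swap u v)) ⟨a, r⟩).1 with hF'
  set a := (e.symm u).1
  set b := (e.symm v).1
  have hoff : ∀ c, c ≠ a → c ≠ b → F' c = F c := by
    intro c hca hcb
    simp only [hF, hF', trans_apply]
    congr 1
    funext r
    rw [swap_apply_of_ne_of_ne]
    · rintro rfl
      exact hca (by simp [a])
    · rintro rfl
      exact hcb (by simp [b])
  have hup : F' = Function.update (Function.update F a (F' a)) b (F' b) := by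
    funext c
    by_cases hcb : c = b
    · subst hcb; simp
    · rw [Function.update_of_ne hcb]
      by_cases hca : c = a
      · subst hca; simp
      · rw [Function.update_of_ne hca, hoff c hca hcb]
  have h1 := abs_ofFn_update_sub_le h (Function.update F a (F' a)) b (F' b)
  rw [← hup] at h1
  have h2 := abs_ofFn_update_sub_le h F a (F' a)
  have h3 := abs_sub_le (f (List.ofFn F')) (f (List.ofFn (Function.update F a (F' a))))
    (f (List.ofFn F))
  change |f (List.ofFn F') - f (List.ofFn F)| ≤ 4 * A
  linarith

end Sockets

/-! ## Standard ensembles -/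

section Standard

theorem expect_uniformOfFintype_eq_of_sum {α : Type*} [Fintype α] [Nonempty α] {f : α → ℝ} {M : ℝ}
    (h : ∑ x, f x = Fintype.card α * M) : expect (PMF.uniformOfFintype α) f = M := by
  have : (Fintype.card α : ℝ) ≠ 0 := Nat.cast_ne_zero.2 Fintype.card_ne_zero
  rw [expect_uniformOfFintype, h]
  field_simp

theorem sum_eq_card_mul_expect {α : Type*} [Fintype α] [Nonempty α] (f : α → ℝ) :
    ∑ x, f x = Fintype.card α * expect (PMF.uniformOfFintype α) f := by
  have : (Fintype.card α : ℝ) ≠ 0 := Nat.cast_ne_zero.2 Fintype.card_ne_zero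
  rw [expect_uniformOfFintype]
  field_simp

theorem DegreeAssignment.exists_perm {n : ℕ} {Λ : Polynomial ℝ} (d d' : DegreeAssignment n Λ) :
    ∃ σ : Equiv.Perm (Fin n), ∀ i, d.1 i = d'.1 (σ i) := by
  obtain ⟨σ, hσ⟩ := exists_equiv_of_card_fiber_eq d.1 d'.1 fun c => by
    have h := (d.2 c).trans (d'.2 c).symm
    exact_mod_cast h
  exact ⟨σ, fun i => (hσ i).symm⟩

variable {𝒜 : Type*} [MeasurableSpace 𝒜] {W : BinaryChannel 𝒜} {κ : CodeKind}

/-- Averages over the matchings of the entropy do not depend on the order of the nodes. -/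
theorem sum_codeEntropy_socketGraph_congr (κ : CodeKind) (W : BinaryChannel 𝒜) {m n : ℕ}
    (k : Fin m → ℕ) (l : Fin n → ℕ) (ρ : Equiv.Perm (Fin m)) (σ : Equiv.Perm (Fin n)) :
    Fintype.card ((Σ a, Fin (k (ρ a))) ≃ (Σ i, Fin (l (σ i)))) =
      Fintype.card ((Σ a, Fin (k a)) ≃ (Σ i, Fin (l i))) ∧
    ∑ e : (Σ a, Fin (k (ρ a))) ≃ (Σ i, Fin (l (σ i))), codeEntropy κ W (socketGraph e) =
      ∑ e : (Σ a, Fin (k a)) ≃ (Σ i, Fin (l i)), codeEntropy κ W (socketGraph e) := by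
  set Φ := Equiv.equivCongr (Equiv.sigmaCongrLeft (β := fun a => Fin (k a)) ρ)
      (Equiv.sigmaCongrLeft (β := fun i => Fin (l i)) σ) with hΦ
  refine ⟨Fintype.card_congr Φ, ?_⟩
  rw [← Φ.sum_comp]
  refine Finset.sum_congr rfl fun e _ => ?_
  rw [codeEntropy_perm κ W (socketGraph_congr_perm ρ σ e), codeEntropy_map]

theorem sum_standardConfig {n : ℕ} {Λ P : Polynomial ℝ} (F : StandardConfig n Λ P → ℝ) :
    ∑ s, F s = ∑ d : DegreeAssignment n Λ, ∑ c : DegreeAssignment (standardCheckCount n Λ P) P,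
      ∑ e : (Σ a, Fin (c.degree a)) ≃ (Σ i, Fin (d.degree i)), F ⟨d, c, e⟩ := by
  let T : (Σ (d : DegreeAssignment n Λ) (c : DegreeAssignment (standardCheckCount n Λ P) P),
    (Σ a, Fin (c.degree a)) ≃ (Σ i, Fin (d.degree i))) ≃ StandardConfig n Λ P := Equiv.refl _
  rw [← T.sum_comp F, Fintype.sum_sigma]
  exact Finset.sum_congr rfl fun d _ => Fintype.sum_sigma _

/-- The degree partitions contribute no fluctuation: all fibres over them have the same mean `M` by
relabelling, so the exponential moment is an average of those of uniform matchings. -/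
theorem centeredMgf_standardEnsemble_le (hW : κ = CodeKind.ldpc → W.OutputSymmetric) {n : ℕ}
    (Λ P : Polynomial ℝ) [Nonempty (StandardConfig n Λ P)] (t : ℝ) :
    centeredMgf (standardEnsemble n Λ P) (codeEntropy κ W) t ≤
      Real.exp (n * (32 * (Λ.natDegree + 1)) * t ^ 2) := by
  set V := Real.exp (n * (32 * (Λ.natDegree + 1)) * t ^ 2) with hV
  have hH : ∀ K, InsertLipschitz K 1 fun G : TannerGraph n => codeEntropy κ W G := fun K =>
    insertLipschitz_codeEntropy hW K
  rw [standardEnsemble, centeredMgf_map _ _ (isBdd_codeEntropy κ W)]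
  obtain ⟨d₀, c₀, e₀⟩ := ‹Nonempty (StandardConfig n Λ P)›.some
  have hne₀ : Nonempty ((Σ a, Fin (c₀.degree a)) ≃ (Σ i, Fin (d₀.degree i))) := ⟨e₀⟩
  set M := expect (PMF.uniformOfFintype ((Σ a, Fin (c₀.degree a)) ≃ (Σ i, Fin (d₀.degree i))))
    fun e => codeEntropy κ W (socketGraph e) with hM
  -- Any two partitions of the same type differ by permutations of the nodes, so a matching in one
  -- fibre yields one in every fibre, with the same average entropy.
  have hfib : ∀ (d : DegreeAssignment n Λ) (c : DegreeAssignment (standardCheckCount n Λ P) P),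
      Nonempty ((Σ a, Fin (c.degree a)) ≃ (Σ i, Fin (d.degree i))) ∧
      ∑ e : (Σ a, Fin (c.degree a)) ≃ (Σ i, Fin (d.degree i)), codeEntropy κ W (socketGraph e) =
        Fintype.card ((Σ a, Fin (c.degree a)) ≃ (Σ i, Fin (d.degree i))) * M := by
    intro d c
    obtain ⟨σ, hσ⟩ := d.exists_perm d₀
    obtain ⟨ρ, hρ⟩ := c.exists_perm c₀
    have h1 : d.degree = fun i => d₀.degree (σ i) := funext fun i => congrArg Fin.val (hσ i)
    have h2 : c.degree = fun a => c₀.degree (ρ a) := funext fun a => congrArg Fin.val (hρ a)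
    rw [h1, h2]
    obtain ⟨h3, h4⟩ := sum_codeEntropy_socketGraph_congr κ W c₀.degree d₀.degree ρ σ
    refine ⟨Fintype.card_pos_iff.1 (h3 ▸ Fintype.card_pos), ?_⟩
    rw [h4, h3, hM, ← sum_eq_card_mul_expect]
  have hcard : (Fintype.card (StandardConfig n Λ P) : ℝ) = ∑ d : DegreeAssignment n Λ,
      ∑ c : DegreeAssignment (standardCheckCount n Λ P) P,
      (Fintype.card ((Σ a, Fin (c.degree a)) ≃ (Σ i, Fin (d.degree i))) : ℝ) := by
    have := sum_standardConfig fun _ : StandardConfig n Λ P => (1 : ℝ)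
    simpa using this
  have hmean : expect (PMF.uniformOfFintype (StandardConfig n Λ P))
      (fun s => codeEntropy κ W s.graph) = M := by
    refine expect_uniformOfFintype_eq_of_sum ?_
    rw [sum_standardConfig, hcard, Finset.sum_mul]
    refine Finset.sum_congr rfl fun d _ => ?_
    rw [Finset.sum_mul]
    exact Finset.sum_congr rfl fun c _ => (hfib d c).2
  have hpos : (0 : ℝ) < Fintype.card (StandardConfig n Λ P) := Nat.cast_pos.2 Fintype.card_pos
  rw [centeredMgf, hmean, expect_uniformOfFintype, div_le_iff₀ hpos, sum_standardConfig, hcard,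
    Finset.mul_sum]
  refine Finset.sum_le_sum fun d _ => ?_
  rw [Finset.mul_sum]
  refine Finset.sum_le_sum fun c _ => ?_
  have hne := (hfib d c).1
  have hmean' : expect (PMF.uniformOfFintype ((Σ a, Fin (c.degree a)) ≃ (Σ i, Fin (d.degree i))))
      (fun e => codeEntropy κ W (socketGraph e)) = M :=
    expect_uniformOfFintype_eq_of_sum (hfib d c).2
  -- A transposition costs 4, so each socket contributes `t² (2 · 4)² / 2 = 32 t²`, and there are at
  -- most `n (Λ.natDegree + 1)` sockets.
  have key := centeredMgf_equiv_le (f := fun e : (Σ a, Fin (c.degree a)) ≃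
    (Σ i, Fin (d.degree i)) => codeEntropy κ W (socketGraph e)) (c := 4 * 1)
    (fun u v e => abs_socketGraph_swap_sub_le hH u v e) t
  have hN : (Fintype.card (Σ i, Fin (d.degree i)) : ℝ) ≤ n * (Λ.natDegree + 1) := by
    rw [Fintype.card_sigma]
    simp only [Fintype.card_fin]
    have : ∑ i, d.degree i ≤ ∑ _i : Fin n, (Λ.natDegree + 1) :=
      Finset.sum_le_sum fun i _ => (d.1 i).2.le
    rw [Finset.sum_const, Finset.card_univ, Fintype.card_fin, smul_eq_mul] at this
    exact_mod_cast this
  have hkV := key.trans (b := _) (c := V) (Real.exp_le_exp.2 (by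
    have := mul_le_mul_of_nonneg_right hN (by positivity : 0 ≤ t ^ 2 * (2 * (4 * 1 : ℝ)) ^ 2 / 2)
    linarith))
  rw [centeredMgf, hmean', expect_uniformOfFintype,
    div_le_iff₀ (Nat.cast_pos.2 Fintype.card_pos)] at hkV
  exact hkV

theorem standardEnsemble_concentrates (hW : κ = CodeKind.ldpc → W.OutputSymmetric)
    (Λ P : Polynomial ℝ) :
    ∃ A B : ℝ, 0 < A ∧ 0 < B ∧ ∀ (n : ℕ) [NeZero n] [Nonempty (StandardConfig n Λ P)],
      ConcentratesWith A B (standardEnsemble n Λ P) (codeEntropy κ W) :=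
  -- The exponential moment bound holds for every `t`, so the threshold 1 is an arbitrary choice.
  ⟨2, min 1 (1 / (2 * (32 * ((Λ.natDegree : ℝ) + 1)))) / 2, two_pos, by positivity, fun n _ _ =>
    concentratesWith_of_centeredMgf one_pos (by positivity) fun t _ =>
      centeredMgf_standardEnsemble_le hW Λ P t⟩

end Standard

/-! ## Regularized socket laws -/

/-- The `ℓ¹` distance of two integer vectors. -/
def vecDist {n : ℕ} (d d' : Fin n → ℤ) : ℝ := ∑ i, |(d i : ℝ) - d' i|

section RegularizedLaw

variable {n : ℕ} {a : ℝ}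

theorem vecDist_nonneg (d d' : Fin n → ℤ) : 0 ≤ vecDist d d' :=
  Finset.sum_nonneg fun _ _ => abs_nonneg _

/-- The number of free sockets. -/
def freeSockets (d : Fin n → ℤ) : ℝ := ∑ i, ((d i).toNat : ℝ)

/-- The number of free sockets at each node, increased uniformly so that the total is at least
`a`. -/
def paddedWeight (a : ℝ) (d : Fin n → ℤ) (i : Fin n) : ℝ :=
  (d i).toNat + max (a - freeSockets d) 0 / n

theorem paddedWeight_nonneg (a : ℝ) (d : Fin n → ℤ) (i : Fin n) : 0 ≤ paddedWeight a d i :=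
  add_nonneg (Nat.cast_nonneg _) (div_nonneg (le_max_right _ _) (Nat.cast_nonneg _))

theorem abs_toNat_sub_le (u v : ℤ) : |(u.toNat : ℝ) - v.toNat| ≤ |(u : ℝ) - v| := by
  have h : ∀ u : ℤ, (u.toNat : ℝ) = max (u : ℝ) 0 := fun u => by
    rw [← Int.cast_natCast, Int.toNat_eq_max]; push_cast; rfl
  rw [h, h]
  exact abs_max_sub_max_le_abs _ _ _

theorem abs_freeSockets_sub_le (d d' : Fin n → ℤ) :
    |freeSockets d - freeSockets d'| ≤ vecDist d d' := by
  rw [freeSockets, freeSockets, ← Finset.sum_sub_distrib]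
  exact (Finset.abs_sum_le_sum_abs _ _).trans
    (Finset.sum_le_sum fun i _ => abs_toNat_sub_le (d i) (d' i))

variable [NeZero n]

theorem sum_paddedWeight (a : ℝ) (d : Fin n → ℤ) :
    ∑ i, paddedWeight a d i = max a (freeSockets d) := by
  have hn : (n : ℝ) ≠ 0 := Nat.cast_ne_zero.2 (NeZero.ne n)
  simp only [paddedWeight, Finset.sum_add_distrib, Finset.sum_const, Finset.card_univ,
    Fintype.card_fin, nsmul_eq_mul]
  rw [mul_div_cancel₀ _ hn, ← freeSockets, ← max_add_add_left]
  simp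

theorem sum_abs_paddedWeight_sub_le (a : ℝ) (d d' : Fin n → ℤ) :
    ∑ i, |paddedWeight a d i - paddedWeight a d' i| ≤ 2 * vecDist d d' := by
  have hn : (0 : ℝ) < n := Nat.cast_pos.2 (NeZero.pos n)
  have h1 : ∀ i, |paddedWeight a d i - paddedWeight a d' i| ≤
      |(d i : ℝ) - d' i| + vecDist d d' / n := by
    intro i
    rw [paddedWeight, paddedWeight, add_sub_add_comm, ← sub_div]
    refine (abs_add_le _ _).trans (add_le_add (abs_toNat_sub_le _ _) ?_)
    rw [abs_div, abs_of_pos hn]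
    refine div_le_div_of_nonneg_right ((abs_max_sub_max_le_abs _ _ _).trans ?_) hn.le
    rw [sub_sub_sub_cancel_left, abs_sub_comm]
    exact abs_freeSockets_sub_le d d'
  refine (Finset.sum_le_sum fun i _ => h1 i).trans_eq ?_
  rw [Finset.sum_add_distrib, Finset.sum_const, Finset.card_univ, Fintype.card_fin, nsmul_eq_mul,
    mul_div_cancel₀ _ hn.ne', two_mul]
  rfl

/-- The law proportional to `paddedWeight`. It is the socket law as long as there are at least `a`
free sockets. -/
def paddedLaw (a : ℝ) (ha : 0 < a) (d : Fin n → ℤ) : PMF (Fin n) :=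
  PMF.normalize (fun i => ENNReal.ofReal (paddedWeight a d i))
    (by
      rw [tsum_fintype, ← ENNReal.ofReal_sum_of_nonneg fun i _ => paddedWeight_nonneg a d i,
        sum_paddedWeight]
      exact (ENNReal.ofReal_pos.2 (lt_max_of_lt_left ha)).ne')
    (by
      rw [tsum_fintype, ← ENNReal.ofReal_sum_of_nonneg fun i _ => paddedWeight_nonneg a d i]
      exact ENNReal.ofReal_ne_top)

theorem paddedLaw_toReal (ha : 0 < a) (d : Fin n → ℤ) (i : Fin n) :
    (paddedLaw a ha d i).toReal = paddedWeight a d i / max a (freeSockets d) := by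
  rw [paddedLaw, PMF.normalize_apply, tsum_fintype,
    ← ENNReal.ofReal_sum_of_nonneg fun i _ => paddedWeight_nonneg a d i, sum_paddedWeight,
    ENNReal.toReal_mul, ENNReal.toReal_inv, ENNReal.toReal_ofReal (paddedWeight_nonneg a d i),
    ENNReal.toReal_ofReal (ha.le.trans (le_max_left _ _)), div_eq_mul_inv]

theorem socketLaw_eq_paddedLaw (ha : 0 < a) {d : Fin n → ℤ} (h : ∃ i, 0 < d i)
    (hd : a ≤ freeSockets d) : socketLaw d h = paddedLaw a ha d := by
  have hf : (fun i => ENNReal.ofReal (paddedWeight a d i)) = fun i => ((d i).toNat : ℝ≥0∞) := by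
    funext i
    rw [paddedWeight, max_eq_right (sub_nonpos.2 hd), zero_div, add_zero, ENNReal.ofReal_natCast]
  ext i
  simp only [socketLaw, paddedLaw, PMF.normalize_apply, hf]

/-- The weights change by at most twice the distance and the normalization by at most once, while
padding keeps the denominators above `a`. This gives the factor 3, rounded up to 4. -/
theorem lawDist_paddedLaw_le (ha : 0 < a) (d d' : Fin n → ℤ) :
    lawDist (paddedLaw a ha d) (paddedLaw a ha d') ≤ 4 * vecDist d d' / a := by
  set U := max a (freeSockets d)
  set U' := max a (freeSockets d')
  have hU : 0 < U := lt_max_of_lt_left ha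
  have hU' : 0 < U' := lt_max_of_lt_left ha
  have hUU : |U - U'| ≤ vecDist d d' := by
    simp only [U, U', max_comm a]
    exact (abs_max_sub_max_le_abs _ _ _).trans (abs_freeSockets_sub_le d d')
  have h1 : ∀ i, |paddedWeight a d i / U - paddedWeight a d' i / U'| ≤
      |paddedWeight a d i - paddedWeight a d' i| / U +
        paddedWeight a d' i * (vecDist d d' / (U * U')) := by
    intro i
    have h2 : paddedWeight a d i / U - paddedWeight a d' i / U' =
        (paddedWeight a d i - paddedWeight a d' i) / U +
          paddedWeight a d' i * ((U' - U) / (U * U')) := by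
      field_simp
      ring
    rw [h2]
    refine (abs_add_le _ _).trans (add_le_add ?_ ?_)
    · rw [abs_div, abs_of_pos hU]
    · rw [abs_mul, abs_of_nonneg (paddedWeight_nonneg a d' i), abs_div,
        abs_of_pos (mul_pos hU hU'), abs_sub_comm]
      exact mul_le_mul_of_nonneg_left (div_le_div_of_nonneg_right hUU (mul_pos hU hU').le)
        (paddedWeight_nonneg a d' i)
  simp only [lawDist, paddedLaw_toReal]
  refine (Finset.sum_le_sum fun i _ => h1 i).trans ?_
  rw [Finset.sum_add_distrib, ← Finset.sum_div, ← Finset.sum_mul, sum_paddedWeight]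
  have h3 : U' * (vecDist d d' / (U * U')) = vecDist d d' / U := by field_simp
  have h4 := sum_abs_paddedWeight_sub_le a d d'
  have h5 := vecDist_nonneg d d'
  refine (add_le_add_left (div_le_div_of_nonneg_right h4 hU.le) _).trans ?_
  change 2 * vecDist d d' / U + U' * (vecDist d d' / (U * U')) ≤ _
  rw [h3, ← add_div]
  exact div_le_div₀ (by positivity) (by linarith) ha (le_max_left _ _)

end RegularizedLaw

/-! ## Regularized multi-Poisson rounds -/

/-- The free sockets left after the checks `R` have been connected. -/
def remaining {n : ℕ} (d : Fin n → ℤ) (R : TannerGraph n) (i : Fin n) : ℤ :=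
  d i - (R.flatten.count i : ℤ)

/-- The multi-Poisson rounds with padded socket laws. -/
def paddedRounds {n : ℕ} [NeZero n] (a : ℝ) (ha : 0 < a) (γ : ℝ) (P : Polynomial ℝ) :
    ℕ → (Fin n → ℤ) → TannerGraph n → PMF (TannerGraph n)
  | 0, _, G => PMF.pure G
  | t + 1, d, G => (poissonRound (paddedLaw a ha d) γ P).bind fun R =>
      paddedRounds a ha γ P t (remaining d R) (G ++ R)

/-- The Lipschitz constants of the expectation after `t` rounds in the numbers of free sockets. -/
def socketLipschitz (K : ℕ) : ℕ → ℝ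
  | 0 => 0
  | t + 1 => socketLipschitz K t + 8 * (1 + K * socketLipschitz K t)

section PaddedRounds

variable {n : ℕ}

theorem socketLipschitz_nonneg (K t : ℕ) : 0 ≤ socketLipschitz K t := by
  induction t with
  | zero => exact le_rfl
  | succ t ih => rw [socketLipschitz]; positivity

theorem socketLipschitz_mono (K : ℕ) : Monotone (socketLipschitz K) :=
  monotone_nat_of_le_succ fun t => by
    have := socketLipschitz_nonneg K t
    rw [socketLipschitz]
    exact le_add_of_nonneg_right (by positivity)

theorem sum_count_eq_length (c : List (Fin n)) : ∑ i, c.count i = c.length := by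
  have := Multiset.sum_count_eq_card (s := Finset.univ) (m := (c : Multiset (Fin n))) (by simp)
  simpa using this

theorem vecDist_remaining_insert (d : Fin n → ℤ) (l r : TannerGraph n) (c : List (Fin n)) :
    vecDist (remaining d (l ++ c :: r)) (remaining d (l ++ r)) = c.length := by
  rw [vecDist, ← sum_count_eq_length]
  push_cast
  refine Finset.sum_congr rfl fun i _ => ?_
  have : ((remaining d (l ++ c :: r) i : ℤ) : ℝ) - remaining d (l ++ r) i = -(c.count i : ℝ) := by
    simp only [remaining, List.flatten_append, List.flatten_cons, List.count_append]
    push_cast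
    ring
  rw [this, abs_neg, abs_of_nonneg (Nat.cast_nonneg _)]

theorem vecDist_remaining (d d' : Fin n → ℤ) (R : TannerGraph n) :
    vecDist (remaining d R) (remaining d' R) = vecDist d d' := by
  refine Finset.sum_congr rfl fun i _ => ?_
  simp only [remaining]
  push_cast
  ring_nf

theorem sum_remaining (d : Fin n → ℤ) (R : TannerGraph n) :
    ∑ i, (remaining d R i : ℝ) = ∑ i, (d i : ℝ) - R.flatten.length := by
  rw [← sum_count_eq_length]
  simp only [remaining]
  push_cast
  rw [Finset.sum_sub_distrib]

variable [NeZero n] {a : ℝ} (ha : 0 < a) {γ : ℝ} {P : Polynomial ℝ}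
  {H : TannerGraph n → ℝ}

theorem expect_paddedRounds_succ (hH : IsBdd H) (t : ℕ) (d : Fin n → ℤ) (G : TannerGraph n) :
    expect (paddedRounds a ha γ P (t + 1) d G) H = expect (poissonRound (paddedLaw a ha d) γ P)
      fun R => expect (paddedRounds a ha γ P t (remaining d R) (G ++ R)) H := by
  rw [paddedRounds, expect_bind _ _ hH]

theorem isBdd_expect {α β : Type*} {H : β → ℝ} (hH : IsBdd H) (q : α → PMF β) :
    IsBdd fun x => expect (q x) H :=
  (hH.comp Prod.snd).expect

/-- The future rounds depend on the free sockets but not on the graph built so far, so both graphs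
can be continued by the same checks. -/
theorem insertLipschitz_paddedRounds {A : ℝ} {K : ℕ} (hH : IsBdd H) (h : InsertLipschitz K A H)
    (t : ℕ) (d : Fin n → ℤ) :
    InsertLipschitz K A fun G => expect (paddedRounds a ha γ P t d G) H := by
  induction t generalizing d with
  | zero => simpa only [paddedRounds, expect_pure] using h
  | succ t ih =>
    intro l r c hc
    simp only [expect_paddedRounds_succ ha hH]
    refine abs_expect_sub_le (isBdd_expect hH _) (isBdd_expect hH _) fun R _ => ?_
    simpa using ih (remaining d R) l (r ++ R) c hc

/-- A check of the current round acts twice: it is present in the final graph, at cost 1, and it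
uses up at most `P.natDegree` sockets, each at cost `b` for the later rounds. -/
theorem insertLipschitz_of_remaining (hH : IsBdd H) (h : InsertLipschitz P.natDegree 1 H) {t : ℕ}
    {b : ℝ} (hb : 0 ≤ b) (hV : ∀ d d' G, |expect (paddedRounds a ha γ P t d G) H -
      expect (paddedRounds a ha γ P t d' G) H| ≤ b * vecDist d d')
    (d : Fin n → ℤ) (G : TannerGraph n) :
    InsertLipschitz P.natDegree (1 + P.natDegree * b) fun R =>
      expect (paddedRounds a ha γ P t (remaining d R) (G ++ R)) H := by
  intro l r c hc
  have h1 := hV (remaining d (l ++ c :: r)) (remaining d (l ++ r)) (G ++ (l ++ c :: r))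
  have h2 := insertLipschitz_paddedRounds ha (γ := γ) (P := P) hH h t (remaining d (l ++ r))
    (G ++ l) r c hc
  rw [vecDist_remaining_insert] at h1
  simp only [List.append_assoc] at h2
  have h3 : b * (c.length : ℝ) ≤ P.natDegree * b := by
    rw [mul_comm]
    exact mul_le_mul_of_nonneg_right (by exact_mod_cast hc) hb
  refine (abs_sub_le _ _ _).trans ((add_le_add (h1.trans h3) h2).trans_eq ?_)
  ring

/-- Changing `d` affects the later rounds, where the distance of the socket vectors is unchanged if
the same checks are drawn, and the law of the current draws. In the second effect the mean number `n
γ` of edges cancels the `a` in the denominator of `lawDist_paddedLaw_le`, leaving `8 (1 + K b)` with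
`K = P.natDegree`; this is the recursion of `socketLipschitz`, free of `n`. -/
theorem abs_expect_paddedRounds_sub_le (hP : IsDegreeSequence P) (hγ : 0 < γ) (hH : IsBdd H)
    (h : InsertLipschitz P.natDegree 1 H) (han : a = n * γ) (t : ℕ) (d d' : Fin n → ℤ)
    (G : TannerGraph n) :
    |expect (paddedRounds a ha γ P t d G) H - expect (paddedRounds a ha γ P t d' G) H| ≤
      socketLipschitz P.natDegree t * vecDist d d' := by
  induction t generalizing d d' G with
  | zero => simp [paddedRounds, expect_pure, socketLipschitz]
  | succ t ih =>
    have hb := socketLipschitz_nonneg P.natDegree t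
    set b := socketLipschitz P.natDegree t with hbdef
    have hK : (0 : ℝ) ≤ P.natDegree := Nat.cast_nonneg _
    simp only [expect_paddedRounds_succ ha hH]
    have h1 : |(expect (poissonRound (paddedLaw a ha d) γ P) fun R =>
          expect (paddedRounds a ha γ P t (remaining d R) (G ++ R)) H) -
        expect (poissonRound (paddedLaw a ha d) γ P) fun R =>
          expect (paddedRounds a ha γ P t (remaining d' R) (G ++ R)) H| ≤ b * vecDist d d' := by
      refine abs_expect_sub_le (isBdd_expect hH _) (isBdd_expect hH _) fun R _ => ?_
      exact (ih _ _ _).trans_eq (by rw [vecDist_remaining])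
    have h2 := abs_expect_poissonChecks_sub_le (paddedLaw a ha d) (paddedLaw a ha d')
      (checkRate n γ P) (List.range' 2 (P.natDegree - 1))
      (fun k hk => le_natDegree_of_mem_range' hk)
      (isBdd_expect hH fun R => paddedRounds a ha γ P t (remaining d' R) (G ++ R))
      (insertLipschitz_of_remaining ha hH h hb ih d' G)
    rw [sum_checkRate_mul_degree hP hγ, ← han] at h2
    have h3 : a * (2 * (1 + P.natDegree * b) * lawDist (paddedLaw a ha d) (paddedLaw a ha d')) ≤
        8 * (1 + P.natDegree * b) * vecDist d d' := by
      have h4 := mul_le_mul_of_nonneg_left (lawDist_paddedLaw_le ha d d')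
        (by positivity : 0 ≤ a * (2 * (1 + P.natDegree * b)))
      refine (h4.trans_eq ?_).trans' (by ring_nf; exact le_rfl)
      field_simp
      ring
    refine (abs_sub_le _ _ _).trans ((add_le_add h1 (h2.trans h3)).trans_eq ?_)
    rw [socketLipschitz]
    ring

theorem InsertLipschitz.mono {α : Type*} {K : ℕ} {A B : ℝ} {f : List (List α) → ℝ}
    (h : InsertLipschitz K A f) (hAB : A ≤ B) : InsertLipschitz K B f :=
  fun l r c hc => (h l r c hc).trans hAB

theorem centeredMgf_paddedRounds_le (hP : IsDegreeSequence P) (hγ : 0 < γ) (hH : IsBdd H)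
    (h : InsertLipschitz P.natDegree 1 H) (han : a = n * γ) {A s : ℝ} (hs : 2 * |s| * A ≤ 1)
    (t : ℕ) (hA : 1 + P.natDegree * socketLipschitz P.natDegree t ≤ A) (d : Fin n → ℤ)
    (G : TannerGraph n) :
    centeredMgf (paddedRounds a ha γ P t d G) H s ≤
      Real.exp (n * (t * (8 * (γ / meanDegree P) * A ^ 2)) * s ^ 2) := by
  induction t generalizing d G with
  | zero => simp [paddedRounds, centeredMgf, expect_pure]
  | succ t ih =>
    have hA' : 1 + P.natDegree * socketLipschitz P.natDegree t ≤ A :=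
      (add_le_add_right (mul_le_mul_of_nonneg_left (socketLipschitz_mono P.natDegree t.le_succ)
        (Nat.cast_nonneg _)) 1).trans hA
    rw [paddedRounds]
    refine (centeredMgf_bind_le _ _ hH fun R _ => ih hA' _ _).trans ?_
    have h1 := (insertLipschitz_of_remaining ha hH h (socketLipschitz_nonneg P.natDegree t)
      (abs_expect_paddedRounds_sub_le ha hP hγ hH h han t) d G).mono hA'
    refine (mul_le_mul_of_nonneg_right (centeredMgf_poissonRound_le hP hγ _
      (isBdd_expect hH _) h1 hs) (Real.exp_pos _).le).trans_eq ?_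
    rw [← Real.exp_add]
    push_cast
    ring_nf

end PaddedRounds

/-! ## Uniform degree assignments -/

section UniformDegrees

open Equiv

variable {n : ℕ} {Λ : Polynomial ℝ}

/-- Relabelling of the nodes. -/
def DegreeAssignment.permute (d : DegreeAssignment n Λ) (σ : Perm (Fin n)) :
    DegreeAssignment n Λ :=
  ⟨fun i => d.1 (σ i), fun l => by
    rw [← d.2 l]
    exact congrArg _ (Finset.card_equiv σ fun i => by simp)⟩

/-- Permutations act transitively on the assignments; summing over pairs of an assignment and a
permutation in both orders gives the identity. -/
theorem expect_uniform_degreeAssignment [Nonempty (DegreeAssignment n Λ)]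
    (d₀ : DegreeAssignment n Λ) (f : DegreeAssignment n Λ → ℝ) :
    expect (PMF.uniformOfFintype (DegreeAssignment n Λ)) f =
      expect (PMF.uniformOfFintype (Perm (Fin n))) fun σ => f (d₀.permute σ) := by
  have h1 : ∀ σ : Perm (Fin n), ∑ d : DegreeAssignment n Λ, f (d.permute σ) = ∑ d, f d := by
    intro σ
    have hinv : ∀ (σ : Perm (Fin n)) (d : DegreeAssignment n Λ),
        (d.permute σ).permute σ⁻¹ = d := fun σ d =>
      Subtype.ext (funext fun i => congrArg d.1 (σ.apply_symm_apply i))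
    let T : DegreeAssignment n Λ ≃ DegreeAssignment n Λ :=
      { toFun := fun d => d.permute σ
        invFun := fun d => d.permute σ⁻¹
        left_inv := hinv σ
        right_inv := fun d => by simpa using hinv σ⁻¹ d }
    exact Equiv.sum_comp T f
  have h2 : ∀ d : DegreeAssignment n Λ, ∑ σ : Perm (Fin n), f (d.permute σ) =
      ∑ σ : Perm (Fin n), f (d₀.permute σ) := by
    intro d
    obtain ⟨ρ, hρ⟩ := d.exists_perm d₀
    refine Fintype.sum_equiv (Equiv.mulLeft ρ) _ _ fun σ => ?_
    congr 1
    exact Subtype.ext (funext fun i => hρ (σ i))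
  refine expect_uniformOfFintype_eq_of_sum ?_
  have hc : (Fintype.card (Perm (Fin n)) : ℝ) ≠ 0 := Nat.cast_ne_zero.2 Fintype.card_ne_zero
  rw [expect_uniformOfFintype, mul_div_assoc', eq_div_iff hc]
  have h3 := Finset.sum_comm (s := Finset.univ) (t := Finset.univ)
    (f := fun (d : DegreeAssignment n Λ) (σ : Perm (Fin n)) => f (d.permute σ))
  simp only [h1, h2, Finset.sum_const, Finset.card_univ, nsmul_eq_mul] at h3
  linarith

/-- A transposition of the nodes moves two entries of the degree vector, each by at most
`Λ.natDegree`. -/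
theorem centeredMgf_uniform_degreeAssignment_le [Nonempty (DegreeAssignment n Λ)]
    {g : (Fin n → ℤ) → ℝ} {b : ℝ} (hb : 0 ≤ b) (hg : ∀ d d', |g d - g d'| ≤ b * vecDist d d')
    (t : ℝ) :
    centeredMgf (PMF.uniformOfFintype (DegreeAssignment n Λ))
      (fun d => g fun i => (d.degree i : ℤ)) t ≤
      Real.exp (n * (8 * (b * Λ.natDegree) ^ 2) * t ^ 2) := by
  have d₀ : DegreeAssignment n Λ := Classical.arbitrary _
  rw [centeredMgf, expect_uniform_degreeAssignment d₀, expect_uniform_degreeAssignment d₀]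
  refine (centeredMgf_perm_le n (c := b * (2 * Λ.natDegree))
    (f := fun σ => g fun i => ((d₀.permute σ).degree i : ℤ)) (fun u v σ => ?_) t).trans_eq ?_
  · refine (hg _ _).trans (mul_le_mul_of_nonneg_left ?_ hb)
    have h1 : vecDist (fun i => ((d₀.permute (swap u v * σ)).degree i : ℤ))
        (fun i => ((d₀.permute σ).degree i : ℤ)) =
        ∑ j, |((d₀.degree (swap u v j) : ℤ) : ℝ) - (d₀.degree j : ℤ)| :=
      Equiv.sum_comp σ fun j => |((d₀.degree (swap u v j) : ℤ) : ℝ) - (d₀.degree j : ℤ)|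
    have h2 : ∀ j, |((d₀.degree (swap u v j) : ℤ) : ℝ) - (d₀.degree j : ℤ)| ≤
        (if j = u then (Λ.natDegree : ℝ) else 0) + if j = v then (Λ.natDegree : ℝ) else 0 := by
      intro j
      by_cases hj : j = u ∨ j = v
      · have h3 : ∀ i, (d₀.degree i : ℝ) ∈ Set.Icc 0 (Λ.natDegree : ℝ) := fun i =>
          ⟨Nat.cast_nonneg _, by exact_mod_cast Nat.lt_succ_iff.1 (d₀.1 i).2⟩
        have h4 : |((d₀.degree (swap u v j) : ℤ) : ℝ) - (d₀.degree j : ℤ)| ≤ Λ.natDegree := by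
          push_cast
          have h5 := h3 (swap u v j)
          have h6 := h3 j
          exact abs_le.2 ⟨by linarith [h5.1, h6.2], by linarith [h5.2, h6.1]⟩
        have h0 : (0 : ℝ) ≤ Λ.natDegree := Nat.cast_nonneg _
        refine h4.trans ?_
        rcases hj with rfl | rfl
        · rw [if_pos rfl]
          exact le_add_of_nonneg_right (by split_ifs <;> simp)
        · rw [if_pos rfl]
          exact le_add_of_nonneg_left (by split_ifs <;> simp)
      · rw [not_or] at hj
        rw [swap_apply_of_ne_of_ne hj.1 hj.2, if_neg hj.1, if_neg hj.2]
        simp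
    rw [h1]
    refine (Finset.sum_le_sum fun j _ => h2 j).trans_eq ?_
    rw [Finset.sum_add_distrib, Finset.sum_ite_eq', Finset.sum_ite_eq']
    simp [two_mul]
  · ring_nf

theorem sum_degree (d : DegreeAssignment n Λ) : ∑ i, (d.degree i : ℝ) = n * meanDegree Λ := by
  rw [meanDegree_eq, ← Finset.sum_fiberwise Finset.univ d.1, Finset.sum_range, Finset.mul_sum]
  refine Finset.sum_congr rfl fun l _ => ?_
  rw [← mul_assoc, ← d.2 l, ← nsmul_eq_mul, ← Finset.sum_const]
  refine Finset.sum_congr rfl fun i hi => ?_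
  rw [← (Finset.mem_filter.1 hi).2]
  rfl

end UniformDegrees

/-! ## Multi-Poisson ensembles -/

section MultiPoisson

variable {n : ℕ} [NeZero n] {a γ : ℝ} {P : Polynomial ℝ}

/-- Unless many sockets are used up, padding the socket laws has no effect. -/
theorem abs_expect_multiPoissonRounds_sub_le (ha : 0 < a) (fail : PMF (TannerGraph n))
    {f : TannerGraph n → ℝ} (hf : ∀ G, |f G| ≤ 1) {θ : ℝ} (hθ : 0 ≤ θ) {M : ℝ}
    (hM : Real.exp (((List.range' 2 (P.natDegree - 1)).map fun k =>
      (checkRate n γ P k : ℝ) * (Real.exp (θ * k) - 1)).sum) ≤ M) (t : ℕ) (d : Fin n → ℤ)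
    (G : TannerGraph n) :
    |expect (multiPoissonRounds γ P fail t d G) f - expect (paddedRounds a ha γ P t d G) f| ≤
      2 * (∑ j ∈ Finset.range t, M ^ j) * Real.exp (θ * (a - ∑ i, (d i : ℝ))) := by
  have hb : IsBdd f := ⟨1, hf⟩
  have hM0 : 0 ≤ M := (Real.exp_pos _).le.trans hM
  induction t generalizing d G with
  | zero => simp [multiPoissonRounds, paddedRounds]
  | succ t ih =>
    set S := ∑ j ∈ Finset.range t, M ^ j with hS
    have hS0 : 0 ≤ S := Finset.sum_nonneg fun j _ => pow_nonneg hM0 j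
    set e := Real.exp (θ * (a - ∑ i, (d i : ℝ))) with he
    have he0 : 0 < e := Real.exp_pos _
    rw [geom_sum_succ, ← hS]
    -- The signed total is followed because each edge lowers it by exactly one. If it is at least
    -- `a`, so is the number of free sockets: there is no failure, the two laws agree, and the
    -- recursion proceeds. If it is below `a`, the right-hand side is at least 2 and the claim is
    -- trivial.
    rcases le_or_gt a (∑ i, (d i : ℝ)) with had | had
    · have hex : ∃ i, 0 < d i := by
        by_contra! hcon
        exact absurd (had.trans (Finset.sum_nonpos fun i _ => by exact_mod_cast hcon i)) ha.not_ge
      have hfree : a ≤ freeSockets d := had.trans (Finset.sum_le_sum fun i _ => by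
        exact_mod_cast Int.self_le_toNat (d i))
      rw [expect_paddedRounds_succ ha hb, multiPoissonRounds, dif_pos hex,
        socketLaw_eq_paddedLaw ha hex hfree, expect_bind _ _ hb,
        ← expect_sub (isBdd_expect hb _) (isBdd_expect hb _)]
      set F : TannerGraph n → ℝ := fun R =>
        expect (multiPoissonRounds γ P fail t (remaining d R) (G ++ R)) f -
          expect (paddedRounds a ha γ P t (remaining d R) (G ++ R)) f with hF
      have hFb : IsBdd F := (isBdd_expect hb _).sub (isBdd_expect hb _)
      -- Averaging this bound over the round costs one factor `M`, the exponential moment of the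
      -- number of new edges; this builds the geometric sum.
      have hexp : ∀ R, |F R| ≤ 2 * S * e * Real.exp (θ * R.flatten.length) := by
        intro R
        refine (ih (remaining d R) (G ++ R)).trans_eq ?_
        rw [sum_remaining, he, mul_assoc (2 * S), ← Real.exp_add]
        ring_nf
      have h1 : |expect (poissonRound (paddedLaw a ha d) γ P) F| ≤ 2 * S * e * M := by
        refine abs_le'.2 ⟨?_, ?_⟩
        · exact (expect_poissonChecks_le_of_le_exp _ _ _ hFb fun R =>
            (le_abs_self _).trans (hexp R)).trans (mul_le_mul_of_nonneg_left hM (by positivity))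
        · rw [← neg_one_mul, ← expect_const_mul]
          exact (expect_poissonChecks_le_of_le_exp _ _ _ ((IsBdd.const (-1)).mul hFb) fun R =>
            (by rw [neg_one_mul]; exact (neg_le_abs _).trans (hexp R))).trans
            (mul_le_mul_of_nonneg_left hM (by positivity))
      refine h1.trans ?_
      nlinarith
    · have he1 : 1 ≤ e := Real.one_le_exp (mul_nonneg hθ (sub_nonneg.2 had.le))
      have h1 : ∀ p : PMF (TannerGraph n), |expect p f| ≤ 1 := fun p =>
        abs_expect_le hb fun G _ => hf G
      refine (abs_sub _ _).trans ((add_le_add (h1 _) (h1 _)).trans ?_)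
      have : 0 ≤ M * S := mul_nonneg hM0 hS0
      nlinarith

/-- From `exp x - 1 ≤ x + x²` for `x = θ k ≤ 1`: the first order is the mean number `n γ` of edges,
and the relative error is at most `θ * P.natDegree`. -/
theorem sum_checkRate_mul_exp_sub_one_le (hP : IsDegreeSequence P) (hγ : 0 < γ) (n : ℕ) {θ : ℝ}
    (hθ : 0 ≤ θ) (hK : θ * P.natDegree ≤ 1) :
    ((List.range' 2 (P.natDegree - 1)).map fun k =>
      (checkRate n γ P k : ℝ) * (Real.exp (θ * k) - 1)).sum ≤
      n * γ * (θ * (1 + θ * P.natDegree)) := by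
  rw [← sum_checkRate_mul_degree hP hγ, ← List.sum_map_mul_right]
  refine List.sum_le_sum fun k hk => ?_
  have hkK : (k : ℝ) ≤ P.natDegree := by exact_mod_cast le_natDegree_of_mem_range' hk
  have hk0 : (0 : ℝ) ≤ k := Nat.cast_nonneg k
  have h1 : θ * k ≤ θ * P.natDegree := mul_le_mul_of_nonneg_left hkK hθ
  have h2 := Real.abs_exp_sub_one_sub_id_le (x := θ * k)
    (by rw [abs_of_nonneg (by positivity)]; exact h1.trans hK)
  rw [mul_assoc]
  refine mul_le_mul_of_nonneg_left ?_ (NNReal.coe_nonneg _)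
  have h3 : θ * k * (θ * k) ≤ θ * k * (θ * P.natDegree) :=
    mul_le_mul_of_nonneg_left h1 (by positivity)
  nlinarith [(abs_le.1 h2).2]

/-- The multi-Poisson ensemble with padded socket laws. -/
def paddedEnsemble (n : ℕ) [NeZero n] (Λ P : Polynomial ℝ) (γ a : ℝ) (ha : 0 < a)
    [Nonempty (DegreeAssignment n Λ)] : PMF (TannerGraph n) :=
  (PMF.uniformOfFintype (DegreeAssignment n Λ)).bind fun d =>
    paddedRounds a ha γ P (⌊meanDegree Λ / γ⌋₊ - 1) (fun i => (d.degree i : ℤ)) []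

/-- Before the last of `T` rounds about `(T - 1) n γ` edges have been drawn, while `n Λ'(1) ≥ (T +
1) n γ`. On average at least `2 n γ` sockets are then left, twice the padding threshold, and a
Chernoff bound makes a shortage exponentially unlikely. -/
theorem exists_abs_expect_multiPoissonEnsemble_sub_le {Λ : Polynomial ℝ}
    (hΛ : IsDegreeSequence Λ) (hP : IsDegreeSequence P) (hγ : 0 < γ) :
    ∃ D c : ℝ, 0 < D ∧ 0 < c ∧ ∀ (n : ℕ) [NeZero n] [Nonempty (DegreeAssignment n Λ)]
      (fail : PMF (TannerGraph n)) (a : ℝ) (ha : 0 < a), a = n * γ →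
      ∀ f : TannerGraph n → ℝ, (∀ G, |f G| ≤ 1) →
      |expect (multiPoissonEnsemble n Λ P γ fail) f - expect (paddedEnsemble n Λ P γ a ha) f| ≤
        D * Real.exp (-(n * c)) := by
  have hmd := hΛ.meanDegree_pos
  set m := meanDegree Λ with hm
  set T := ⌊m / γ⌋₊ - 1 with hT
  set K : ℝ := (P.natDegree : ℝ)
  have hK : 0 ≤ K := Nat.cast_nonneg _
  -- Small enough for the quadratic estimate (`θ K ≤ 1`) and for the second-order error to take at
  -- most half of the reserve (`m θ K ≤ γ / 2`).
  set θ := min 1 (γ / (2 * m)) / (K + 1) with hθdef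
  have hθ : 0 < θ := div_pos (lt_min one_pos (by positivity)) (by positivity)
  have hθK : θ * K ≤ min 1 (γ / (2 * m)) := by
    rw [hθdef, div_mul_eq_mul_div, div_le_iff₀ (by positivity)]
    exact mul_le_mul_of_nonneg_left (by linarith) (lt_min one_pos (by positivity)).le
  have hθK1 := hθK.trans (min_le_left _ _)
  have hθKm : m * (θ * K) ≤ γ / 2 := by
    refine (mul_le_mul_of_nonneg_left (hθK.trans (min_le_right _ _)) hmd.le).trans_eq ?_
    field_simp
  -- The summand 1 only keeps the constant positive when there is no round.
  refine ⟨2 * T + 1, θ * γ / 2, by positivity, by positivity, fun n _ _ fail a ha han f hf => ?_⟩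
  have hn : (0 : ℝ) < n := Nat.cast_pos.2 (NeZero.pos n)
  have hb : IsBdd f := ⟨1, hf⟩
  rw [multiPoissonEnsemble, paddedEnsemble, expect_bind _ _ hb, expect_bind _ _ hb]
  refine abs_expect_sub_le (isBdd_expect hb _) (isBdd_expect hb _) fun d _ => ?_
  set x := n * γ * (θ * (1 + θ * K)) with hx
  have hx0 : 0 ≤ x := by positivity
  refine (abs_expect_multiPoissonRounds_sub_le ha fail hf hθ.le
    (Real.exp_le_exp.2 (sum_checkRate_mul_exp_sub_one_le hP hγ n hθ.le hθK1)) _ _ _).trans ?_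
  have hsum : ∑ i, (((d.degree i : ℤ) : ℝ)) = n * m := by
    simpa using sum_degree d
  rw [hsum, ← hT]
  rcases Nat.eq_zero_or_pos T with h0 | h0
  · rw [h0, Finset.sum_range_zero, mul_zero, zero_mul]
    positivity
  · have h1 : ∑ j ∈ Finset.range T, Real.exp x ^ j ≤ T * Real.exp ((T - 1) * x) := by
      refine (Finset.sum_le_card_nsmul _ _ (Real.exp ((T - 1) * x)) fun j hj => ?_).trans_eq ?_
      · rw [← Real.exp_nat_mul]
        have : (j : ℝ) + 1 ≤ T := by exact_mod_cast Finset.mem_range.1 hj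
        exact Real.exp_le_exp.2 (mul_le_mul_of_nonneg_right (by linarith) hx0)
      · rw [Finset.card_range, nsmul_eq_mul]
    have hTm : (T + 1) * γ ≤ m := by
      have h2 : ((T + 1 : ℕ) : ℝ) ≤ m / γ :=
        (Nat.cast_le.2 (by omega : T + 1 ≤ ⌊m / γ⌋₊)).trans (Nat.floor_le (by positivity))
      rw [le_div_iff₀ hγ] at h2
      exact_mod_cast h2
    have hexp : (T - 1) * x + θ * (a - n * m) ≤ -(n * (θ * γ / 2)) := by
      have h3 : (T - 1) * γ * (θ * K) ≤ γ / 2 :=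
        (mul_le_mul_of_nonneg_right (by linarith) (by positivity)).trans hθKm
      have h4 : (T - 1) * γ * (1 + θ * K) + γ - m ≤ -(γ / 2) := by linarith
      have h5 := mul_le_mul_of_nonneg_left h4 (by positivity : 0 ≤ n * θ)
      rw [han, hx]
      linarith
    calc 2 * (∑ j ∈ Finset.range T, Real.exp x ^ j) * Real.exp (θ * (a - n * m))
        ≤ 2 * (T * Real.exp ((T - 1) * x)) * Real.exp (θ * (a - n * m)) := by gcongr
      _ = 2 * T * Real.exp ((T - 1) * x + θ * (a - n * m)) := by rw [Real.exp_add]; ring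
      _ ≤ (2 * T + 1) * Real.exp (-(n * (θ * γ / 2))) := by
        gcongr
        linarith

/-- Concentration is inherited by a law at exponentially small distance. -/
theorem tailProb_le_of_abs_expect_sub_le {L L' : PMF (TannerGraph n)} {H : TannerGraph n → ℝ}
    (hH : ∀ G, H G ∈ Set.Icc 0 (n : ℝ)) {B' c D : ℝ} (hB' : 0 < B') (hc : 0 < c) (hD : 0 < D)
    (hclose : ∀ f : TannerGraph n → ℝ, (∀ G, |f G| ≤ 1) →
      |expect L f - expect L' f| ≤ D * Real.exp (-(n * c)))
    (htail : ∀ ε, 0 < ε →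
      tailProb L' H (expect L' H) (n * ε) ≤ 2 * Real.exp (-(n * B' * ε ^ 2)))
    {ε : ℝ} (hε : 0 < ε) (hε1 : ε ≤ 1) :
    tailProb L H (expect L H) (n * ε) ≤
      (2 + D + Real.exp (min (B' / 4) c * (2 * (D / c)))) *
        Real.exp (-(n * min (B' / 4) c * ε ^ 2)) := by
  have hn : (0 : ℝ) < n := Nat.cast_pos.2 (NeZero.pos n)
  set B := min (B' / 4) c with hB
  have hB0 : 0 < B := lt_min (by positivity) hc
  -- Testing with `H / n`, which lies in `[0, 1]`, gives the bound `n D exp (-n c)`, and `n c ≤ exp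
  -- (n c)`.
  have hmean : |expect L H - expect L' H| ≤ D / c := by
    have h1 := hclose (fun G => (1 / n) * H G) fun G => by
      rw [abs_of_nonneg (mul_nonneg (by positivity) (hH G).1), one_div_mul_eq_div]
      exact div_le_one_of_le₀ (hH G).2 hn.le
    rw [expect_const_mul, expect_const_mul, ← mul_sub, abs_mul, abs_of_pos (by positivity),
      one_div_mul_eq_div, div_le_iff₀ hn] at h1
    refine h1.trans ?_
    rw [le_div_iff₀ hc, Real.exp_neg, mul_assoc, mul_assoc]
    refine mul_le_of_le_one_right hD.le ?_
    rw [inv_mul_le_iff₀ (Real.exp_pos _), mul_one]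
    linarith [Real.add_one_le_exp (n * c)]
  -- For small `n ε` the prefactor already makes the bound at least 1. Otherwise the shift of the
  -- mean takes at most half of the deviation, and halving `ε` is the reason for `B' / 4`.
  rcases le_or_gt (n * ε) (2 * (D / c)) with hs | hl
  · have h1 : tailProb L H (expect L H) (n * ε) ≤ 1 :=
      expect_le (IsBdd.ite _) fun x _ => by split_ifs <;> simp
    have h2 : n * B * ε ^ 2 ≤ B * (2 * (D / c)) := by
      have : n * ε * ε ≤ n * ε := mul_le_of_le_one_right (by positivity) hε1
      nlinarith
    have h3 : 1 ≤ Real.exp (B * (2 * (D / c))) * Real.exp (-(n * B * ε ^ 2)) := by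
      rw [← Real.exp_add]
      exact Real.one_le_exp (by linarith)
    refine h1.trans (h3.trans (mul_le_mul_of_nonneg_right ?_ (Real.exp_pos _).le))
    linarith
  · have h1 : tailProb L H (expect L H) (n * ε) ≤ tailProb L H (expect L' H) (n * (ε / 2)) := by
      refine expect_mono (IsBdd.ite _) (IsBdd.ite _) fun G _ => ?_
      by_cases h : n * ε < |H G - expect L H|
      · have h2 := abs_sub_le (H G) (expect L' H) (expect L H)
        rw [abs_sub_comm (expect L' H)] at h2
        rw [if_pos h, if_pos (by linarith)]
      · rw [if_neg h]
        split_ifs <;> simp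
    have h2 := (abs_le.1 (hclose (fun G => if n * (ε / 2) < |H G - expect L' H| then 1 else 0)
      fun G => by split_ifs <;> simp)).2
    have h3 := htail (ε / 2) (by positivity)
    have h4 : Real.exp (-(n * B' * (ε / 2) ^ 2)) ≤ Real.exp (-(n * B * ε ^ 2)) := by
      have : n * ε ^ 2 * B ≤ n * ε ^ 2 * (B' / 4) :=
        mul_le_mul_of_nonneg_left (min_le_left _ _) (by positivity)
      exact Real.exp_le_exp.2 (by linarith)
    have h5 : Real.exp (-(n * c)) ≤ Real.exp (-(n * B * ε ^ 2)) := by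
      have h6 : B * ε ^ 2 ≤ c :=
        (mul_le_of_le_one_right hB0.le (pow_le_one₀ hε.le hε1)).trans (min_le_right _ _)
      have := mul_le_mul_of_nonneg_left h6 hn.le
      exact Real.exp_le_exp.2 (by linarith)
    have h7 : tailProb L H (expect L' H) (n * (ε / 2)) -
        tailProb L' H (expect L' H) (n * (ε / 2)) ≤ D * Real.exp (-(n * c)) := h2
    have h8 := mul_le_mul_of_nonneg_left h5 hD.le
    have h9 := (mul_pos (Real.exp_pos (B * (2 * (D / c)))) (Real.exp_pos (-(n * B * ε ^ 2)))).le
    linarith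

theorem centeredMgf_paddedEnsemble_le {Λ : Polynomial ℝ} [Nonempty (DegreeAssignment n Λ)]
    (ha : 0 < a) (hP : IsDegreeSequence P) (hγ : 0 < γ) (han : a = n * γ) {H : TannerGraph n → ℝ}
    (hH : IsBdd H) (h : InsertLipschitz P.natDegree 1 H) {T : ℕ} (hT : T = ⌊meanDegree Λ / γ⌋₊ - 1)
    {b A s : ℝ} (hb : b = socketLipschitz P.natDegree T) (hA : A = 1 + P.natDegree * b)
    (hs : 2 * |s| * A ≤ 1) :
    centeredMgf (paddedEnsemble n Λ P γ a ha) H s ≤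
      Real.exp (n * (T * (8 * (γ / meanDegree P) * A ^ 2) + 8 * (b * Λ.natDegree) ^ 2) * s ^ 2) := by
  subst hT hb
  refine (centeredMgf_bind_le _ _ hH fun d _ =>
    centeredMgf_paddedRounds_le ha hP hγ hH h han hs _ hA.ge _ _).trans ?_
  refine (mul_le_mul_of_nonneg_right (centeredMgf_uniform_degreeAssignment_le
    (socketLipschitz_nonneg _ _) (fun d d' =>
      abs_expect_paddedRounds_sub_le ha hP hγ hH h han (⌊meanDegree Λ / γ⌋₊ - 1) d d' []) s)
    (Real.exp_pos _).le).trans_eq ?_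
  rw [← Real.exp_add]
  ring_nf

theorem multiPoissonEnsemble_concentrates {𝒜 : Type*} [MeasurableSpace 𝒜] {W : BinaryChannel 𝒜}
    {κ : CodeKind} (hW : κ = CodeKind.ldpc → W.OutputSymmetric) {Λ : Polynomial ℝ}
    (hΛ : IsDegreeSequence Λ) (hP : IsDegreeSequence P) (hγ : 0 < γ) :
    ∃ A B : ℝ, 0 < A ∧ 0 < B ∧ ∀ (n : ℕ) [NeZero n] [Nonempty (DegreeAssignment n Λ)]
      (fail : PMF (TannerGraph n)),
      ConcentratesWith A B (multiPoissonEnsemble n Λ P γ fail) (codeEntropy κ W) := by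
  obtain ⟨D, c, hD, hc, hclose⟩ := exists_abs_expect_multiPoissonEnsemble_sub_le hΛ hP hγ
  have hmd := hP.meanDegree_pos
  set T := ⌊meanDegree Λ / γ⌋₊ - 1 with hT
  set b := socketLipschitz P.natDegree T with hb
  have hb0 : 0 ≤ b := socketLipschitz_nonneg _ _
  set A := 1 + P.natDegree * b with hA
  have hA0 : 0 < A := by positivity
  set v := T * (8 * (γ / meanDegree P) * A ^ 2) + 8 * (b * Λ.natDegree) ^ 2 with hv
  have hv0 : 0 ≤ v := by positivity
  -- The rate `v` vanishes when there is no round, so `v + 1` is used as a positive variance proxy;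
  -- `1 / (2 * A)` is the range of `s` permitted by the Poisson rounds.
  set B' := min (1 / (2 * A)) (1 / (2 * (v + 1))) / 2 with hB'
  have hB'0 : 0 < B' := by positivity
  refine ⟨2 + D + Real.exp (min (B' / 4) c * (2 * (D / c))), min (B' / 4) c, by positivity,
    by positivity, fun n _ _ fail => ?_⟩
  have ha : 0 < n * γ := mul_pos (Nat.cast_pos.2 (NeZero.pos n)) hγ
  have hI := codeEntropy_mem_Icc (n := n) κ W
  refine concentratesWith_of_tailProb hI (fun ε hε hε1 =>
    tailProb_le_of_abs_expect_sub_le hI hB'0 hc hD (hclose n fail (n * γ) ha rfl) (fun ε hε =>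
      tailProb_mgf_le hI (t₀ := 1 / (2 * A)) (v := v + 1) (by positivity) (by positivity)
        (fun s hs => ?_) hε) hε hε1) (by positivity)
  refine (centeredMgf_paddedEnsemble_le ha hP hγ rfl (isBdd_codeEntropy κ W)
    (insertLipschitz_codeEntropy hW _) hT hb hA ?_).trans ?_
  · rw [le_div_iff₀ (by positivity)] at hs
    linarith
  · rw [← hv]
    gcongr
    exact (lt_add_one v).le

end MultiPoisson

end

theorem mainTheorem2 {𝒜 : Type*} [MeasurableSpace 𝒜] (W : BinaryChannel 𝒜) (κ : CodeKind)
    (hW : κ = CodeKind.ldpc → W.OutputSymmetric)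
    (Λ P : Polynomial ℝ) (hΛ : IsDegreeSequence Λ) (hP : IsDegreeSequence P)
    (γ : ℝ) (hγ : 0 < γ) :
    (∃ A B : ℝ, 0 < A ∧ 0 < B ∧ ∀ (n : ℕ) [NeZero n] [Nonempty (StandardConfig n Λ P)],
      ConcentratesWith A B (standardEnsemble n Λ P) (codeEntropy κ W)) ∧
    (∃ A B : ℝ, 0 < A ∧ 0 < B ∧ ∀ (n : ℕ) [NeZero n],
      ConcentratesWith A B (poissonEnsemble n γ P) (codeEntropy κ W)) ∧
    (∃ A B : ℝ, 0 < A ∧ 0 < B ∧ ∀ (n : ℕ) [NeZero n] [Nonempty (DegreeAssignment n Λ)]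
      (fail : PMF (TannerGraph n)),
      ConcentratesWith A B (multiPoissonEnsemble n Λ P γ fail) (codeEntropy κ W)) := by
  exact ⟨standardEnsemble_concentrates hW Λ P, poissonEnsemble_concentrates hW hP hγ,
    multiPoissonEnsemble_concentrates hW hΛ hP hγ⟩
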